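/- **Setting.** Let finitely many elements $\kappa\subset\mathbb R^3$ with pairwise disjoint interiors be given. Each closed element $\bar\kappa$ is the image of a convex reference polytope $\hat\kappa$ with non-empty interior under a $C^1$ diffeomorphism between a neighbourhood of $\hat\kappa$ and a neighbourhood of $\bar\kappa$. Let $\mathcal D$ be the interior of $\bigcup_\kappa\bar\kappa$. Let $\mathcal U$ be the finite-dimensional discontinuous finite element space of functions that on each element are a polynomial in the reference coordinates, taken from a prescribed space (for example all polynomials of degree at most $r$); functions in $\mathcal U$ are identified with their coefficient vectors in a fixed basis. Let $\sigma_t>0$ and $\sigma_a$ be integrable on $\mathcal D$. Let $\Omega_d\in\mathbb S^2$, $w_d>0$ be finitely many quadrature directions and weights, invariant under $\Omega_d\mapsto-\Omega_d$, with $\sum_d w_d=4\pi$ and $\sum_d w_d\Omega_d\Omega_d^T=\frac{4\pi}3I$. On an interior face $\Gamma$ shared by $\kappa,\kappa'$, with unit normal $\mathbf n$ from $\kappa$ to $\kappa'$, put $[\![u]\!]=u_\kappa-u_{\kappa'}$ and $\{u\}=\frac12(u_\kappa+u_{\kappa'})$; on a boundary face, with outward normal $\mathbf n$, put $[\![u]\!]=u$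 and $\{u\}=\theta u$ with a fixed $\theta\in\mathbb R$ (for example $\theta=1$ or $\theta=\frac12$). Define matrices by $$\mathbf v^TM_t\mathbf u=\sum_\kappa\int_\kappa\sigma_tuv,\quad \mathbf v^TM_a\mathbf u=\sum_\kappa\int_\kappa\sigma_auv,\quad \mathbf v^TG_j\mathbf u=\sum_\kappa\int_\kappa(\partial_{x_j}u)v,$$ $$\mathbf v^TF^{(d)}\mathbf u=\sum_\Gamma\int_\Gamma\Big(-\Omega_d\cdot\mathbf n[\![u]\!]\{v\}+\tfrac12|\Omega_d\cdot\mathbf n|[\![u]\!][\![v]\!]\Big)dS,$$ $$\mathbf v^T\tilde F^{(d)}\mathbf u=\sum_\Gamma\int_\Gamma\Big(\Omega_d\cdot\mathbf n\{u\}[\![v]\!]+\tfrac12|\Omega_d\cdot\mathbf n|[\![u]\!][\![v]\!]\Big)dS,$$ the sums being over all interior and boundary faces, and $\Omega_d\cdot\mathbf G=\sum_{j=1}^3(\Omega_d)_jG_j$, $F_0=\frac1{4\pi}\sum_dw_dF^{(d)}$, $F_{1,j}=\frac1{4\pi}\sum_dw_d(\Omega_d)_jF^{(d)}$, $\tilde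 F_{1,j}=\frac1{4\pi}\sum_dw_d(\Omega_d)_j\tilde F^{(d)}$, $$D_0=\tfrac13\sum_jG_j^TM_t^{-1}G_j-\sum_j\tilde F_{1,j}M_t^{-1}G_j+\sum_jG_j^TM_t^{-1}F_{1,j}+M_a,$$ $$S_\varepsilon=\sum_dw_d\big(I+\varepsilon M_t^{-1}(\Omega_d\cdot\mathbf G+F^{(d)})\big)^{-1}\tfrac1{4\pi}\big(I-\varepsilon^2M_t^{-1}M_a\big).$$ **Theorem.** Let $P$ be a (not necessarily orthogonal) projection onto the subspace of those functions in $\mathcal U$ that are continuous on $\overline{\mathcal D}$ and vanish on $\partial\mathcal D$, and let $Q=I-P$. Then $Q^TF_0Q$ is invertible as a map from the range of $Q$ to the range of $Q^T$, and, if $\sigma_a>0$ on $\mathcal D$, $P^TD_0P$ is invertible as a map from the range of $P$ to the range of $P^T$. Whenever the latter map is invertible, put, with the inverses of these maps (which do not depend on $\varepsilon$), $$E_P=P(P^TD_0P)^{-1}P^T,\qquad E_Q=Q(Q^TF_0Q)^{-1}Q^T,$$ $$E_\varepsilon=\tfrac1\varepsilon E_P+(I-E_PD_0)E_Q(I-D_0E_P).$$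 Then, as $\varepsilon\to0^+$ with everything else fixed, $$\tfrac1\varepsilon E_\varepsilon M_t(I-S_\varepsilon)=I+\mathcal O(\varepsilon).$$ -/

import Mathlib

open scoped InnerProductSpace Matrix Topology

noncomputable section

/-- Physical and reference space `ℝ³` with its Euclidean norm. -/
abbrev E3 : Type := EuclideanSpace ℝ (Fin 3)

/-- A reference element: a bounded convex polytope with non-empty interior, given as an
intersection of half-spaces `⟪normal i, y⟫ ≤ offset i` with unit outward normals (no half-space is
listed twice). Tetrahedra, hexahedra, prisms and pyramids are examples. -/
structure RefPolytope where
  nFacets : ℕ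
  normal : Fin nFacets → E3
  offset : Fin nFacets → ℝ
  norm_normal : ∀ i, ‖normal i‖ = 1
  distinct : Function.Injective fun i => (normal i, offset i)
  bounded : Bornology.IsBounded {y : E3 | ∀ i, ⟪normal i, y⟫_ℝ ≤ offset i}
  solid : (interior {y : E3 | ∀ i, ⟪normal i, y⟫_ℝ ≤ offset i}).Nonempty

/-- The closed polytope. -/
def RefPolytope.carrier (K : RefPolytope) : Set E3 :=
  {y | ∀ i, ⟪K.normal i, y⟫_ℝ ≤ K.offset i}

/-- The area (two-dimensional Lebesgue) measure of the plane `{y | ⟪a, y⟫ = c}`, for a unit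
vector `a`: the plane is the translate by `c • a` of the orthogonal complement of `a`. -/
def planeArea (a : E3) (c : ℝ) : MeasureTheory.Measure E3 :=
  MeasureTheory.Measure.map (fun z : (ℝ ∙ a)ᗮ => c • a + (z : E3)) MeasureTheory.volume

/-- A mesh of finitely many (possibly curved) elements. Element `e` is the image of a reference
polytope under a `C¹` diffeomorphism between a neighbourhood of the polytope and a neighbourhood
of the closed element; distinct elements have disjoint interiors. `localSpace e` is the space of
polynomials on the reference polytope, for instance those of total degree at most `r`, or those of
degree at most `r` in each variable. -/
structure DGMesh where
  nElem : ℕ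
  ref : Fin nElem → RefPolytope
  map : Fin nElem → OpenPartialHomeomorph E3 E3
  subset_source : ∀ e, (ref e).carrier ⊆ (map e).source
  contDiffOn_map : ∀ e, ContDiffOn ℝ 1 (map e) (map e).source
  contDiffOn_symm : ∀ e, ContDiffOn ℝ 1 (map e).symm (map e).target
  disjoint : ∀ e e', e ≠ e' →
    Disjoint (map e '' interior (ref e).carrier) (map e' '' interior (ref e').carrier)
  localSpace : Fin nElem → Submodule ℝ (MvPolynomial (Fin 3) ℝ)

namespace DGMesh

variable (M : DGMesh)

/-- The open element. -/
def elem (e : Fin M.nElem) : Set E3 := M.map e '' interior (M.ref e).carrier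

/-- The closed element. -/
def closedElem (e : Fin M.nElem) : Set E3 := M.map e '' (M.ref e).carrier

/-- The spatial domain decomposed by the mesh. -/
def domain : Set E3 := interior (⋃ e, M.closedElem e)

/-- The discontinuous finite element space: one polynomial on each reference element. -/
abbrev Space : Type := (e : Fin M.nElem) → M.localSpace e

/-- The restriction `u_κ` of a discrete function to the element `e`, as a function of the physical
variable; it is meaningful on the closed element. -/
def val (u : M.Space) (e : Fin M.nElem) (x : E3) : ℝ :=
  MvPolynomial.eval (fun j => (M.map e).symm x j) (u e : MvPolynomial (Fin 3) ℝ)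

/-- The discrete function `u` is continuous on the closed domain and zero on its boundary. -/
def ContinuousZeroBoundary (u : M.Space) : Prop :=
  ∃ g : E3 → ℝ, ContinuousOn g (closure M.domain) ∧
    (∀ e, ∀ x ∈ M.closedElem e, g x = M.val u e x) ∧ ∀ x ∈ frontier M.domain, g x = 0

/-- The gradient of the function `x ↦ ⟪aᵢ, y(x)⟫`, with `y(x)` the reference coordinates of `x`,
which is constant on the facet `i` of the element `e` and smaller inside the element. -/
def facetGrad (e : Fin M.nElem) (i : Fin (M.ref e).nFacets) (x : E3) : E3 :=
  gradient (fun x' => ⟪(M.ref e).normal i, (M.map e).symm x'⟫_ℝ) x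

/-- The outward unit normal of the element `e` at a point `x` of its facet `i`. -/
def facetNormal (e : Fin M.nElem) (i : Fin (M.ref e).nFacets) (x : E3) : E3 :=
  ‖M.facetGrad e i x‖⁻¹ • M.facetGrad e i x

/-- The ratio of the physical and the reference area elements on the facet `i` of `e`,
`|det Φ'(y)| ‖Φ'(y)⁻ᵀ aᵢ‖` (Nanson's formula); the vector `Φ'(y)⁻ᵀ aᵢ` is `facetGrad` at `Φ(y)`. -/
def areaDensity (e : Fin M.nElem) (i : Fin (M.ref e).nFacets) (y : E3) : ℝ :=
  |(fderiv ℝ (M.map e) y).det| * ‖M.facetGrad e i (M.map e y)‖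

/-- The surface integral of `f` over the part in `T` of the facet `i` of the element `e`. -/
def facetIntegral (e : Fin M.nElem) (i : Fin (M.ref e).nFacets) (T : Set E3) (f : E3 → ℝ) : ℝ :=
  ∫ y in {y | y ∈ (M.ref e).carrier ∧ M.map e y ∈ T},
    f (M.map e y) * M.areaDensity e i y ∂(planeArea ((M.ref e).normal i) ((M.ref e).offset i))

/-- The sum over all faces of the surface integrals of `h n ⟦u⟧ {u} ⟦v⟧ {v}`. An interior face is
the part of a facet of `e` that lies in another closed element `e'`, where `e < e'` fixes the sign
of the normal (from `e` to `e'`) and of the jump; a boundary face is the part of a facet that lies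
in the boundary of the domain. On a boundary face the jump is `u` and the average is `θ u`. -/
def faceSum (θ : ℝ) (h : E3 → ℝ → ℝ → ℝ → ℝ → ℝ) (u v : M.Space) : ℝ :=
  (∑ e, ∑ e', if e < e' then
      ∑ i, M.facetIntegral e i (M.closedElem e') (fun x => h (M.facetNormal e i x)
        (M.val u e x - M.val u e' x) ((M.val u e x + M.val u e' x) / 2)
        (M.val v e x - M.val v e' x) ((M.val v e x + M.val v e' x) / 2))
    else 0) +
  ∑ e, ∑ i, M.facetIntegral e i (frontier M.domain) (fun x => h (M.facetNormal e i x)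
    (M.val u e x) (θ * M.val u e x) (M.val v e x) (θ * M.val v e x))

/-- The form `∑_κ ∫_κ s u v dx`. -/
def massForm (s : E3 → ℝ) (u v : M.Space) : ℝ :=
  ∑ e, ∫ x in M.elem e, s x * M.val u e x * M.val v e x

/-- The form `∑_κ ∫_κ (∂u/∂x_j) v dx`. -/
def derivForm (j : Fin 3) (u v : M.Space) : ℝ :=
  ∑ e, ∫ x in M.elem e, fderiv ℝ (M.val u e) x (EuclideanSpace.single j 1) * M.val v e x

/-- The upwind face form for the direction `ω`. -/
def upwindForm (θ : ℝ) (ω : E3) (u v : M.Space) : ℝ :=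
  M.faceSum θ (fun n ju _ jv av => -(⟪ω, n⟫_ℝ * ju * av) + 1 / 2 * |⟪ω, n⟫_ℝ| * ju * jv) u v

/-- The face form that replaces the upwind form after an integration by parts. -/
def upwindFormTilde (θ : ℝ) (ω : E3) (u v : M.Space) : ℝ :=
  M.faceSum θ (fun n ju au jv _ => ⟪ω, n⟫_ℝ * au * jv + 1 / 2 * |⟪ω, n⟫_ℝ| * ju * jv) u v

end DGMesh

/-- A discrete ordinates quadrature on the unit sphere: positive weights, invariance under
reversal of directions, and the zeroth and second moments of the uniform measure. -/
structure AngularQuadrature where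
  nDir : ℕ
  dir : Fin nDir → E3
  weight : Fin nDir → ℝ
  norm_dir : ∀ d, ‖dir d‖ = 1
  weight_pos : ∀ d, 0 < weight d
  rev : Equiv.Perm (Fin nDir)
  dir_rev : ∀ d, dir (rev d) = -dir d
  weight_rev : ∀ d, weight (rev d) = weight d
  sum_weight : ∑ d, weight d = 4 * Real.pi
  sum_weight_mul : ∀ j k : Fin 3,
    ∑ d, weight d * (dir d j * dir d k) = if j = k then 4 * Real.pi / 3 else 0

/-- A discontinuous Galerkin discretization of the `S_N` transport equation: mesh, quadrature,
opacities, the weight `θ` in the average `{u} = θ u` on boundary faces, and a finite element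
basis. -/
structure TransportDG where
  mesh : DGMesh
  quad : AngularQuadrature
  σt : E3 → ℝ
  σa : E3 → ℝ
  σt_pos : ∀ x ∈ mesh.domain, 0 < σt x
  σt_int : MeasureTheory.IntegrableOn σt mesh.domain
  σa_int : MeasureTheory.IntegrableOn σa mesh.domain
  θ : ℝ
  N : ℕ
  basis : Module.Basis (Fin N) ℝ mesh.Space

namespace TransportDG

variable (A : TransportDG)

/-- Square matrices acting on coefficient vectors. -/
abbrev Mat : Type := Matrix (Fin A.N) (Fin A.N) ℝ

/-- The matrix `B` with `vᵀ B u = a(u, v)`. -/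
def matrixOf (a : A.mesh.Space → A.mesh.Space → ℝ) : A.Mat :=
  Matrix.of fun m n => a (A.basis n) (A.basis m)

/-- `M_t` -/
def Mt : A.Mat := A.matrixOf (A.mesh.massForm A.σt)

/-- `M_a` -/
def Ma : A.Mat := A.matrixOf (A.mesh.massForm A.σa)

/-- The components of the vector of matrices `𝐆`. -/
def G (j : Fin 3) : A.Mat := A.matrixOf (A.mesh.derivForm j)

/-- `Ω_d · 𝐆` -/
def ΩG (d : Fin A.quad.nDir) : A.Mat := ∑ j, A.quad.dir d j • A.G j

/-- `F^{(d)}` -/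
def F (d : Fin A.quad.nDir) : A.Mat := A.matrixOf (A.mesh.upwindForm A.θ (A.quad.dir d))

/-- `F̃^{(d)}` -/
def Ftilde (d : Fin A.quad.nDir) : A.Mat :=
  A.matrixOf (A.mesh.upwindFormTilde A.θ (A.quad.dir d))

/-- `F_0` -/
def F0 : A.Mat := (1 / (4 * Real.pi)) • ∑ d, A.quad.weight d • A.F d

/-- The components of `𝐅_1`. -/
def F1 (j : Fin 3) : A.Mat :=
  (1 / (4 * Real.pi)) • ∑ d, (A.quad.weight d * A.quad.dir d j) • A.F d

/-- The components of `𝐅̃_1`. -/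
def F1tilde (j : Fin 3) : A.Mat :=
  (1 / (4 * Real.pi)) • ∑ d, (A.quad.weight d * A.quad.dir d j) • A.Ftilde d

/-- `D_0` -/
def D0 : A.Mat :=
  (1 / 3 : ℝ) • (∑ j, (A.G j)ᵀ * A.Mt⁻¹ * A.G j) - (∑ j, A.F1tilde j * A.Mt⁻¹ * A.G j)
    + (∑ j, (A.G j)ᵀ * A.Mt⁻¹ * A.F1 j) + A.Ma

/-- The source iteration matrix `S_ε`. -/
def S (ε : ℝ) : A.Mat :=
  ∑ d, A.quad.weight d • ((1 + ε • (A.Mt⁻¹ * (A.ΩG d + A.F d)))⁻¹ *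
    ((1 / (4 * Real.pi)) • (1 - ε ^ 2 • (A.Mt⁻¹ * A.Ma))))

/-- `P` is a (not necessarily orthogonal) projection onto the coefficient vectors of the
continuous discrete functions with zero boundary values. -/
def IsProjContinuous (P : A.Mat) : Prop :=
  P * P = P ∧ ∀ c : Fin A.N → ℝ,
    c ∈ LinearMap.range P.mulVecLin ↔
      A.mesh.ContinuousZeroBoundary (A.basis.equivFun.symm c)

end TransportDG

/-- `Pᵀ B P` as a linear map from the range of `P` to the range of `Pᵀ`. -/
def compression {N : ℕ} (P B : Matrix (Fin N) (Fin N) ℝ) :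
    LinearMap.range P.mulVecLin →ₗ[ℝ] LinearMap.range Pᵀ.mulVecLin :=
  (Pᵀ * B * P).mulVecLin.restrict fun x _ =>
    ⟨(B * P) *ᵥ x, by simp [Matrix.mul_assoc]⟩

open Classical in
/-- The matrix `P (Pᵀ B P)⁻¹ Pᵀ`, where `(Pᵀ B P)⁻¹` is the inverse of `Pᵀ B P` as a map from the
range of `P` to the range of `Pᵀ`; zero if this map is not invertible. -/
def projSolve {N : ℕ} (P B : Matrix (Fin N) (Fin N) ℝ) : Matrix (Fin N) (Fin N) ℝ :=
  if h : Function.Bijective (compression P B) then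
    LinearMap.toMatrix' (P.mulVecLin ∘ₗ (LinearMap.range P.mulVecLin).subtype ∘ₗ
      (LinearEquiv.ofBijective (compression P B) h).symm.toLinearMap ∘ₗ
      Pᵀ.mulVecLin.rangeRestrict)
  else 0

namespace TransportDG

variable (A : TransportDG)

/-- `E_P` -/
def EP (P : A.Mat) : A.Mat := projSolve P A.D0

/-- `E_Q`, with `Q = I - P` -/
def EQ (P : A.Mat) : A.Mat := projSolve (1 - P) A.F0

/-- The additive preconditioner `E_ε`. -/
def E (P : A.Mat) (ε : ℝ) : A.Mat :=
  (1 / ε) • A.EP P + (1 - A.EP P * A.D0) * A.EQ P * (1 - A.D0 * A.EP P)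

end TransportDG

end

/-! Write `H_d = Ω_d·G + F^{(d)}` and `A_d = M_t⁻¹ H_d`, and call a weighted sum over directions,
divided by `4π`, a mean. Expanding each resolvent to third order gives `M_t (I - S_ε) = ε F₀ + ε²
(M_a - mean of H_d M_t⁻¹ H_d) + O(ε³)`; the first coefficient is `F₀` because the first moment of
the quadrature vanishes. With `C = (I - E_P D₀) E_Q (I - D₀ E_P)`, the preconditioned operator is
therefore `I + O(ε)` as soon as the `ε⁻¹` term `E_P F₀` is zero and the `ε⁰` term is `I`. This
reduction is `preconditioned_isBigO`.

Both conditions rest on the fact that continuous functions with zero boundary values have no jumps.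
Hence `Pᵀ F₀ = 0`, `F₀ P = 0`, and integration by parts against such functions
(`dirDerivForm_add_upwindForm`) gives `Pᵀ H_d = -Pᵀ (Ω_d·G)ᵀ`. Inserting this in the left factor of
`H_d M_t⁻¹ H_d` and using the isotropic second moment turns `Pᵀ` times the second coefficient into
`Pᵀ D₀` (`transpose_mul_second_order`); the `F̃` term of `D₀` is annihilated by `Pᵀ`. Since `E_P =
E_P Pᵀ` and `E_Q F₀ = Q`, the `ε⁰` term is `E_P D₀ + (I - E_P D₀) Q = Q + E_P D₀ P = Q + P = I`.

For the invertibility of `Pᵀ D₀ P`, the flux terms drop out on the range of `P`, which leaves a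
positive semidefinite term plus `M_a`. For `Qᵀ F₀ Q`, the consistency terms of the upwind flux
cancel in the mean, so `F₀` is a jump penalty whose weight is positive for every unit normal.
Vanishing energy means that the jumps vanish almost everywhere on the faces, and it must be shown
that such a function is continuous in the pointwise sense, on a curved and possibly nonconforming
mesh. This is `continuousZeroBoundary_of_ae`: a function without jumps has a bounded weak gradient
on all of space, so its mollifications are uniformly Lipschitz and it has a Lipschitz extension.

The weak gradient and the integration by parts need a divergence theorem on curved polytopes
(`integral_elem_fderiv`), proved with smooth cutoffs, and the cancellation of fluxes between
neighbours. The latter holds because two facets are tangent at almost every common point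
(`ae_facetGrad_parallel`), have opposite normals there, and induce the same surface measure on their
intersection (`facetMeasure_restrict_eq`). -/

/-! ### Compressions to the range of a projection, and the resolvent expansion. -/

section LinearAlgebra

variable {N : ℕ}

/-- The solve begins by applying `Pᵀ`, which is idempotent. Identities known only after
multiplication by `Pᵀ` can therefore be used behind `E_P`. -/
theorem projSolve_mul_transpose {P : Matrix (Fin N) (Fin N) ℝ} (B : Matrix (Fin N) (Fin N) ℝ)
    (hP : P * P = P) : projSolve P B * Pᵀ = projSolve P B := by
  unfold projSolve
  split_ifs with h
  · apply (Matrix.toLin' (R := ℝ)).injective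
    rw [Matrix.toLin'_mul, Matrix.toLin'_toMatrix']
    refine LinearMap.ext fun y => ?_
    have : Pᵀ.mulVecLin.rangeRestrict (Pᵀ *ᵥ y) = Pᵀ.mulVecLin.rangeRestrict y := by
      apply Subtype.ext
      change Pᵀ *ᵥ (Pᵀ *ᵥ y) = Pᵀ *ᵥ y
      rw [Matrix.mulVec_mulVec, ← Matrix.transpose_mul, hP]
    simp only [LinearMap.comp_apply, Matrix.toLin'_apply, this]
  · simp

/-- The vector `Pᵀ (B P y)` is the image of `P y` under the compression, so the inverse returns `P
y`. -/
theorem projSolve_mul_mul {P B : Matrix (Fin N) (Fin N) ℝ} (hP : P * P = P)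
    (h : Function.Bijective (compression P B)) : projSolve P B * B * P = P := by
  unfold projSolve
  rw [dif_pos h]
  apply (Matrix.toLin' (R := ℝ)).injective
  rw [mul_assoc, Matrix.toLin'_mul, Matrix.toLin'_toMatrix']
  refine LinearMap.ext fun y => ?_
  have : Pᵀ.mulVecLin.rangeRestrict ((B * P) *ᵥ y)
      = LinearEquiv.ofBijective (compression P B) h ⟨P *ᵥ y, ⟨y, rfl⟩⟩ := by
    apply Subtype.ext
    simp [compression, mul_assoc, hP]
  simp only [LinearMap.comp_apply, Matrix.toLin'_apply, this, LinearEquiv.coe_coe,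
    LinearEquiv.symm_apply_apply]
  simp [hP]

/-- For `x = P x` in the kernel, `x · B x = x · Pᵀ B P x = 0`, so the kernel is trivial.
Surjectivity follows by dimension, as `P` and `Pᵀ` have equal rank. -/
theorem compression_bijective {P B : Matrix (Fin N) (Fin N) ℝ} (hP : P * P = P)
    (h : ∀ x, P *ᵥ x = x → x ⬝ᵥ B *ᵥ x = 0 → x = 0) : Function.Bijective (compression P B) := by
  have hinj : Function.Injective (compression P B) := by
    rw [← LinearMap.ker_eq_bot, LinearMap.ker_eq_bot']
    rintro ⟨x, hx⟩ h0
    obtain ⟨y, rfl⟩ := hx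
    have hPx : P *ᵥ (P.mulVecLin y) = P.mulVecLin y := by simp [hP]
    apply Subtype.ext
    refine h _ hPx ?_
    have h1 : (Pᵀ * B * P) *ᵥ (P.mulVecLin y) = 0 := congrArg Subtype.val h0
    have h2 : (P.mulVecLin y) ⬝ᵥ ((Pᵀ * B * P) *ᵥ (P.mulVecLin y)) = 0 := by rw [h1]; simp
    rw [← Matrix.mulVec_mulVec, hPx, ← Matrix.mulVec_mulVec, Matrix.dotProduct_mulVec,
      Matrix.vecMul_transpose, hPx] at h2
    exact h2
  refine ⟨hinj, ?_⟩
  rw [← LinearMap.injective_iff_surjective_of_finrank_eq_finrank]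
  · exact hinj
  · exact (Matrix.rank_transpose P).symm

theorem continuousAt_inv_one_add_smul (A : Matrix (Fin N) (Fin N) ℝ) :
    ContinuousAt (fun ε : ℝ => (1 + ε • A)⁻¹) 0 := by
  simp only [Matrix.inv_def]
  have h1 : ContinuousAt (fun ε : ℝ => Ring.inverse (1 + ε • A).det) 0 := by
    have : ContinuousAt (fun ε : ℝ => (1 + ε • A).det) 0 :=
      (Continuous.matrix_det (continuous_const.add
        (continuous_id.smul continuous_const))).continuousAt
    simp only [Ring.inverse_eq_inv']
    exact this.inv₀ (by simp)
  have h2 : ContinuousAt (fun ε : ℝ => (1 + ε • A).adjugate) 0 :=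
    (Continuous.matrix_adjugate (continuous_const.add
      (continuous_id.smul continuous_const))).continuousAt
  exact h1.smul h2

theorem eventually_isUnit_det (A : Matrix (Fin N) (Fin N) ℝ) :
    ∀ᶠ ε : ℝ in 𝓝 0, IsUnit (1 + ε • A).det := by
  have : ContinuousAt (fun ε : ℝ => (1 + ε • A).det) 0 :=
    (Continuous.matrix_det (continuous_const.add
      (continuous_id.smul continuous_const))).continuousAt
  filter_upwards [this.eventually_ne (by simp : (1 + (0 : ℝ) • A).det ≠ 0)] with ε h
  exact isUnit_iff_ne_zero.2 h

/-- The identity `R = 1 - ε A R` for the resolvent is substituted into itself twice. The remainder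
is exact, so no norm estimate of a Neumann series is needed. -/
theorem inv_one_add_smul_expansion {A : Matrix (Fin N) (Fin N) ℝ} {ε : ℝ}
    (h : IsUnit (1 + ε • A).det) :
    (1 + ε • A)⁻¹ = 1 - ε • A + ε ^ 2 • (A * A) - ε ^ 3 • (A * A * A * (1 + ε • A)⁻¹) := by
  set R := (1 + ε • A)⁻¹
  have h1 : (1 + ε • A) * R = 1 := Matrix.mul_nonsing_inv _ h
  have h2 : R = 1 - ε • (A * R) := by
    rw [add_mul, one_mul, smul_mul_assoc] at h1
    exact eq_sub_of_add_eq h1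
  have h3 : A * R = A - ε • (A * A * R) := by
    conv_lhs => rw [h2]
    simp [mul_sub, mul_assoc]
  have h4 : A * A * R = A * A - ε • (A * A * A * R) := by
    conv_lhs => rw [h2]
    simp [mul_sub, mul_assoc]
  conv_lhs => rw [h2, h3, h4]
  module

/-- The preconditioned source iteration operator is the identity up to `O(ε)` once the terms of
order `ε⁻¹` and `1` are as required. -/
theorem preconditioned_isBigO {k : ℕ} (w : Fin k → ℝ) (κ : ℝ)
    (A : Fin k → Matrix (Fin N) (Fin N) ℝ) (B M EP C : Matrix (Fin N) (Fin N) ℝ)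
    (hw : κ * ∑ d, w d = 1)
    (h0 : EP * M * (κ • ∑ d, w d • A d) = 0)
    (h1 : EP * M * (B - κ • ∑ d, w d • (A d * A d)) + C * M * (κ • ∑ d, w d • A d) = 1)
    (m n : Fin N) :
    (fun ε : ℝ => ((1 / ε) • (((1 / ε) • EP + C) * M *
      (1 - ∑ d, w d • ((1 + ε • A d)⁻¹ * (κ • (1 - ε ^ 2 • B))))) - 1) m n)
        =O[𝓝[>] 0] fun ε : ℝ => ε := by
  set a1 := κ • ∑ d, w d • A d with ha1
  set a2 := κ • ∑ d, w d • (A d * A d) with ha2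
  -- `T` is the mean of the cubic remainders and `ε³ Z` the remainder of `1 - S`. The operator minus
  -- the identity will equal `ε Y`; all three are continuous at `0`, hence bounded nearby.
  let T : ℝ → Matrix (Fin N) (Fin N) ℝ := fun ε =>
    κ • ∑ d, w d • (A d * A d * A d * (1 + ε • A d)⁻¹)
  let Z : ℝ → Matrix (Fin N) (Fin N) ℝ := fun ε =>
    T ε - a1 * B + ε • (a2 * B) - ε ^ 2 • (T ε * B)
  let Y : ℝ → Matrix (Fin N) (Fin N) ℝ := fun ε =>
    EP * M * Z ε + C * M * (B - a2) + ε • (C * M * Z ε)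
  have hT : ContinuousAt T 0 := by
    have (d : Fin k) : ContinuousAt
        (fun ε : ℝ => w d • (A d * A d * A d * (1 + ε • A d)⁻¹)) 0 :=
      ((continuousAt_const (y := A d * A d * A d)).mul
        (continuousAt_inv_one_add_smul (A d))).const_smul (w d)
    have : ContinuousAt
        (fun ε : ℝ => ∑ d, w d • (A d * A d * A d * (1 + ε • A d)⁻¹)) 0 :=
      tendsto_finsetSum _ fun d _ => this d
    exact this.const_smul κ
  have hid : ContinuousAt (fun ε : ℝ => ε) 0 := continuousAt_id
  have hZ : ContinuousAt Z 0 :=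
    ((hT.sub (continuousAt_const (y := a1 * B))).add
      (hid.smul (continuousAt_const (y := a2 * B)))).sub
      ((hid.pow 2).smul (hT.mul (continuousAt_const (y := B))))
  have hY : ContinuousAt Y 0 :=
    (((continuousAt_const (y := EP * M)).mul hZ).add
      (continuousAt_const (y := C * M * (B - a2)))).add
      (hid.smul ((continuousAt_const (y := C * M)).mul hZ))
  have hYb : (fun ε => Y ε m n) =O[𝓝[>] 0] (fun _ => (1 : ℝ)) := by
    have : ContinuousAt (fun ε => Y ε m n) 0 :=
      (continuous_id.matrix_elem m n).continuousAt.comp (f := Y) hY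
    exact (this.tendsto.isBigO_one ℝ).mono nhdsWithin_le_nhds
  have key : (fun ε : ℝ => ((1 / ε) • (((1 / ε) • EP + C) * M *
      (1 - ∑ d, w d • ((1 + ε • A d)⁻¹ * (κ • (1 - ε ^ 2 • B))))) - 1) m n)
      =ᶠ[𝓝[>] 0] fun ε => ε * Y ε m n := by
    have hunit : ∀ᶠ ε : ℝ in 𝓝[>] 0, ∀ d, IsUnit (1 + ε • A d).det :=
      nhdsWithin_le_nhds (Filter.eventually_all.2 fun d => eventually_isUnit_det (A d))
    filter_upwards [hunit, self_mem_nhdsWithin] with ε hε hpos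
    have hε0 : ε ≠ 0 := ne_of_gt hpos
    have hS : (∑ d, w d • ((1 + ε • A d)⁻¹ * (κ • (1 - ε ^ 2 • B))))
        = (1 - ε • a1 + ε ^ 2 • a2 - ε ^ 3 • T ε) * (1 - ε ^ 2 • B) := by
      have e1 : (1 - ε • a1 + ε ^ 2 • a2 - ε ^ 3 • T ε)
          = κ • ∑ d, w d • (1 + ε • A d)⁻¹ := by
        have e2 : ∀ d, w d • (1 + ε • A d)⁻¹ = w d • (1 : Matrix (Fin N) (Fin N) ℝ)
            - ε • (w d • A d) + ε ^ 2 • (w d • (A d * A d))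
            - ε ^ 3 • (w d • (A d * A d * A d * (1 + ε • A d)⁻¹)) := fun d => by
          conv_lhs => rw [inv_one_add_smul_expansion (hε d)]
          module
        simp only [e2]
        rw [Finset.sum_sub_distrib, Finset.sum_add_distrib, Finset.sum_sub_distrib,
          ← Finset.smul_sum, ← Finset.smul_sum, ← Finset.smul_sum, ← Finset.sum_smul]
        simp only [ha1, ha2, T]
        rw [smul_sub, smul_add, smul_sub, smul_smul κ, hw, one_smul]
        module
      rw [e1, smul_mul_assoc, Finset.sum_mul, Finset.smul_sum]
      refine Finset.sum_congr rfl fun d _ => ?_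
      rw [mul_smul_comm, smul_mul_assoc, smul_comm]
    have h1S : 1 - (1 - ε • a1 + ε ^ 2 • a2 - ε ^ 3 • T ε) * (1 - ε ^ 2 • B)
        = ε • a1 + ε ^ 2 • (B - a2) + ε ^ 3 • Z ε := by
      simp only [Z, sub_mul, add_mul, mul_sub, one_mul, mul_one, smul_mul_assoc, mul_smul_comm]
      module
    rw [hS, h1S]
    have : (1 / ε) • (((1 / ε) • EP + C) * M * (ε • a1 + ε ^ 2 • (B - a2) + ε ^ 3 • Z ε)) - 1
        = ε • Y ε := by
      have e3 : ((1 / ε) • EP + C) * M * (ε • a1 + ε ^ 2 • (B - a2) + ε ^ 3 • Z ε)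
          = (1 : ℝ) • (EP * M * a1) + ε • (EP * M * (B - a2) + C * M * a1) + ε ^ 2 • Y ε := by
        simp only [Y, add_mul, mul_add, smul_mul_assoc, mul_smul_comm]
        have i1 : 1 / ε * ε = 1 := by field_simp
        have i2 : 1 / ε * ε ^ 2 = ε := by field_simp
        have i3 : 1 / ε * ε ^ 3 = ε ^ 2 := by field_simp
        simp only [smul_add, smul_smul, i1, i2, i3, mul_comm ε (1 / ε), mul_comm (ε ^ 2) (1 / ε),
          mul_comm (ε ^ 3) (1 / ε)]
        module
      rw [e3, h0, h1, smul_zero, zero_add, smul_add, smul_smul, smul_smul]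
      have i1 : 1 / ε * ε = 1 := by field_simp
      have i2 : 1 / ε * ε ^ 2 = ε := by field_simp
      rw [i1, i2, one_smul, add_sub_cancel_left]
    rw [this]
    simp
  refine key.trans_isBigO ?_
  simpa using (Asymptotics.isBigO_refl (fun ε : ℝ => ε) (𝓝[>] 0)).mul hYb

end LinearAlgebra

/-! ### Area measure on planes, and the area formula by thickening. -/

section PlaneArea

open MeasureTheory Set

theorem measurable_planeEmbedding (a : E3) (c : ℝ) :
    Measurable (fun z : (ℝ ∙ a)ᗮ => c • a + (z : E3)) := by fun_prop

instance (a : E3) (c : ℝ) : SFinite (planeArea a c) := by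
  unfold planeArea; infer_instance

theorem planeArea_lt_top_of_isCompact (a : E3) (c : ℝ) {K : Set E3} (hK : IsCompact K) :
    planeArea a c K < ⊤ := by
  have hcl : Topology.IsClosedEmbedding (fun z : (ℝ ∙ a)ᗮ => c • a + (z : E3)) :=
    (Homeomorph.addLeft (c • a)).isClosedEmbedding.comp
      (Submodule.closed_of_finiteDimensional (ℝ ∙ a)ᗮ).isClosedEmbedding_subtypeVal
  unfold planeArea
  rw [Measure.map_apply (measurable_planeEmbedding a c) hK.measurableSet]
  exact (hcl.isCompact_preimage hK).measure_lt_top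

instance (a : E3) (c : ℝ) : IsFiniteMeasureOnCompacts (planeArea a c) :=
  ⟨fun _ hK => planeArea_lt_top_of_isCompact a c hK⟩

theorem ae_planeArea_inner {a : E3} (ha : ‖a‖ = 1) (c : ℝ) :
    ∀ᵐ y ∂(planeArea a c), ⟪a, y⟫_ℝ = c := by
  unfold planeArea
  rw [ae_map_iff (measurable_planeEmbedding a c).aemeasurable]
  · refine Filter.Eventually.of_forall fun z => ?_
    have : ⟪a, (z : E3)⟫_ℝ = 0 := Submodule.mem_orthogonal_singleton_iff_inner_right.1 z.2
    rw [inner_add_right, inner_smul_right, this, real_inner_self_eq_norm_sq, ha]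
    simp
  · exact measurableSet_eq_fun (by fun_prop) (by fun_prop)

/-- Lebesgue measure on space is the product of the area measure of a plane and Lebesgue measure
on the normal line. -/
theorem measurePreserving_planeArea_prod {a : E3} (ha : ‖a‖ = 1) (c : ℝ) :
    MeasurePreserving (fun p : E3 × ℝ => p.1 + p.2 • a) ((planeArea a c).prod volume) volume := by
  let g : (ℝ ∙ a)ᗮ × ℝ → E3 × ℝ := fun p => (c • a + (p.1 : E3), p.2)
  have hg : MeasurePreserving g (volume.prod volume) ((planeArea a c).prod volume) :=
    ((measurable_planeEmbedding a c).measurePreserving volume).prod (MeasurePreserving.id volume)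
  have h1 : MeasurePreserving (fun p : (ℝ ∙ a)ᗮ × ℝ => c • a + ((p.1 : E3) + p.2 • a))
      (volume.prod volume) volume := by
    refine (measurePreserving_add_left volume (c • a)).comp ?_
    have e1 := (LinearIsometryEquiv.toSpanUnitSingleton (𝕜 := ℝ) a ha).measurePreserving
    have e2 : MeasurePreserving (fun p : (ℝ ∙ a)ᗮ × ℝ =>
        (LinearIsometryEquiv.toSpanUnitSingleton (𝕜 := ℝ) a ha p.2, p.1))
        (volume.prod volume) (volume.prod volume) :=
      (e1.prod (MeasurePreserving.id volume)).comp Measure.measurePreserving_swap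
    have e3 := ((WithLp.volume_preserving_toLp (ℝ ∙ a) (ℝ ∙ a)ᗮ)).comp e2
    have e4 := (ℝ ∙ a).orthogonalDecomposition.symm.measurePreserving.comp e3
    have e5 : (fun p : (ℝ ∙ a)ᗮ × ℝ => (p.1 : E3) + p.2 • a)
        = (ℝ ∙ a).orthogonalDecomposition.symm ∘ WithLp.toLp 2 ∘ fun p =>
          (LinearIsometryEquiv.toSpanUnitSingleton (𝕜 := ℝ) a ha p.2, p.1) := by
      ext1 p
      simp [add_comm]
    rw [e5]
    exact e4
  refine ⟨by fun_prop, ?_⟩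
  rw [← hg.map_eq, Measure.map_map (by fun_prop) hg.measurable, ← h1.map_eq]
  congr 1
  ext1 p
  simp [g, add_assoc]

/-- The orthogonal projection to the plane `⟪a, y⟫ = c`. -/
noncomputable def planeProj (a : E3) (c : ℝ) (z : E3) : E3 := z - (⟪a, z⟫_ℝ - c) • a

/-- The cylinder of height one over a subset of the plane `⟪a, y⟫ = c`. -/
def planeCylinder (a : E3) (c : ℝ) (T : Set E3) : Set E3 :=
  {z | ⟪a, z⟫_ℝ - c ∈ Icc (0 : ℝ) 1 ∧ planeProj a c z ∈ T}

@[fun_prop]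
theorem continuous_planeProj (a : E3) (c : ℝ) : Continuous (planeProj a c) := by
  unfold planeProj; fun_prop

theorem planeProj_add_smul {a : E3} (ha : ‖a‖ = 1) {c : ℝ} {y : E3} (hy : ⟪a, y⟫_ℝ = c) (s : ℝ) :
    planeProj a c (y + s • a) = y := by
  unfold planeProj
  rw [inner_add_right, inner_smul_right, real_inner_self_eq_norm_sq, ha, hy]
  simp

theorem inner_add_smul_sub {a : E3} (ha : ‖a‖ = 1) {c : ℝ} {y : E3} (hy : ⟪a, y⟫_ℝ = c) (s : ℝ) :
    ⟪a, y + s • a⟫_ℝ - c = s := by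
  rw [inner_add_right, inner_smul_right, real_inner_self_eq_norm_sq, ha, hy]
  simp

theorem planeProj_add (a : E3) (c : ℝ) (z : E3) :
    planeProj a c z + (⟪a, z⟫_ℝ - c) • a = z := by
  unfold planeProj; simp

theorem measurableSet_planeCylinder (a : E3) (c : ℝ) {T : Set E3} (hT : MeasurableSet T) :
    MeasurableSet (planeCylinder a c T) := by
  refine MeasurableSet.inter ?_ ?_
  · exact measurableSet_Icc.preimage (f := fun z : E3 => ⟪a, z⟫_ℝ - c) (by fun_prop)
  · exact hT.preimage (continuous_planeProj a c).measurable

theorem add_smul_mem_planeCylinder {a : E3} (ha : ‖a‖ = 1) {c : ℝ} {T : Set E3} {y : E3}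
    (hy : ⟪a, y⟫_ℝ = c) (s : ℝ) : y + s • a ∈ planeCylinder a c T ↔ s ∈ Icc (0 : ℝ) 1 ∧ y ∈ T := by
  simp only [planeCylinder, mem_ofPred_eq, planeProj_add_smul ha hy, inner_add_smul_sub ha hy]

/-- By Fubini in the normal direction: the integrand is constant along normals and the height is
one. Surface statements thus become volume statements, to which Lebesgue measure theorems apply. -/
theorem lintegral_planeCylinder {a : E3} (ha : ‖a‖ = 1) (c : ℝ) {T : Set E3}
    (hT : MeasurableSet T) {g : E3 → ENNReal} (hg : Measurable g) :
    ∫⁻ z in planeCylinder a c T, g (planeProj a c z) = ∫⁻ y in T, g y ∂(planeArea a c) := by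
  have hm := measurableSet_planeCylinder a c hT
  have hgm : Measurable (fun z => g (planeProj a c z)) :=
    hg.comp (continuous_planeProj a c).measurable
  rw [← lintegral_indicator hm, ← lintegral_indicator hT,
    ← (measurePreserving_planeArea_prod ha c).lintegral_comp (hgm.indicator hm),
    lintegral_prod _ (by
      exact ((hgm.indicator hm).comp
        (measurePreserving_planeArea_prod ha c).measurable).aemeasurable)]
  refine lintegral_congr_ae ?_
  filter_upwards [ae_planeArea_inner ha c] with y hy
  have : ∀ s : ℝ, (planeCylinder a c T).indicator (fun z => g (planeProj a c z)) (y + s • a)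
      = (Icc (0 : ℝ) 1).indicator (fun _ => T.indicator g y) s := fun s => by
    by_cases h1 : s ∈ Icc (0 : ℝ) 1 <;> by_cases h2 : y ∈ T <;>
      simp only [indicator, add_smul_mem_planeCylinder ha hy, h1, h2, planeProj_add_smul ha hy,
        and_self, if_true, if_false, and_false, false_and]
  simp only [this]
  rw [lintegral_indicator measurableSet_Icc]
  simp

/-- For almost every base point the property holds at almost every height. Since `[0, 1]` has
positive length, a good height exists, and the property depends on the base point only. -/
theorem ae_planeArea_of_ae_planeCylinder {a : E3} (ha : ‖a‖ = 1) (c : ℝ) {T : Set E3}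
    (hT : MeasurableSet T) {p : E3 → Prop}
    (h : ∀ᵐ z ∂(volume.restrict (planeCylinder a c T)), p (planeProj a c z)) :
    ∀ᵐ y ∂((planeArea a c).restrict T), p y := by
  rw [ae_restrict_iff' (measurableSet_planeCylinder a c hT)] at h
  rw [ae_restrict_iff' hT]
  have h2 := Measure.ae_ae_of_ae_prod
    ((measurePreserving_planeArea_prod ha c).quasiMeasurePreserving.ae h)
  filter_upwards [h2, ae_planeArea_inner ha c] with y hy hyc hyT
  have hpos : ∃ᵐ s : ℝ, s ∈ Icc (0 : ℝ) 1 := by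
    rw [frequently_ae_iff]
    change volume (Icc (0 : ℝ) 1) ≠ 0
    simp
  obtain ⟨s, hs, hs'⟩ := (hpos.and_eventually hy).exists
  have := hs' ((add_smul_mem_planeCylinder ha hyc s).2 ⟨hs, hyT⟩)
  rwa [planeProj_add_smul ha hyc] at this

/-- The derivative of the projection to a plane. -/
noncomputable def planeProjLin (a : E3) : E3 →L[ℝ] E3 :=
  ContinuousLinearMap.id ℝ E3 - (innerSL ℝ a).smulRight a

theorem planeProjLin_apply (a v : E3) : planeProjLin a v = v - ⟪a, v⟫_ℝ • a := by
  simp [planeProjLin]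

theorem hasFDerivAt_planeProj (a : E3) (c : ℝ) (z : E3) :
    HasFDerivAt (planeProj a c) (planeProjLin a) z := by
  have h1 : HasFDerivAt (fun z : E3 => ⟪a, z⟫_ℝ - c) (innerSL ℝ a) z :=
    ((innerSL ℝ a).hasFDerivAt).sub_const c
  exact (hasFDerivAt_id z).sub (h1.smul_const a)

/-- At almost every point of a subset of a plane on which a differentiable function vanishes, the
tangential derivatives of the function vanish too. -/
theorem ae_fderiv_tangent_eq_zero {a : E3} (ha : ‖a‖ = 1) (c : ℝ) {T : Set E3}
    (hT : MeasurableSet T) (f : E3 → ℝ) (f' : E3 → E3 →L[ℝ] ℝ)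
    (hf' : ∀ y ∈ T, HasFDerivAt f (f' y) y) (hf : ∀ y ∈ T, f y = 0) :
    ∀ᵐ y ∂((planeArea a c).restrict T), ∀ v, ⟪a, v⟫_ℝ = 0 → f' y v = 0 := by
  apply ae_planeArea_of_ae_planeCylinder ha c hT
  -- `F` vanishes on the whole cylinder, so it is approximated there by the zero map with constant
  -- `0`. The density-point bound `norm_fderiv_sub_le` then makes its derivative zero almost
  -- everywhere. The factor `a` only makes `F` vector-valued, as that bound requires.
  let F : E3 → E3 := fun z => f (planeProj a c z) • a
  have hF : ApproximatesLinearOn F (0 : E3 →L[ℝ] E3) (planeCylinder a c T) 0 := by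
    intro x hx y hy
    simp [F, hf _ hx.2, hf _ hy.2]
  have hF' : ∀ z ∈ planeCylinder a c T, HasFDerivWithinAt F
      (((f' (planeProj a c z)).comp (planeProjLin a)).smulRight a) (planeCylinder a c T) z := by
    intro z hz
    exact (((hf' _ hz.2).comp z (hasFDerivAt_planeProj a c z)).smul_const a).hasFDerivWithinAt
  filter_upwards [hF.norm_fderiv_sub_le volume (measurableSet_planeCylinder a c hT) _ hF']
    with z hz v hv
  have h0 : ((f' (planeProj a c z)).comp (planeProjLin a)).smulRight a = 0 := by
    rw [sub_zero] at hz
    exact nnnorm_eq_zero.1 (nonpos_iff_eq_zero.1 hz)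
  have h1 : f' (planeProj a c z) v • a = 0 := by
    have := congrArg (fun A : E3 →L[ℝ] E3 => A v) h0
    simpa [planeProjLin_apply, hv] using this
  have ha0 : a ≠ 0 := fun h => by simp [h] at ha
  exact (smul_eq_zero.1 h1).resolve_right ha0

theorem det_id_add_smulRight (f : E3 →L[ℝ] ℝ) (w : E3) :
    (ContinuousLinearMap.id ℝ E3 + f.smulRight w).det = 1 + f w := by
  have := LinearMap.transvection.det (f : Module.Dual ℝ E3) w
  rw [← ContinuousLinearMap.coe_coe f, ← this]
  congr 1

/-- Area formula for maps between subsets of planes. -/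
theorem lintegral_image_planeArea {a a' : E3} (ha : ‖a‖ = 1) (ha' : ‖a'‖ = 1) (c c' : ℝ)
    {T : Set E3} (hT : MeasurableSet T) (hTp : ∀ y ∈ T, ⟪a, y⟫_ℝ = c) (ψ : E3 → E3)
    (L : E3 → E3 →L[ℝ] E3) (hL : ∀ y ∈ T, HasFDerivAt ψ (L y) y) (hinj : InjOn ψ T)
    (hmaps : ∀ y ∈ T, ⟪a', ψ y⟫_ℝ = c')
    (htan : ∀ y ∈ T, ∀ v, ⟪a, v⟫_ℝ = 0 → ⟪a', L y v⟫_ℝ = 0)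
    (himg : MeasurableSet (ψ '' T)) {g k : E3 → ENNReal} (hg : Measurable g) (hk : Measurable k)
    (hne : ∀ y ∈ T, ⟪a', L y a⟫_ℝ ≠ 0)
    (hgk : ∀ y ∈ T, k y = ENNReal.ofReal (|(L y).det| / |⟪a', L y a⟫_ℝ|) * g (ψ y)) :
    ∫⁻ x in ψ '' T, g x ∂(planeArea a' c') = ∫⁻ y in T, k y ∂(planeArea a c) := by
  -- `H` thickens `ψ` by preserving the height over the plane. It maps the cylinder over `T`
  -- bijectively onto the cylinder over `ψ '' T`, so the volume change of variables applies to it.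
  let H : E3 → E3 := fun z => ψ (planeProj a c z) + (⟪a, z⟫_ℝ - c) • a'
  let H' : E3 → E3 →L[ℝ] E3 := fun z =>
    (L (planeProj a c z)).comp (planeProjLin a) + (innerSL ℝ a).smulRight a'
  have hH' : ∀ z ∈ planeCylinder a c T, HasFDerivWithinAt H (H' z) (planeCylinder a c T) z := by
    intro z hz
    have h1 : HasFDerivAt (fun z : E3 => ⟪a, z⟫_ℝ - c) (innerSL ℝ a) z :=
      ((innerSL ℝ a).hasFDerivAt).sub_const c
    exact (((hL _ hz.2).comp z (hasFDerivAt_planeProj a c z)).add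
      (h1.smul_const a')).hasFDerivWithinAt
  have hinner : ∀ z ∈ planeCylinder a c T, ⟪a', H z⟫_ℝ - c' = ⟪a, z⟫_ℝ - c := fun z hz =>
    inner_add_smul_sub ha' (hmaps _ hz.2) _
  have hproj : ∀ z ∈ planeCylinder a c T, planeProj a' c' (H z) = ψ (planeProj a c z) :=
    fun z hz => planeProj_add_smul ha' (hmaps _ hz.2) _
  have hHinj : InjOn H (planeCylinder a c T) := by
    intro z hz z' hz' h
    have h1 : planeProj a c z = planeProj a c z' := by
      apply hinj hz.2 hz'.2
      rw [← hproj z hz, ← hproj z' hz', h]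
    rw [← planeProj_add a c z, ← planeProj_add a c z', h1, ← hinner z hz, ← hinner z' hz', h]
  have himgH : H '' planeCylinder a c T = planeCylinder a' c' (ψ '' T) := by
    ext x
    constructor
    · rintro ⟨z, hz, rfl⟩
      exact ⟨by rw [hinner z hz]; exact hz.1, by rw [hproj z hz]; exact mem_image_of_mem ψ hz.2⟩
    · rintro ⟨h1, y, hy, hyx⟩
      have hz : y + (⟪a', x⟫_ℝ - c') • a ∈ planeCylinder a c T :=
        (add_smul_mem_planeCylinder ha (hTp y hy) _).2 ⟨h1, hy⟩
      refine ⟨_, hz, ?_⟩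
      simp only [H]
      rw [planeProj_add_smul ha (hTp y hy), inner_add_smul_sub ha (hTp y hy), hyx, planeProj_add]
  have hdet : ∀ z ∈ planeCylinder a c T, |(H' z).det|
      = |(L (planeProj a c z)).det| / |⟪a', L (planeProj a c z) a⟫_ℝ| := by
    intro z hz
    set y := planeProj a c z
    -- `N` is the identity on the orthogonal complement of `a'` and sends `a'` to `L y a`. Then `L y
    -- = N ∘ H' z`, and multiplicativity of determinants gives the Jacobian of `H`.
    let N : E3 →L[ℝ] E3 :=
      ContinuousLinearMap.id ℝ E3 + (innerSL ℝ a').smulRight (L y a - a')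
    have hN : N.det = ⟪a', L y a⟫_ℝ := by
      simp only [N]
      rw [det_id_add_smulRight]
      simp [inner_sub_right, ha']
    have hcomp : L y = N.comp (H' z) := by
      ext1 v
      have h1 : ⟪a', H' z v⟫_ℝ = ⟪a, v⟫_ℝ := by
        have h2 : ⟪a', L y (v - ⟪a, v⟫_ℝ • a)⟫_ℝ = 0 := by
          apply htan y hz.2
          rw [inner_sub_right, inner_smul_right, real_inner_self_eq_norm_sq, ha]
          simp
        have h3 : H' z v = L y (v - ⟪a, v⟫_ℝ • a) + ⟪a, v⟫_ℝ • a' := by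
          simp [H', planeProjLin_apply, y]
        rw [h3, inner_add_right, h2, inner_smul_right, real_inner_self_eq_norm_sq, ha']
        simp
      have h4 : N (H' z v) = H' z v + ⟪a, v⟫_ℝ • (L y a - a') := by
        simp [N, h1]
      rw [ContinuousLinearMap.comp_apply, h4]
      simp [H', planeProjLin_apply, y, smul_sub]
    have hdd : (L y).det = N.det * (H' z).det := by
      conv_lhs => rw [hcomp]
      exact LinearMap.det_comp _ _
    rw [hdd, hN, abs_mul, mul_div_cancel_left₀ _ (abs_ne_zero.2 (hne y hz.2))]
  rw [← lintegral_planeCylinder ha' c' himg hg, ← himgH,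
    lintegral_image_eq_lintegral_abs_det_fderiv_mul volume (measurableSet_planeCylinder a c hT)
      hH' hHinj, ← lintegral_planeCylinder ha c hT hk]
  refine setLIntegral_congr_fun (measurableSet_planeCylinder a c hT) fun z hz => ?_
  simp only [hdet z hz, hproj z hz, hgk _ hz.2]

end PlaneArea

/-! ### Geometry of the reference polytopes. -/

namespace RefPolytope

variable (K : RefPolytope)

theorem isClosed_carrier : IsClosed K.carrier := by
  have : K.carrier = ⋂ i, {y | ⟪K.normal i, y⟫_ℝ ≤ K.offset i} := by
    ext y; simp [carrier]
  rw [this]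
  exact isClosed_iInter fun i => isClosed_le (by fun_prop) (by fun_prop)

theorem isCompact_carrier : IsCompact K.carrier :=
  Metric.isCompact_of_isClosed_isBounded K.isClosed_carrier K.bounded

theorem convex_carrier : Convex ℝ K.carrier := by
  have : K.carrier = ⋂ i, {y | ⟪K.normal i, y⟫_ℝ ≤ K.offset i} := by
    ext y; simp [carrier]
  rw [this]
  exact convex_iInter fun i => convex_halfSpace_le
    ⟨fun x y => inner_add_right _ x y, fun r x => inner_smul_right _ x r⟩ _

theorem closure_interior_carrier : closure (interior K.carrier) = K.carrier := by
  rw [K.convex_carrier.closure_interior_eq_closure_of_nonempty_interior K.solid,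
    K.isClosed_carrier.closure_eq]

/-- At an interior point with equality in one constraint, a small step along that unit normal would
stay in the polytope while violating the constraint. -/
theorem interior_carrier :
    interior K.carrier = {y | ∀ i, ⟪K.normal i, y⟫_ℝ < K.offset i} := by
  apply Set.Subset.antisymm
  · intro y hy i
    refine lt_of_le_of_ne (interior_subset hy i) fun h => ?_
    have hc : ContinuousAt (fun t : ℝ => y + t • K.normal i) 0 := by fun_prop
    have hev : ∀ᶠ t : ℝ in 𝓝[>] 0, y + t • K.normal i ∈ interior K.carrier :=
      nhdsWithin_le_nhds (hc.eventually_mem (isOpen_interior.mem_nhds (by simpa using hy)))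
    obtain ⟨t, ht, hpos⟩ := (hev.and self_mem_nhdsWithin).exists
    have := interior_subset ht i
    rw [inner_add_right, inner_smul_right, real_inner_self_eq_norm_sq, K.norm_normal, h] at this
    have hpos : 0 < t := hpos
    linarith
  · apply interior_maximal
    · exact fun y hy i => (hy i).le
    · simp only [Set.ofPred_forall]
      exact isOpen_iInter_of_finite fun i => isOpen_lt (by fun_prop) (by fun_prop)

/-- Two different facets through a point of the polytope are not parallel. -/
theorem eq_of_parallel {y : E3} {i k : Fin K.nFacets}
    (hi : ⟪K.normal i, y⟫_ℝ = K.offset i) (hk : ⟪K.normal k, y⟫_ℝ = K.offset k) {r : ℝ}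
    (h : K.normal k = r • K.normal i) : k = i := by
  have hr : |r| = 1 := by
    have := K.norm_normal k
    rw [h, norm_smul, K.norm_normal, mul_one] at this
    exact this
  have hoff : K.offset k = r * K.offset i := by
    rw [← hk, ← hi, h, inner_smul_left]; simp
  -- Equal normals give the same half-space, which is listed only once. Opposite normals confine the
  -- polytope to a plane, against its non-empty interior.
  rcases eq_or_eq_neg_of_abs_eq hr with rfl | rfl
  · apply K.distinct
    simp [h, hoff]
  · exfalso
    obtain ⟨z, hz⟩ := K.solid
    have hz' : z ∈ interior K.carrier := hz
    rw [interior_carrier] at hz'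
    have h1 := hz' i
    have h2 := hz' k
    rw [h, inner_smul_left, hoff] at h2
    simp at h2
    linarith

end RefPolytope

/-! ### Topology of the elements and calculus of their parametrizations. -/

namespace DGMesh

variable (M : DGMesh)

open Set

/-- The affine function of the reference coordinates that vanishes on the facet `i`. -/
noncomputable def facetLevel (e : Fin M.nElem) (i : Fin (M.ref e).nFacets) (x : E3) : ℝ :=
  ⟪(M.ref e).normal i, (M.map e).symm x⟫_ℝ - (M.ref e).offset i

/-- The image of the facet `i`. -/
def facet (e : Fin M.nElem) (i : Fin (M.ref e).nFacets) : Set E3 :=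
  {x | x ∈ M.closedElem e ∧ M.facetLevel e i x = 0}

variable {M}
variable {e e' : Fin M.nElem}

theorem interior_subset_source : interior (M.ref e).carrier ⊆ (M.map e).source :=
  interior_subset.trans (M.subset_source e)

theorem elem_subset_closedElem : M.elem e ⊆ M.closedElem e :=
  image_mono interior_subset

theorem closedElem_subset_target : M.closedElem e ⊆ (M.map e).target := by
  rintro _ ⟨y, hy, rfl⟩
  exact (M.map e).map_source (M.subset_source e hy)

theorem elem_subset_target : M.elem e ⊆ (M.map e).target :=
  elem_subset_closedElem.trans closedElem_subset_target

theorem isOpen_elem : IsOpen (M.elem e) :=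
  (M.map e).isOpen_image_of_subset_source isOpen_interior interior_subset_source

theorem isCompact_closedElem : IsCompact (M.closedElem e) :=
  (M.ref e).isCompact_carrier.image_of_continuousOn
    ((M.map e).continuousOn.mono (M.subset_source e))

theorem isClosed_closedElem : IsClosed (M.closedElem e) := isCompact_closedElem.isClosed

theorem symm_mem_source {x : E3} (hx : x ∈ M.closedElem e) :
    (M.map e).symm x ∈ (M.ref e).carrier := by
  obtain ⟨y, hy, rfl⟩ := hx
  rwa [(M.map e).left_inv (M.subset_source e hy)]

theorem mem_elem_iff_symm {x : E3} (hx : x ∈ (M.map e).target) :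
    x ∈ M.elem e ↔ (M.map e).symm x ∈ interior (M.ref e).carrier := by
  constructor
  · rintro ⟨y, hy, rfl⟩
    rwa [(M.map e).left_inv (interior_subset_source hy)]
  · exact fun h => ⟨_, h, (M.map e).right_inv hx⟩

theorem mem_elem_iff {x : E3} (hx : x ∈ (M.map e).target) :
    x ∈ M.elem e ↔ ∀ i, M.facetLevel e i x < 0 := by
  rw [mem_elem_iff_symm hx, RefPolytope.interior_carrier]
  simp [facetLevel]

theorem facetLevel_nonpos {x : E3} (hx : x ∈ M.closedElem e) (i : Fin (M.ref e).nFacets) :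
    M.facetLevel e i x ≤ 0 := by
  have := symm_mem_source hx i
  unfold facetLevel
  linarith

theorem closedElem_subset_closure_elem : M.closedElem e ⊆ closure (M.elem e) := by
  rintro _ ⟨y, hy, rfl⟩
  have hc : ContinuousAt (M.map e) y := (M.map e).continuousAt (M.subset_source e hy)
  rw [← (M.ref e).closure_interior_carrier] at hy
  exact mem_closure_image hc hy

/-- The inverse parametrization is open, so it carries the interior of the closed element to an open
subset of the polytope. -/
theorem interior_closedElem : interior (M.closedElem e) = M.elem e := by
  apply Subset.antisymm
  · intro x hx
    have hxt := closedElem_subset_target (interior_subset hx)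
    rw [mem_elem_iff_symm hxt]
    have h2 : (M.map e).symm '' interior (M.closedElem e) ⊆ (M.ref e).carrier := by
      rintro _ ⟨z, hz, rfl⟩
      exact symm_mem_source (interior_subset hz)
    exact interior_maximal h2 ((M.map e).symm.isOpen_image_of_subset_source isOpen_interior
      (interior_subset.trans closedElem_subset_target)) ⟨x, hx, rfl⟩
  · exact interior_maximal elem_subset_closedElem isOpen_elem

theorem exists_mem_facet {x : E3} (hx : x ∈ M.closedElem e) (hx' : x ∉ M.elem e) :
    ∃ i, x ∈ M.facet e i := by
  rw [mem_elem_iff (closedElem_subset_target hx)] at hx'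
  push Not at hx'
  obtain ⟨i, hi⟩ := hx'
  exact ⟨i, hx, le_antisymm (facetLevel_nonpos hx i) hi⟩

theorem notMem_elem_of_mem_facet {x : E3} {i : Fin (M.ref e).nFacets} (hx : x ∈ M.facet e i) :
    x ∉ M.elem e := fun h =>
  ne_of_lt ((mem_elem_iff (closedElem_subset_target hx.1)).1 h i) hx.2

theorem elem_disjoint (h : e ≠ e') : Disjoint (M.elem e) (M.elem e') := M.disjoint e e' h

/-- A closed element lies in the closure of its open element, and an open set cannot meet the
closure of a set disjoint from it. -/
theorem notMem_closedElem_of_mem_elem (h : e ≠ e') {x : E3} (hx : x ∈ M.elem e) :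
    x ∉ M.closedElem e' := fun hx' => by
  obtain ⟨z, hz, hz'⟩ := mem_closure_iff.1 (closedElem_subset_closure_elem hx') _ isOpen_elem hx
  exact (disjoint_left.1 (elem_disjoint h)) hz hz'

theorem exists_mem_facet_of_mem_facet (h : e ≠ e') {x : E3} (hx : x ∈ M.closedElem e)
    (hx' : x ∈ M.closedElem e') : ∃ k, x ∈ M.facet e' k :=
  exists_mem_facet hx' fun h1 => notMem_closedElem_of_mem_elem h.symm h1 hx

theorem elem_subset_domain : M.elem e ⊆ M.domain :=
  interior_maximal (elem_subset_closedElem.trans (subset_iUnion M.closedElem e)) isOpen_elem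

theorem isOpen_domain : IsOpen M.domain := isOpen_interior

theorem isClosed_iUnion_closedElem : IsClosed (⋃ e, M.closedElem e) :=
  isClosed_iUnion_of_finite fun _ => isClosed_closedElem

theorem closure_domain : closure M.domain = ⋃ e, M.closedElem e := by
  apply Subset.antisymm
  · exact closure_minimal interior_subset isClosed_iUnion_closedElem
  · exact iUnion_subset fun e =>
      closedElem_subset_closure_elem.trans (closure_mono elem_subset_domain)

theorem closedElem_subset_closure_domain : M.closedElem e ⊆ closure M.domain := by
  rw [closure_domain]; exact subset_iUnion _ e

/-- If no other closed element contained the point, a neighbourhood of it in the domain would be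
covered by `e` alone. The point would then be interior to `e` and not on a facet. -/
theorem facet_subset {i : Fin (M.ref e).nFacets} {x : E3} (hx : x ∈ M.facet e i)
    (hf : x ∉ frontier M.domain) : ∃ e', e' ≠ e ∧ x ∈ M.closedElem e' := by
  by_contra! hcon
  have hxd : x ∈ M.domain := by
    have h1 := closedElem_subset_closure_domain hx.1
    by_contra h2
    exact hf ⟨h1, by rwa [isOpen_domain.interior_eq]⟩
  apply notMem_elem_of_mem_facet hx
  rw [← interior_closedElem]
  let C : Set E3 := ⋃ e' : {e' // e' ≠ e}, M.closedElem e'.1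
  have hC : IsClosed C := isClosed_iUnion_of_finite fun _ => isClosed_closedElem
  have hxC : x ∉ C := by
    intro h
    obtain ⟨⟨e', he'⟩, h⟩ := mem_iUnion.1 h
    exact hcon e' he' h
  refine interior_maximal ?_ (isOpen_domain.sdiff hC) ⟨hxd, hxC⟩
  rintro z ⟨hz, hzC⟩
  obtain ⟨e', he'⟩ := mem_iUnion.1 (interior_subset hz)
  by_cases h : e' = e
  · rwa [h] at he'
  · exact absurd (mem_iUnion.2 ⟨⟨e', h⟩, he'⟩) hzC

theorem hasFDerivAt_map {y : E3} (hy : y ∈ (M.map e).source) :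
    HasFDerivAt (M.map e) (fderiv ℝ (M.map e) y) y :=
  (((M.contDiffOn_map e).contDiffAt ((M.map e).open_source.mem_nhds hy)).differentiableAt
    one_ne_zero).hasFDerivAt

theorem hasFDerivAt_symm {x : E3} (hx : x ∈ (M.map e).target) :
    HasFDerivAt (M.map e).symm (fderiv ℝ (M.map e).symm x) x :=
  (((M.contDiffOn_symm e).contDiffAt ((M.map e).open_target.mem_nhds hx)).differentiableAt
    one_ne_zero).hasFDerivAt

theorem fderiv_symm_fderiv_map {y : E3} (hy : y ∈ (M.map e).source) (v : E3) :
    fderiv ℝ (M.map e).symm (M.map e y) (fderiv ℝ (M.map e) y v) = v := by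
  have h1 := (hasFDerivAt_symm ((M.map e).map_source hy)).comp y (hasFDerivAt_map hy)
  have h2 : HasFDerivAt ((M.map e).symm ∘ M.map e) (ContinuousLinearMap.id ℝ E3) y :=
    (hasFDerivAt_id y).congr_of_eventuallyEq ((M.map e).eventually_left_inverse hy)
  have := congrArg (fun A : E3 →L[ℝ] E3 => A v) (h1.unique h2)
  simpa using this

theorem fderiv_map_fderiv_symm {y : E3} (hy : y ∈ (M.map e).source) (v : E3) :
    fderiv ℝ (M.map e) y (fderiv ℝ (M.map e).symm (M.map e y) v) = v := by
  have hx := (M.map e).map_source hy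
  have h0 : HasFDerivAt (M.map e) (fderiv ℝ (M.map e) y) ((M.map e).symm (M.map e y)) := by
    rw [(M.map e).left_inv hy]; exact hasFDerivAt_map hy
  have h1 := h0.comp _ (hasFDerivAt_symm hx)
  have h2 : HasFDerivAt (M.map e ∘ (M.map e).symm) (ContinuousLinearMap.id ℝ E3) (M.map e y) :=
    (hasFDerivAt_id _).congr_of_eventuallyEq ((M.map e).eventually_right_inverse hx)
  have := congrArg (fun A : E3 →L[ℝ] E3 => A v) (h1.unique h2)
  simpa using this

theorem det_fderiv_map_ne_zero {y : E3} (hy : y ∈ (M.map e).source) :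
    (fderiv ℝ (M.map e) y).det ≠ 0 := by
  have h : (fderiv ℝ (M.map e).symm (M.map e y)).comp (fderiv ℝ (M.map e) y)
      = ContinuousLinearMap.id ℝ E3 := by
    ext1 v; exact fderiv_symm_fderiv_map hy v
  have h2 : (fderiv ℝ (M.map e).symm (M.map e y)).det * (fderiv ℝ (M.map e) y).det = 1 := by
    have := LinearMap.det_comp (fderiv ℝ (M.map e).symm (M.map e y) : E3 →ₗ[ℝ] E3)
      (fderiv ℝ (M.map e) y : E3 →ₗ[ℝ] E3)
    have h3 : (fderiv ℝ (M.map e).symm (M.map e y) : E3 →ₗ[ℝ] E3).comp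
        (fderiv ℝ (M.map e) y : E3 →ₗ[ℝ] E3) = LinearMap.id :=
      congrArg ContinuousLinearMap.toLinearMap h
    rw [h3, LinearMap.det_id] at this
    exact this.symm
  exact right_ne_zero_of_mul_eq_one h2

theorem hasFDerivAt_inner_symm {x : E3} (hx : x ∈ (M.map e).target)
    (i : Fin (M.ref e).nFacets) :
    HasFDerivAt (fun x' => ⟪(M.ref e).normal i, (M.map e).symm x'⟫_ℝ)
      ((innerSL ℝ ((M.ref e).normal i)).comp (fderiv ℝ (M.map e).symm x)) x :=
  (innerSL ℝ ((M.ref e).normal i)).hasFDerivAt.comp x (hasFDerivAt_symm hx)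

theorem inner_facetGrad {x : E3} (hx : x ∈ (M.map e).target) (i : Fin (M.ref e).nFacets)
    (v : E3) : ⟪M.facetGrad e i x, v⟫_ℝ
      = ⟪(M.ref e).normal i, fderiv ℝ (M.map e).symm x v⟫_ℝ := by
  unfold facetGrad gradient
  rw [(hasFDerivAt_inner_symm hx i).fderiv, InnerProductSpace.toDual_symm_apply]
  rfl

theorem hasFDerivAt_facetLevel {x : E3} (hx : x ∈ (M.map e).target)
    (i : Fin (M.ref e).nFacets) :
    HasFDerivAt (M.facetLevel e i) (innerSL ℝ (M.facetGrad e i x)) x := by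
  have := (hasFDerivAt_inner_symm hx i).sub_const ((M.ref e).offset i)
  have h : innerSL ℝ (M.facetGrad e i x)
      = (innerSL ℝ ((M.ref e).normal i)).comp (fderiv ℝ (M.map e).symm x) := by
    ext1 v
    exact inner_facetGrad hx i v
  rw [h]
  exact this

/-- The gradient is `Φ'⁻ᵀ aᵢ`, dual to `Φ'`. This identity pulls questions about facet gradients
back to the polytope. -/
theorem inner_facetGrad_map {y : E3} (hy : y ∈ (M.map e).source) (i : Fin (M.ref e).nFacets)
    (v : E3) : ⟪M.facetGrad e i (M.map e y), fderiv ℝ (M.map e) y v⟫_ℝ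
      = ⟪(M.ref e).normal i, v⟫_ℝ := by
  rw [inner_facetGrad ((M.map e).map_source hy), fderiv_symm_fderiv_map hy]

theorem facetGrad_ne_zero {x : E3} (hx : x ∈ (M.map e).target) (i : Fin (M.ref e).nFacets) :
    M.facetGrad e i x ≠ 0 := fun h => by
  have h1 := inner_facetGrad_map ((M.map e).map_target hx) i ((M.ref e).normal i)
  rw [(M.map e).right_inv hx, h, inner_zero_left, real_inner_self_eq_norm_sq,
    (M.ref e).norm_normal] at h1
  norm_num at h1

theorem continuousOn_fderiv_map : ContinuousOn (fderiv ℝ (M.map e)) (M.map e).source :=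
  (M.contDiffOn_map e).continuousOn_fderiv_of_isOpen (M.map e).open_source le_rfl

theorem continuousOn_facetGrad (i : Fin (M.ref e).nFacets) :
    ContinuousOn (M.facetGrad e i) (M.map e).target := by
  have h1 : ContinuousOn (fun x => (innerSL ℝ ((M.ref e).normal i)).comp
      (fderiv ℝ (M.map e).symm x)) (M.map e).target :=
    continuousOn_const.clm_comp
      ((M.contDiffOn_symm e).continuousOn_fderiv_of_isOpen (M.map e).open_target le_rfl)
  have h2 : ContinuousOn (fun x => (InnerProductSpace.toDual ℝ E3).symm
      ((innerSL ℝ ((M.ref e).normal i)).comp (fderiv ℝ (M.map e).symm x))) (M.map e).target :=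
    (InnerProductSpace.toDual ℝ E3).symm.continuous.comp_continuousOn h1
  refine h2.congr fun x hx => ?_
  unfold facetGrad gradient
  rw [(hasFDerivAt_inner_symm hx i).fderiv]

theorem continuousOn_facetNormal (i : Fin (M.ref e).nFacets) :
    ContinuousOn (M.facetNormal e i) (M.map e).target :=
  ((continuousOn_facetGrad i).norm.inv₀ fun _ hx => norm_ne_zero_iff.2 (facetGrad_ne_zero hx i)).smul
    (continuousOn_facetGrad i)

theorem norm_facetNormal {x : E3} (hx : x ∈ (M.map e).target) (i : Fin (M.ref e).nFacets) :
    ‖M.facetNormal e i x‖ = 1 := by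
  unfold facetNormal
  rw [norm_smul, norm_inv, norm_norm,
    inv_mul_cancel₀ (norm_ne_zero_iff.2 (facetGrad_ne_zero hx i))]

theorem continuousOn_areaDensity (i : Fin (M.ref e).nFacets) :
    ContinuousOn (M.areaDensity e i) (M.map e).source := by
  unfold areaDensity
  refine ContinuousOn.mul ?_ ?_
  · exact (ContinuousLinearMap.continuous_det.comp_continuousOn continuousOn_fderiv_map).abs
  · exact ((continuousOn_facetGrad i).comp (M.map e).continuousOn
      fun y hy => (M.map e).map_source hy).norm

theorem areaDensity_pos {y : E3} (hy : y ∈ (M.map e).source) (i : Fin (M.ref e).nFacets) :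
    0 < M.areaDensity e i y :=
  mul_pos (abs_pos.2 (det_fderiv_map_ne_zero hy))
    (norm_pos_iff.2 (facetGrad_ne_zero ((M.map e).map_source hy) i))

end DGMesh

theorem ContinuousOn.measurable_indicator_of {α β : Type*} [TopologicalSpace α]
    [MeasurableSpace α] [OpensMeasurableSpace α] [TopologicalSpace β] [MeasurableSpace β]
    [BorelSpace β] [Zero β] {f : α → β} {s : Set α} (hf : ContinuousOn f s)
    (hs : MeasurableSet s) : Measurable (s.indicator f) := by
  classical
  rw [← Set.piecewise_eq_indicator]
  exact hf.measurable_piecewise continuousOn_const hs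

/-- The pieces need only partition the points where the integrand is nonzero, up to a null set. This
lets boundary points drop out when the integrand vanishes there. -/
theorem MeasureTheory.setIntegral_eq_sum_of_ae {α ι : Type*} [MeasurableSpace α] [Fintype ι]
    {μ : MeasureTheory.Measure α} {A : Set α} {s : ι → Set α} {f : α → ℝ}
    (hA : MeasurableSet A) (hs : ∀ i, MeasurableSet (s i)) (hf : MeasureTheory.IntegrableOn f A μ)
    (hsub : ∀ i, s i ⊆ A)
    (hdisj : ∀ᵐ x ∂μ, x ∈ A → f x ≠ 0 → ∃! i, x ∈ s i) :
    ∫ x in A, f x ∂μ = ∑ i, ∫ x in s i, f x ∂μ := by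
  classical
  simp_rw [← MeasureTheory.integral_indicator hA, ← MeasureTheory.integral_indicator (hs _)]
  rw [← MeasureTheory.integral_finsetSum]
  · refine MeasureTheory.integral_congr_ae ?_
    filter_upwards [hdisj] with x hx
    by_cases hxA : x ∈ A
    · rw [Set.indicator_of_mem hxA]
      by_cases h0 : f x = 0
      · simp [Set.indicator, h0]
      obtain ⟨i, hi, huniq⟩ := hx hxA h0
      rw [Finset.sum_eq_single i]
      · rw [Set.indicator_of_mem hi]
      · exact fun j _ hj => Set.indicator_of_notMem (fun h => hj (huniq j h)) _
      · simp
    · rw [Set.indicator_of_notMem hxA, Finset.sum_eq_zero]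
      exact fun i _ => Set.indicator_of_notMem (fun h => hxA (hsub i h)) _
  · exact fun i _ => (hf.mono_set (hsub i)).integrable_indicator (hs i)

/-! ### Surface measures of facets and their agreement from both sides. -/

namespace DGMesh

open Set MeasureTheory

variable {M : DGMesh} {e e' : Fin M.nElem}

variable (M) in
/-- The surface measure of the facet `i` of the element `e`, as a measure on physical space. -/
noncomputable def facetMeasure (e : Fin M.nElem) (i : Fin (M.ref e).nFacets) : Measure E3 :=
  Measure.map ((M.ref e).carrier.indicator (M.map e))
    (((planeArea ((M.ref e).normal i) ((M.ref e).offset i)).restrict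
      (M.ref e).carrier).withDensity fun y =>
        ENNReal.ofReal ((M.ref e).carrier.indicator (M.areaDensity e i) y))

theorem measurableSet_carrier : MeasurableSet (M.ref e).carrier :=
  (M.ref e).isClosed_carrier.measurableSet

theorem measurable_indicator_map : Measurable ((M.ref e).carrier.indicator (M.map e)) :=
  ((M.map e).continuousOn.mono (M.subset_source e)).measurable_indicator_of measurableSet_carrier

theorem measurable_indicator_areaDensity (i : Fin (M.ref e).nFacets) :
    Measurable ((M.ref e).carrier.indicator (M.areaDensity e i)) :=
  ((continuousOn_areaDensity i).mono (M.subset_source e)).measurable_indicator_of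
    measurableSet_carrier

theorem measurable_ofReal_areaDensity (i : Fin (M.ref e).nFacets) : Measurable fun y =>
    ENNReal.ofReal ((M.ref e).carrier.indicator (M.areaDensity e i) y) :=
  (measurable_indicator_areaDensity i).ennreal_ofReal

theorem lintegral_facetMeasure (i : Fin (M.ref e).nFacets) {g : E3 → ENNReal}
    (hg : Measurable g) : ∫⁻ x, g x ∂(M.facetMeasure e i)
      = ∫⁻ y in (M.ref e).carrier, ENNReal.ofReal (M.areaDensity e i y) * g (M.map e y)
        ∂(planeArea ((M.ref e).normal i) ((M.ref e).offset i)) := by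
  unfold facetMeasure
  rw [lintegral_map hg measurable_indicator_map]
  refine (lintegral_withDensity_eq_lintegral_mul _ (measurable_ofReal_areaDensity i)
    (hg.comp measurable_indicator_map)).trans ?_
  refine setLIntegral_congr_fun measurableSet_carrier fun y hy => ?_
  simp [Set.indicator_of_mem hy]

instance (i : Fin (M.ref e).nFacets) : IsFiniteMeasure (M.facetMeasure e i) := by
  constructor
  have h1 : IntegrableOn (M.areaDensity e i) (M.ref e).carrier
      (planeArea ((M.ref e).normal i) ((M.ref e).offset i)) :=
    ((continuousOn_areaDensity i).mono (M.subset_source e)).integrableOn_compact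
      (M.ref e).isCompact_carrier
  have h2 := lintegral_facetMeasure (M := M) i (measurable_const (a := (1 : ENNReal)))
  simp only [lintegral_one, mul_one] at h2
  rw [h2]
  exact h1.lintegral_lt_top

theorem measurableSet_symm_image {Y : Set E3} (hY : MeasurableSet Y) (hYe : Y ⊆ M.closedElem e) :
    MeasurableSet ((M.map e).symm '' Y) :=
  hY.image_of_continuousOn_injOn
    ((M.map e).symm.continuousOn.mono (hYe.trans closedElem_subset_target))
    ((M.map e).symm.injOn.mono (hYe.trans closedElem_subset_target))

theorem facetMeasure_apply (i : Fin (M.ref e).nFacets) {Y : Set E3} (hY : MeasurableSet Y)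
    (hYe : Y ⊆ M.closedElem e) : M.facetMeasure e i Y
      = ∫⁻ y in (M.map e).symm '' Y,
        ENNReal.ofReal ((M.ref e).carrier.indicator (M.areaDensity e i) y)
          ∂(planeArea ((M.ref e).normal i) ((M.ref e).offset i)) := by
  rw [← lintegral_indicator_one hY, lintegral_facetMeasure i (measurable_one.indicator hY),
    ← lintegral_indicator measurableSet_carrier,
    ← lintegral_indicator (measurableSet_symm_image hY hYe)]
  congr 1
  ext1 y
  by_cases hy : y ∈ (M.ref e).carrier
  · rw [Set.indicator_of_mem hy]
    by_cases h : M.map e y ∈ Y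
    · have : y ∈ (M.map e).symm '' Y := ⟨_, h, (M.map e).left_inv (M.subset_source e hy)⟩
      simp [Set.indicator_of_mem this, h, Set.indicator_of_mem hy]
    · have : y ∉ (M.map e).symm '' Y := by
        rintro ⟨x, hx, rfl⟩
        rw [(M.map e).right_inv (closedElem_subset_target (hYe hx))] at h
        exact h hx
      simp [Set.indicator_of_notMem this, h]
  · have : y ∉ (M.map e).symm '' Y := by
      rintro ⟨x, hx, rfl⟩
      exact hy (symm_mem_source (hYe hx))
    simp [Set.indicator_of_notMem this, Set.indicator_of_notMem hy]

theorem ae_facetMeasure_of_ae (i : Fin (M.ref e).nFacets) {p : E3 → Prop}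
    (h : ∀ᵐ y ∂((planeArea ((M.ref e).normal i) ((M.ref e).offset i)).restrict
      (M.ref e).carrier), p (M.map e y)) :
    ∀ᵐ x ∂(M.facetMeasure e i), x ∈ M.closedElem e ∧ p x := by
  -- The property need not be measurable, so the exceptional set is first enlarged to a measurable
  -- null set. Its image is measurable because the parametrization is injective and continuous on
  -- the polytope.
  obtain ⟨s, hs, hsm, hs0⟩ := exists_measurable_superset_of_null (ae_iff.1 h)
  let N := s ∩ (M.ref e).carrier
  have hN : MeasurableSet N := hsm.inter measurableSet_carrier
  have hNK : N ⊆ (M.ref e).carrier := inter_subset_right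
  have hNm : MeasurableSet (M.map e '' N) :=
    hN.image_of_continuousOn_injOn ((M.map e).continuousOn.mono (hNK.trans (M.subset_source e)))
      ((M.map e).injOn.mono (hNK.trans (M.subset_source e)))
  have h1 : M.facetMeasure e i (M.map e '' N) = 0 := by
    rw [facetMeasure_apply i hNm (image_mono hNK)]
    have h2 : (M.map e).symm '' (M.map e '' N) = N := by
      rw [image_image]
      conv_rhs => rw [← image_id N]
      exact image_congr fun y hy => (M.map e).left_inv (M.subset_source e (hNK hy))
    rw [h2]
    refine setLIntegral_measure_zero _ _ ?_
    rw [← Measure.restrict_apply hsm]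
    exact hs0
  have h2 : M.facetMeasure e i (M.closedElem e)ᶜ = 0 := by
    have hm : MeasurableSet (M.closedElem e)ᶜ := isClosed_closedElem.measurableSet.compl
    rw [← lintegral_indicator_one hm, lintegral_facetMeasure i (measurable_one.indicator hm)]
    rw [setLIntegral_congr_fun (g := fun _ => 0) measurableSet_carrier, lintegral_zero]
    intro y hy
    have : M.map e y ∉ (M.closedElem e)ᶜ := fun hc => hc ⟨y, hy, rfl⟩
    simp [Set.indicator_of_notMem this]
  filter_upwards [compl_mem_ae_iff.2 h1, compl_mem_ae_iff.2 h2] with x hx1 hx2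
  replace hx2 := notMem_compl_iff.1 hx2
  refine ⟨hx2, ?_⟩
  obtain ⟨y, hy, rfl⟩ := hx2
  by_contra hp
  exact hx1 ⟨y, ⟨hs hp, hy⟩, rfl⟩

/-- The area density is strictly positive on the polytope, so null sets transfer back to the
reference facet. -/
theorem ae_of_ae_facetMeasure (i : Fin (M.ref e).nFacets) {p : E3 → Prop}
    (h : ∀ᵐ x ∂(M.facetMeasure e i), p x) :
    ∀ᵐ y ∂((planeArea ((M.ref e).normal i) ((M.ref e).offset i)).restrict
      (M.ref e).carrier), p (M.map e y) := by
  have h1 := ae_of_ae_map measurable_indicator_map.aemeasurable h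
  rw [ae_withDensity_iff (measurable_ofReal_areaDensity i)] at h1
  filter_upwards [h1, ae_restrict_mem measurableSet_carrier] with y hy hyK
  rw [Set.indicator_of_mem hyK, Set.indicator_of_mem hyK] at hy
  apply hy
  simp [areaDensity_pos (M.subset_source e hyK) i]

theorem facetIntegral_eq (i : Fin (M.ref e).nFacets) {T : Set E3} (hT : MeasurableSet T)
    {f : E3 → ℝ} (hf : AEStronglyMeasurable f ((M.facetMeasure e i).restrict T)) :
    M.facetIntegral e i T f = ∫ x in T, f x ∂(M.facetMeasure e i) := by
  have hmm := measurable_indicator_map (M := M) (e := e)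
  have hTm : MeasurableSet ((M.ref e).carrier.indicator (M.map e) ⁻¹' T) := hT.preimage hmm
  unfold facetMeasure at hf ⊢
  rw [Measure.restrict_map hmm hT] at hf ⊢
  rw [integral_map hmm.aemeasurable hf, restrict_withDensity hTm]
  simp only [ENNReal.ofReal]
  rw [integral_withDensity_eq_integral_smul (measurable_indicator_areaDensity i).real_toNNReal,
    Measure.restrict_restrict hTm]
  have hset : (M.ref e).carrier.indicator (M.map e) ⁻¹' T ∩ (M.ref e).carrier
      = {y | y ∈ (M.ref e).carrier ∧ M.map e y ∈ T} := by
    ext y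
    constructor
    · rintro ⟨h1, h2⟩
      rw [mem_preimage, Set.indicator_of_mem h2] at h1
      exact ⟨h2, h1⟩
    · rintro ⟨h1, h2⟩
      refine ⟨?_, h1⟩
      rwa [mem_preimage, Set.indicator_of_mem h1]
  rw [hset]
  unfold facetIntegral
  refine setIntegral_congr_fun (hset ▸ hTm.inter measurableSet_carrier) fun y hy => ?_
  have hpos := areaDensity_pos (M.subset_source e hy.1) i
  simp only [Set.indicator_of_mem hy.1]
  rw [NNReal.smul_def, Real.coe_toNNReal _ hpos.le, smul_eq_mul, mul_comm]

theorem isClosed_facet (i : Fin (M.ref e).nFacets) : IsClosed (M.facet e i) := by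
  have h1 : ContinuousOn (M.facetLevel e i) (M.closedElem e) := fun x hx =>
    ((hasFDerivAt_facetLevel (closedElem_subset_target hx)
      i).continuousAt).continuousWithinAt
  exact h1.preimage_isClosed_of_isClosed isClosed_closedElem isClosed_singleton

theorem facet_subset_closedElem (i : Fin (M.ref e).nFacets) : M.facet e i ⊆ M.closedElem e :=
  fun _ hx => hx.1

theorem ae_mem_facet (i : Fin (M.ref e).nFacets) :
    ∀ᵐ x ∂(M.facetMeasure e i), x ∈ M.facet e i := by
  refine ae_facetMeasure_of_ae i (p := fun x => M.facetLevel e i x = 0) ?_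
  filter_upwards [ae_restrict_of_ae (ae_planeArea_inner ((M.ref e).norm_normal i)
    ((M.ref e).offset i)), ae_restrict_mem measurableSet_carrier] with y hy hyK
  simp only [facetLevel]
  rw [(M.map e).left_inv (M.subset_source e hyK), hy, sub_self]

/-- The level function of facet `k`, pulled back to the plane of facet `i`, vanishes where the
facets meet. Its tangential derivatives therefore vanish almost everywhere there, so both gradients
annihilate the same tangent plane. The case `e' = e` is included. -/
theorem ae_facetGrad_parallel (i : Fin (M.ref e).nFacets) (k : Fin (M.ref e').nFacets) :
    ∀ᵐ x ∂(M.facetMeasure e i), x ∈ M.facet e' k →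
      ∃ r : ℝ, M.facetGrad e' k x = r • M.facetGrad e i x := by
  have hgoal : ∀ᵐ y ∂((planeArea ((M.ref e).normal i) ((M.ref e).offset i)).restrict
      (M.ref e).carrier), M.map e y ∈ M.facet e' k →
      ∃ r : ℝ, M.facetGrad e' k (M.map e y) = r • M.facetGrad e i (M.map e y) := by
    let T : Set E3 := {y | y ∈ (M.ref e).carrier ∧ M.map e y ∈ M.facet e' k}
    have hT : MeasurableSet T :=
      (((M.map e).continuousOn.mono (M.subset_source e)).preimage_isClosed_of_isClosed
        (M.ref e).isClosed_carrier (isClosed_facet k)).measurableSet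
    have hsrc : ∀ y ∈ T, y ∈ (M.map e).source := fun y hy => M.subset_source e hy.1
    have hder : ∀ y ∈ T, HasFDerivAt (M.facetLevel e' k ∘ M.map e)
        ((innerSL ℝ (M.facetGrad e' k (M.map e y))).comp (fderiv ℝ (M.map e) y)) y :=
      fun y hy => (hasFDerivAt_facetLevel (closedElem_subset_target hy.2.1) k).comp y
        (hasFDerivAt_map (hsrc y hy))
    have := ae_fderiv_tangent_eq_zero ((M.ref e).norm_normal i) ((M.ref e).offset i) hT
      _ _ hder fun y hy => hy.2.2
    rw [ae_restrict_iff' hT] at this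
    rw [ae_restrict_iff' measurableSet_carrier]
    filter_upwards [this] with y hy hyK hyf
    have hys := M.subset_source e hyK
    have hpar := hy ⟨hyK, hyf⟩
    set a := (M.ref e).normal i
    set A := fderiv ℝ (M.map e) y
    set g' := M.facetGrad e' k (M.map e y)
    have ha : ‖a‖ = 1 := (M.ref e).norm_normal i
    -- The factor is found by testing with `A a`, whose inner product with the gradient of facet `i`
    -- is `1`.
    refine ⟨⟪g', A a⟫_ℝ, ?_⟩
    refine ext_inner_right ℝ fun w => ?_
    have hw : A (fderiv ℝ (M.map e).symm (M.map e y) w) = w := fderiv_map_fderiv_symm hys w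
    set v := fderiv ℝ (M.map e).symm (M.map e y) w
    have h1 : ⟪g', A (v - ⟪a, v⟫_ℝ • a)⟫_ℝ = 0 := by
      apply hpar
      rw [inner_sub_right, inner_smul_right, real_inner_self_eq_norm_sq, ha]
      simp
    rw [map_sub, map_smul, inner_sub_right, inner_smul_right] at h1
    rw [inner_smul_left, ← hw, inner_facetGrad_map hys]
    simp only [conj_trivial]
    linarith
  filter_upwards [ae_facetMeasure_of_ae i (p := fun x => x ∈ M.facet e' k →
    ∃ r : ℝ, M.facetGrad e' k x = r • M.facetGrad e i x) hgoal] with x hx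
  exact hx.2

variable (M) in
/-- A point of the facet `i` of `e` through which no element has two facets, and at which all
facets are tangent to each other. -/
def IsRegularFacetPoint (e : Fin M.nElem) (i : Fin (M.ref e).nFacets) (x : E3) : Prop :=
  x ∈ M.facet e i ∧ ∀ e' k, x ∈ M.facet e' k → (∀ l, x ∈ M.facet e' l → l = k) ∧
    ∃ r : ℝ, M.facetGrad e' k x = r • M.facetGrad e i x

theorem eq_of_facetGrad_parallel {x : E3} {k l : Fin (M.ref e).nFacets} (hk : x ∈ M.facet e k)
    (hl : x ∈ M.facet e l) {r : ℝ} (h : M.facetGrad e l x = r • M.facetGrad e k x) : l = k := by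
  have hxt := closedElem_subset_target hk.1
  have hy := (M.map e).map_target hxt
  refine (M.ref e).eq_of_parallel (y := (M.map e).symm x) (r := r)
    (sub_eq_zero.1 hk.2) (sub_eq_zero.1 hl.2) ?_
  refine ext_inner_right ℝ fun v => ?_
  rw [← inner_facetGrad_map hy l, (M.map e).right_inv hxt, h, inner_smul_left, inner_smul_left]
  congr 1
  rw [← inner_facetGrad_map hy k, (M.map e).right_inv hxt]

/-- Two facets of one element through a common point would both be tangent to facet `i`, hence have
parallel gradients, which is impossible in a polytope. Edges are therefore negligible. -/
theorem ae_isRegularFacetPoint (i : Fin (M.ref e).nFacets) :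
    ∀ᵐ x ∂(M.facetMeasure e i), M.IsRegularFacetPoint e i x := by
  have hall : ∀ᵐ x ∂(M.facetMeasure e i), ∀ e' k, x ∈ M.facet e' k →
      ∃ r : ℝ, M.facetGrad e' k x = r • M.facetGrad e i x :=
    ae_all_iff.2 fun _ => ae_all_iff.2 fun k => ae_facetGrad_parallel i k
  filter_upwards [hall, ae_mem_facet i] with x hx hxi
  refine ⟨hxi, fun e' k hk => ⟨fun l hl => ?_, hx e' k hk⟩⟩
  obtain ⟨r, hr⟩ := hx e' k hk
  obtain ⟨s, hs⟩ := hx e' l hl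
  have hr0 : r ≠ 0 := fun h0 => by
    rw [h0, zero_smul] at hr
    exact facetGrad_ne_zero (closedElem_subset_target hk.1) k hr
  apply eq_of_facetGrad_parallel hk hl (r := s / r)
  rw [hs, hr, smul_smul, div_mul_cancel₀ _ hr0]

/-- Along `w` the level of facet `i` decreases from zero to first order, while the other levels are
strictly negative at `x` and stay so by continuity. -/
theorem eventually_mem_elem {x w : E3} {i : Fin (M.ref e).nFacets} (hx : x ∈ M.facet e i)
    (huniq : ∀ l, x ∈ M.facet e l → l = i) (hw : ⟪M.facetGrad e i x, w⟫_ℝ < 0) :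
    ∀ᶠ t : ℝ in 𝓝[>] 0, x + t • w ∈ M.elem e := by
  have hxt := closedElem_subset_target hx.1
  have hpath : HasDerivAt (fun t : ℝ => x + t • w) w 0 := by
    simpa using ((hasDerivAt_id (0 : ℝ)).smul_const w).const_add x
  have hc : Filter.Tendsto (fun t : ℝ => x + t • w) (𝓝 0) (𝓝 x) := by
    simpa using hpath.continuousAt.tendsto
  have h1 : ∀ᶠ t : ℝ in 𝓝[>] 0, x + t • w ∈ (M.map e).target :=
    nhdsWithin_le_nhds (hc.eventually ((M.map e).open_target.mem_nhds hxt))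
  have h2 : ∀ l, ∀ᶠ t : ℝ in 𝓝[>] 0, M.facetLevel e l (x + t • w) < 0 := by
    intro l
    by_cases hl : l = i
    · subst hl
      have hd : HasDerivAt (fun t : ℝ => M.facetLevel e l (x + t • w))
          ⟪M.facetGrad e l x, w⟫_ℝ 0 := by
        have h0 : HasFDerivAt (M.facetLevel e l) (innerSL ℝ (M.facetGrad e l x))
            (x + (0 : ℝ) • w) := by simpa using hasFDerivAt_facetLevel hxt l
        exact h0.comp_hasDerivAt 0 hpath
      have hs' : Filter.Tendsto (slope (fun t : ℝ => M.facetLevel e l (x + t • w)) 0)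
          (𝓝[>] 0) (𝓝 ⟪M.facetGrad e l x, w⟫_ℝ) :=
        (hasDerivAt_iff_tendsto_slope.1 hd).mono_left
          (nhdsWithin_mono _ fun t ht => (ne_of_gt ht : t ≠ 0))
      filter_upwards [hs'.eventually_lt_const hw, self_mem_nhdsWithin] with t ht htpos
      have htpos : 0 < t := htpos
      rw [slope_def_field] at ht
      simp only [zero_smul, add_zero, sub_zero, hx.2] at ht
      by_contra hcon
      exact absurd (div_nonneg (not_lt.1 hcon) htpos.le) (not_le.2 ht)
    · have hlt : M.facetLevel e l x < 0 :=
        lt_of_le_of_ne (facetLevel_nonpos hx.1 l) fun h => hl (huniq l ⟨hx.1, h⟩)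
      have hcl : ContinuousAt (M.facetLevel e l) x := (hasFDerivAt_facetLevel hxt l).continuousAt
      exact nhdsWithin_le_nhds ((hcl.tendsto.comp hc).eventually_lt_const hlt)
  filter_upwards [h1, Filter.eventually_all.2 h2] with t ht1 ht2
  exact (mem_elem_iff ht1).2 ht2

/-- With a positive factor, a small step against the common gradient direction would enter both open
elements, which are disjoint. -/
theorem parallel_factor_neg (h : e ≠ e') {x : E3} {i : Fin (M.ref e).nFacets}
    {k : Fin (M.ref e').nFacets} (hi : x ∈ M.facet e i) (hi' : ∀ l, x ∈ M.facet e l → l = i)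
    (hk : x ∈ M.facet e' k) (hk' : ∀ l, x ∈ M.facet e' l → l = k) {r : ℝ}
    (hr : M.facetGrad e' k x = r • M.facetGrad e i x) : r < 0 := by
  have hg := facetGrad_ne_zero (closedElem_subset_target hi.1) i
  have hg' := facetGrad_ne_zero (closedElem_subset_target hk.1) k
  have hr0 : r ≠ 0 := fun h0 => hg' (by rw [hr, h0, zero_smul])
  by_contra hcon
  have hrpos : 0 < r := lt_of_le_of_ne (not_lt.1 hcon) hr0.symm
  have hpos : 0 < ⟪M.facetGrad e i x, M.facetGrad e i x⟫_ℝ := real_inner_self_pos.2 hg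
  have h1 := eventually_mem_elem (w := -M.facetGrad e i x) hi hi' (by
    rw [inner_neg_right]; linarith)
  have h2 := eventually_mem_elem (w := -M.facetGrad e i x) hk hk' (by
    rw [hr, inner_neg_right, inner_smul_left]
    simp only [conj_trivial]
    nlinarith)
  obtain ⟨t, ht1, ht2⟩ := (h1.and h2).exists
  exact disjoint_left.1 (elem_disjoint h) ht1 ht2

namespace IsRegularFacetPoint

variable {i : Fin (M.ref e).nFacets} {x : E3}

theorem facet_unique (hx : M.IsRegularFacetPoint e i x) {k l : Fin (M.ref e').nFacets}
    (hk : x ∈ M.facet e' k) (hl : x ∈ M.facet e' l) : l = k := (hx.2 e' k hk).1 l hl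

theorem facetNormal_eq_neg (hx : M.IsRegularFacetPoint e i x) (h : e ≠ e')
    {k : Fin (M.ref e').nFacets} (hk : x ∈ M.facet e' k) :
    M.facetNormal e' k x = -M.facetNormal e i x := by
  obtain ⟨r, hr⟩ := (hx.2 e' k hk).2
  have hneg := parallel_factor_neg h hx.1 (fun l hl => hx.facet_unique hx.1 hl) hk
    (fun l hl => hx.facet_unique hk hl) hr
  unfold facetNormal
  rw [hr, norm_smul, Real.norm_eq_abs, abs_of_neg hneg, smul_smul, ← neg_smul]
  congr 1
  rw [mul_inv, mul_right_comm, inv_neg, neg_mul, inv_mul_cancel₀ hneg.ne]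
  ring

/-- Three distinct elements at one regular point would have pairwise oppositely directed gradients.
But the factors `r` and `s` relative to `e` are negative, so the factor `s / r` between the other
two is positive. -/
theorem eq_of_mem_closedElem (hx : M.IsRegularFacetPoint e i x) {e₁ e₂ : Fin M.nElem}
    (h₁ : e₁ ≠ e) (h₂ : e₂ ≠ e) (hx₁ : x ∈ M.closedElem e₁) (hx₂ : x ∈ M.closedElem e₂) :
    e₁ = e₂ := by
  by_contra hne
  obtain ⟨k, hk⟩ := exists_mem_facet_of_mem_facet h₁.symm hx.1.1 hx₁
  obtain ⟨l, hl⟩ := exists_mem_facet_of_mem_facet h₂.symm hx.1.1 hx₂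
  obtain ⟨r, hr⟩ := (hx.2 e₁ k hk).2
  obtain ⟨s, hs⟩ := (hx.2 e₂ l hl).2
  have hr' := parallel_factor_neg h₁.symm hx.1 (fun l hl => hx.facet_unique hx.1 hl) hk
    (fun l hl => hx.facet_unique hk hl) hr
  have hs' := parallel_factor_neg h₂.symm hx.1 (fun l hl => hx.facet_unique hx.1 hl) hl
    (fun m hm => hx.facet_unique hl hm) hs
  have := parallel_factor_neg hne hk (fun l hl => hx.facet_unique hk hl) hl
    (fun m hm => hx.facet_unique hl hm) (r := s / r)
    (by rw [hs, hr, smul_smul, div_mul_cancel₀ _ hr'.ne])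
  exact absurd (div_pos_of_neg_of_neg hs' hr') (not_lt.2 this.le)

end IsRegularFacetPoint

/-- The transition map between the two reference polytopes carries one part of a facet plane to the
other, and the area formula matches Nanson's densities. The tangency it requires holds off a null
set for either measure. -/
theorem facetMeasure_restrict_eq (i : Fin (M.ref e).nFacets)
    (k : Fin (M.ref e').nFacets) :
    (M.facetMeasure e i).restrict (M.facet e' k) = (M.facetMeasure e' k).restrict (M.facet e i) := by
  -- `D` vanishes exactly when the gradients are parallel. Being continuous on the intersection of
  -- the facets, it exhibits the tangency set `X` as closed, hence measurable.
  let D : E3 → E3 := fun x => ⟪M.facetGrad e i x, M.facetGrad e i x⟫_ℝ • M.facetGrad e' k x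
    - ⟪M.facetGrad e i x, M.facetGrad e' k x⟫_ℝ • M.facetGrad e i x
  let X : Set E3 := (M.facet e i ∩ M.facet e' k) ∩ D ⁻¹' {0}
  have hXe : X ⊆ M.closedElem e := fun x hx => hx.1.1.1
  have hXe' : X ⊆ M.closedElem e' := fun x hx => hx.1.2.1
  have hD : ContinuousOn D (M.facet e i ∩ M.facet e' k) := by
    have hg : ContinuousOn (M.facetGrad e i) (M.facet e i ∩ M.facet e' k) :=
      (continuousOn_facetGrad i).mono fun x hx => closedElem_subset_target hx.1.1
    have hg' : ContinuousOn (M.facetGrad e' k) (M.facet e i ∩ M.facet e' k) :=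
      (continuousOn_facetGrad k).mono fun x hx => closedElem_subset_target hx.2.1
    exact ((hg.inner (𝕜 := ℝ) hg).smul hg').sub ((hg.inner (𝕜 := ℝ) hg').smul hg)
  have hX : MeasurableSet X :=
    (hD.preimage_isClosed_of_isClosed ((isClosed_facet i).inter (isClosed_facet k))
      isClosed_singleton).measurableSet
  have hDpar : ∀ x, ∀ r : ℝ, M.facetGrad e' k x = r • M.facetGrad e i x → D x = 0 := by
    intro x r hr
    simp only [D, hr, inner_smul_right, smul_smul]
    rw [mul_comm, sub_self]
  have hparX : ∀ x ∈ X, ∃ r : ℝ, M.facetGrad e' k x = r • M.facetGrad e i x := by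
    intro x hx
    have hpos : ⟪M.facetGrad e i x, M.facetGrad e i x⟫_ℝ ≠ 0 :=
      (real_inner_self_pos.2 (facetGrad_ne_zero (closedElem_subset_target hx.1.1.1) i)).ne'
    refine ⟨⟪M.facetGrad e i x, M.facetGrad e' k x⟫_ℝ / ⟪M.facetGrad e i x, M.facetGrad e i x⟫_ℝ,
      ?_⟩
    have h0 : D x = 0 := hx.2
    rw [div_eq_inv_mul, ← smul_smul, ← sub_eq_zero.1 h0, smul_smul, inv_mul_cancel₀ hpos, one_smul]
  have hr1 : (M.facetMeasure e i).restrict (M.facet e' k) = (M.facetMeasure e i).restrict X := by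
    refine Measure.restrict_congr_set ?_
    filter_upwards [ae_mem_facet i, ae_facetGrad_parallel (e' := e') i k] with x hx1 hx2
    refine propext ⟨fun hx => ?_, fun hx => hx.1.2⟩
    obtain ⟨r, hr⟩ := hx2 hx
    exact ⟨⟨hx1, hx⟩, hDpar x r hr⟩
  have hr2 : (M.facetMeasure e' k).restrict (M.facet e i) = (M.facetMeasure e' k).restrict X := by
    refine Measure.restrict_congr_set ?_
    filter_upwards [ae_mem_facet k, ae_facetGrad_parallel (e' := e) k i] with x hx1 hx2
    refine propext ⟨fun hx => ?_, fun hx => hx.1.1⟩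
    obtain ⟨r, hr⟩ := hx2 hx
    have hr0 : r ≠ 0 := fun h0 => by
      rw [h0, zero_smul] at hr
      exact facetGrad_ne_zero (closedElem_subset_target hx.1) i hr
    exact ⟨⟨hx, hx1⟩, hDpar x r⁻¹ (by rw [hr, smul_smul, inv_mul_cancel₀ hr0, one_smul])⟩
  rw [hr1, hr2]
  ext1 B hB
  rw [Measure.restrict_apply hB, Measure.restrict_apply hB]
  set Y := B ∩ X
  have hY : MeasurableSet Y := hB.inter hX
  have hYX : Y ⊆ X := inter_subset_right
  rw [facetMeasure_apply i hY (hYX.trans hXe), facetMeasure_apply k hY (hYX.trans hXe')]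
  let ψ : E3 → E3 := fun y => (M.map e').symm (M.map e y)
  have hψ : ψ '' ((M.map e).symm '' Y) = (M.map e').symm '' Y := by
    rw [image_image]
    refine image_congr fun x hx => ?_
    simp only [ψ]
    rw [(M.map e).right_inv (closedElem_subset_target (hXe (hYX hx)))]
  rw [← hψ]
  have hsrc : ∀ x ∈ Y, (M.map e).symm x ∈ (M.map e).source := fun x hx =>
    (M.map e).map_target (closedElem_subset_target (hXe (hYX hx)))
  have hright : ∀ x ∈ Y, M.map e ((M.map e).symm x) = x := fun x hx =>
    (M.map e).right_inv (closedElem_subset_target (hXe (hYX hx)))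
  have hright' : ∀ x ∈ Y, M.map e' ((M.map e').symm x) = x := fun x hx =>
    (M.map e').right_inv (closedElem_subset_target (hXe' (hYX hx)))
  let L : E3 → E3 →L[ℝ] E3 := fun y =>
    (fderiv ℝ (M.map e').symm (M.map e y)).comp (fderiv ℝ (M.map e) y)
  have hinner : ∀ x ∈ Y, ∀ v, ⟪(M.ref e').normal k, L ((M.map e).symm x) v⟫_ℝ
      = ⟪M.facetGrad e' k x, fderiv ℝ (M.map e) ((M.map e).symm x) v⟫_ℝ := by
    intro x hx v
    rw [inner_facetGrad (closedElem_subset_target (hXe' (hYX hx))) k]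
    simp [L, hright x hx]
  have hinner2 : ∀ x ∈ Y, ∀ r : ℝ, M.facetGrad e' k x = r • M.facetGrad e i x →
      ∀ v, ⟪(M.ref e').normal k, L ((M.map e).symm x) v⟫_ℝ = r * ⟪(M.ref e).normal i, v⟫_ℝ := by
    intro x hx r hr v
    rw [hinner x hx, hr, inner_smul_left, ← inner_facetGrad_map (hsrc x hx) i v, hright x hx]
    simp
  symm
  refine lintegral_image_planeArea ((M.ref e).norm_normal i) ((M.ref e').norm_normal k) _ _
    (measurableSet_symm_image hY (hYX.trans hXe)) ?_ ψ L ?_ ?_ ?_ ?_ ?_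
    (measurable_ofReal_areaDensity k) (measurable_ofReal_areaDensity i) ?_ ?_
  · rintro _ ⟨x, hx, rfl⟩
    exact sub_eq_zero.1 (hYX hx).1.1.2
  · rintro _ ⟨x, hx, rfl⟩
    refine HasFDerivAt.comp _ (hasFDerivAt_symm ?_) (hasFDerivAt_map (hsrc x hx))
    rw [hright x hx]
    exact closedElem_subset_target (hXe' (hYX hx))
  · rintro _ ⟨x, hx, rfl⟩ _ ⟨x', hx', rfl⟩ heq
    simp only [ψ, hright x hx, hright x' hx'] at heq
    rw [← hright' x hx, ← hright' x' hx', heq]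
  · rintro _ ⟨x, hx, rfl⟩
    simp only [ψ, hright x hx]
    exact sub_eq_zero.1 (hYX hx).1.2.2
  · rintro _ ⟨x, hx, rfl⟩ v hv
    obtain ⟨r, hr⟩ := hparX x (hYX hx)
    rw [hinner2 x hx r hr, hv, mul_zero]
  · rw [hψ]
    exact measurableSet_symm_image hY (hYX.trans hXe')
  · rintro _ ⟨x, hx, rfl⟩
    obtain ⟨r, hr⟩ := hparX x (hYX hx)
    have hr0 : r ≠ 0 := fun h0 => by
      rw [h0, zero_smul] at hr
      exact facetGrad_ne_zero (closedElem_subset_target (hXe' (hYX hx))) k hr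
    rw [hinner2 x hx r hr, real_inner_self_eq_norm_sq, (M.ref e).norm_normal]
    simpa using hr0
  · rintro _ ⟨x, hx, rfl⟩
    obtain ⟨r, hr⟩ := hparX x (hYX hx)
    have hr0 : r ≠ 0 := fun h0 => by
      rw [h0, zero_smul] at hr
      exact facetGrad_ne_zero (closedElem_subset_target (hXe' (hYX hx))) k hr
    have hK := symm_mem_source (hXe (hYX hx))
    have hK' := symm_mem_source (hXe' (hYX hx))
    rw [hinner2 x hx r hr, real_inner_self_eq_norm_sq, (M.ref e).norm_normal, one_pow, mul_one]
    simp only [ψ, hright x hx]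
    rw [Set.indicator_of_mem hK, Set.indicator_of_mem hK', ← ENNReal.ofReal_mul (by positivity)]
    congr 1
    simp only [areaDensity, hright x hx, hright' x hx]
    rw [hr, norm_smul, Real.norm_eq_abs]
    have hdet : (fderiv ℝ (M.map e) ((M.map e).symm x)).det
        = (fderiv ℝ (M.map e') ((M.map e').symm x)).det * (L ((M.map e).symm x)).det := by
      have h1 : fderiv ℝ (M.map e) ((M.map e).symm x)
          = (fderiv ℝ (M.map e') ((M.map e').symm x)).comp (L ((M.map e).symm x)) := by
        ext1 v
        have := fderiv_map_fderiv_symm ((M.map e').map_target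
          (closedElem_subset_target (hXe' (hYX hx))))
          (fderiv ℝ (M.map e) ((M.map e).symm x) v)
        rw [hright' x hx] at this
        simp only [L, ContinuousLinearMap.comp_apply, hright x hx]
        exact this.symm
      conv_lhs => rw [h1]
      exact LinearMap.det_comp _ _
    rw [hdet, abs_mul]
    field_simp

end DGMesh

/-! ### Cancellation of normal fluxes between neighbouring elements. -/

namespace DGMesh

open Set MeasureTheory

variable {M : DGMesh} {e e' : Fin M.nElem}

theorem integrableOn_facetMeasure (i : Fin (M.ref e).nFacets) {T : Set E3} (hT : IsClosed T)
    {f : E3 → ℝ} (hf : ContinuousOn f (M.closedElem e ∩ T)) :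
    IntegrableOn f T (M.facetMeasure e i) := by
  have h1 : IntegrableOn f (M.closedElem e ∩ T) (M.facetMeasure e i) :=
    hf.integrableOn_compact (isCompact_closedElem.inter_right hT)
  refine h1.congr_set_ae ?_
  filter_upwards [ae_mem_facet i] with x hx
  exact propext ⟨fun h => ⟨hx.1, h⟩, fun h => h.2⟩

theorem facetIntegral_eq_of_continuousOn (i : Fin (M.ref e).nFacets) {T : Set E3}
    (hT : IsClosed T) {f : E3 → ℝ} (hf : ContinuousOn f (M.closedElem e ∩ T)) :
    M.facetIntegral e i T f = ∫ x in T, f x ∂(M.facetMeasure e i) :=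
  facetIntegral_eq i hT.measurableSet (integrableOn_facetMeasure i hT hf).aestronglyMeasurable

theorem continuousOn_inner_facetNormal (i : Fin (M.ref e).nFacets) (v : E3) :
    ContinuousOn (fun x => ⟪M.facetNormal e i x, v⟫_ℝ) (M.closedElem e) :=
  ((continuousOn_facetNormal i).mono closedElem_subset_target).inner (𝕜 := ℝ) continuousOn_const

/-- The two elements that share a face see opposite normals there. -/
theorem sum_setIntegral_facetNormal_eq_neg (h : e ≠ e') {f : E3 → ℝ}
    (hf : ContinuousOn f (M.closedElem e ∩ M.closedElem e')) (v : E3) :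
    ∑ i, ∫ x in M.closedElem e', f x * ⟪M.facetNormal e i x, v⟫_ℝ ∂(M.facetMeasure e i)
      = -∑ k, ∫ x in M.closedElem e, f x * ⟪M.facetNormal e' k x, v⟫_ℝ
        ∂(M.facetMeasure e' k) := by
  -- A regular point lies on exactly one facet of the neighbour. Splitting both sides by pairs of
  -- facets allows a comparison pair by pair, where the measures agree and the normals are opposite.
  have split : ∀ {e₁ e₂ : Fin M.nElem}, e₁ ≠ e₂ →
      ContinuousOn f (M.closedElem e₁ ∩ M.closedElem e₂) → ∀ i,
      ∫ x in M.closedElem e₂, f x * ⟪M.facetNormal e₁ i x, v⟫_ℝ ∂(M.facetMeasure e₁ i)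
      = ∑ k, ∫ x in M.facet e₂ k, f x * ⟪M.facetNormal e₁ i x, v⟫_ℝ ∂(M.facetMeasure e₁ i) := by
    intro e₁ e₂ hne hf i
    refine setIntegral_eq_sum_of_ae isClosed_closedElem.measurableSet
      (fun k => (isClosed_facet k).measurableSet)
      (integrableOn_facetMeasure i isClosed_closedElem
        (hf.mul ((continuousOn_inner_facetNormal i v).mono inter_subset_left)))
      facet_subset_closedElem ?_
    filter_upwards [ae_isRegularFacetPoint i] with x hx hx2 _
    obtain ⟨k, hk⟩ := exists_mem_facet_of_mem_facet hne hx.1.1 hx2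
    exact ⟨k, hk, fun l hl => hx.facet_unique hk hl⟩
  simp_rw [split h hf]
  rw [inter_comm] at hf
  simp_rw [split h.symm hf]
  rw [Finset.sum_comm, ← Finset.sum_neg_distrib]
  refine Finset.sum_congr rfl fun k _ => ?_
  rw [← Finset.sum_neg_distrib]
  refine Finset.sum_congr rfl fun i _ => ?_
  rw [← facetMeasure_restrict_eq i k, ← integral_neg]
  refine setIntegral_congr_ae (isClosed_facet k).measurableSet ?_
  filter_upwards [ae_isRegularFacetPoint i] with x hx hk
  rw [hx.facetNormal_eq_neg h hk, inner_neg_left]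
  ring

/-- The facet integrals over all elements are the integrals of the jumps over the interior faces
if the integrand vanishes on the boundary. -/
theorem sum_facetMeasure_eq_sum_jump (f : Fin M.nElem → E3 → ℝ)
    (hf : ∀ e, ContinuousOn (f e) (M.closedElem e))
    (hbdry : ∀ e i, ∀ᵐ x ∂(M.facetMeasure e i), x ∈ frontier M.domain → f e x = 0) (v : E3) :
    ∑ e, ∑ i, ∫ x, f e x * ⟪M.facetNormal e i x, v⟫_ℝ ∂(M.facetMeasure e i)
      = ∑ e, ∑ e', if e < e' then ∑ i, ∫ x in M.closedElem e',
        (f e x - f e' x) * ⟪M.facetNormal e i x, v⟫_ℝ ∂(M.facetMeasure e i) else 0 := by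
  have hcn : ∀ e i, ContinuousOn (fun x => f e x * ⟪M.facetNormal e i x, v⟫_ℝ) (M.closedElem e) :=
    fun e i => (hf e).mul (continuousOn_inner_facetNormal i v)
  -- A regular facet point off the boundary lies in exactly one other closed element. Boundary
  -- points contribute nothing by `hbdry`.
  have h1 : ∀ e i, ∫ x, f e x * ⟪M.facetNormal e i x, v⟫_ℝ ∂(M.facetMeasure e i)
      = ∑ e' : {e' // e' ≠ e}, ∫ x in M.closedElem e',
        f e x * ⟪M.facetNormal e i x, v⟫_ℝ ∂(M.facetMeasure e i) := by
    intro e i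
    rw [← setIntegral_univ]
    refine setIntegral_eq_sum_of_ae MeasurableSet.univ
      (fun e' => isClosed_closedElem.measurableSet)
      (integrableOn_facetMeasure i isClosed_univ ((hcn e i).mono inter_subset_left))
      (fun _ => subset_univ _) ?_
    filter_upwards [ae_isRegularFacetPoint i, hbdry e i] with x hx hxb _ hne
    have hxf : x ∉ frontier M.domain := fun h => hne (by rw [hxb h, zero_mul])
    obtain ⟨e', he', hxe'⟩ := facet_subset hx.1 hxf
    exact ⟨⟨e', he'⟩, hxe', fun e'' he'' =>
      Subtype.ext (hx.eq_of_mem_closedElem e''.2 he' he'' hxe')⟩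
  let J : Fin M.nElem → Fin M.nElem → ℝ := fun e e' => ∑ i, ∫ x in M.closedElem e',
        f e x * ⟪M.facetNormal e i x, v⟫_ℝ ∂(M.facetMeasure e i)
  have h2 : ∀ e, ∑ i, ∫ x, f e x * ⟪M.facetNormal e i x, v⟫_ℝ ∂(M.facetMeasure e i)
      = ∑ e', if e < e' then J e e' else if e' < e then J e e' else 0 := by
    intro e
    simp_rw [h1]
    rw [Finset.sum_comm]
    simp only [J]
    rw [← Finset.sum_subtype (Finset.univ.filter (· ≠ e)) (by simp)
      (fun e' => ∑ i, ∫ x in M.closedElem e', f e x * ⟪M.facetNormal e i x, v⟫_ℝ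
        ∂(M.facetMeasure e i)), Finset.sum_filter]
    refine Finset.sum_congr rfl fun e' _ => ?_
    rcases lt_trichotomy e e' with h | h | h
    · simp [h, h.ne']
    · simp [h]
    · simp [h, h.ne]
  have h3 : ∀ e e', e < e' → J e e' + J e' e = ∑ i, ∫ x in M.closedElem e',
        (f e x - f e' x) * ⟪M.facetNormal e i x, v⟫_ℝ ∂(M.facetMeasure e i) := by
    intro e e' h
    have hfe' : ContinuousOn (f e') (M.closedElem e' ∩ M.closedElem e) :=
      (hf e').mono inter_subset_left
    have := sum_setIntegral_facetNormal_eq_neg h.ne' hfe' v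
    simp only [J]
    rw [this, ← sub_eq_add_neg, ← Finset.sum_sub_distrib]
    refine Finset.sum_congr rfl fun i _ => ?_
    rw [← integral_sub]
    · simp only [sub_mul]
    · exact integrableOn_facetMeasure i isClosed_closedElem ((hcn e i).mono inter_subset_left)
    · refine integrableOn_facetMeasure i isClosed_closedElem (ContinuousOn.mul ?_
        ((continuousOn_inner_facetNormal i v).mono inter_subset_left))
      exact (hf e').mono inter_subset_right
  simp_rw [h2]
  have h4 : ∀ e e', (if e < e' then J e e' else if e' < e then J e e' else 0)
      = (if e < e' then J e e' else 0) + if e' < e then J e e' else 0 := by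
    intro e e'
    rcases lt_trichotomy e e' with h | h | h
    · simp [h, h.le.not_gt]
    · simp [h]
    · simp [h, h.le.not_gt]
  simp_rw [h4, Finset.sum_add_distrib]
  conv_lhs => enter [2]; rw [Finset.sum_comm]
  rw [← Finset.sum_add_distrib]
  refine Finset.sum_congr rfl fun e _ => ?_
  rw [← Finset.sum_add_distrib]
  refine Finset.sum_congr rfl fun e' _ => ?_
  split_ifs with h
  · exact h3 e e' h
  · simp

end DGMesh

/-! ### A smooth one-sided cutoff. -/

section Cutoff

open MeasureTheory Set Filter

/-- A smooth function that is `1` on `(-∞, -1]` and `0` on `[0, ∞)`. -/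
noncomputable def smoothCutoff (t : ℝ) : ℝ := Real.smoothTransition (-t)

theorem contDiff_smoothCutoff {n : WithTop ℕ∞} (hn : n ≤ ((⊤ : ℕ∞) : WithTop ℕ∞)) :
    ContDiff ℝ n smoothCutoff :=
  (Real.smoothTransition.contDiff.comp contDiff_neg).of_le hn

theorem continuous_smoothCutoff : Continuous smoothCutoff :=
  Real.smoothTransition.continuous.comp continuous_neg

theorem smoothCutoff_of_nonneg {t : ℝ} (h : 0 ≤ t) : smoothCutoff t = 0 :=
  Real.smoothTransition.zero_of_nonpos (neg_nonpos.2 h)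

theorem smoothCutoff_of_le {t : ℝ} (h : t ≤ -1) : smoothCutoff t = 1 :=
  Real.smoothTransition.one_of_one_le (by linarith)

theorem smoothCutoff_nonneg (t : ℝ) : 0 ≤ smoothCutoff t := Real.smoothTransition.nonneg _

theorem smoothCutoff_le_one (t : ℝ) : smoothCutoff t ≤ 1 := Real.smoothTransition.le_one _

theorem hasDerivAt_smoothCutoff (t : ℝ) : HasDerivAt smoothCutoff (deriv smoothCutoff t) t :=
  ((contDiff_smoothCutoff (n := 1) (by exact_mod_cast le_top)).differentiable
    one_ne_zero t).hasDerivAt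

theorem continuous_deriv_smoothCutoff : Continuous (deriv smoothCutoff) :=
  (contDiff_smoothCutoff (n := 1) (by exact_mod_cast le_top)).continuous_deriv le_rfl

theorem deriv_smoothCutoff_eq_zero {t : ℝ} (h : t ∉ Icc (-1 : ℝ) 0) :
    deriv smoothCutoff t = 0 := by
  rcases lt_or_ge t (-1) with h1 | h1
  · have : smoothCutoff =ᶠ[𝓝 t] fun _ => 1 := by
      filter_upwards [Iio_mem_nhds h1] with s hs using smoothCutoff_of_le (le_of_lt hs)
    rw [this.deriv_eq, deriv_const]
  · have h2 : 0 < t := by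
      by_contra h3
      exact h ⟨h1, not_lt.1 h3⟩
    have : smoothCutoff =ᶠ[𝓝 t] fun _ => 0 := by
      filter_upwards [Ioi_mem_nhds h2] with s hs using smoothCutoff_of_nonneg (le_of_lt hs)
    rw [this.deriv_eq, deriv_const]

theorem integrable_deriv_smoothCutoff : Integrable (deriv smoothCutoff) :=
  continuous_deriv_smoothCutoff.integrable_of_hasCompactSupport
    (HasCompactSupport.intro isCompact_Icc fun _ h => deriv_smoothCutoff_eq_zero h)

theorem integral_deriv_smoothCutoff : ∫ t, deriv smoothCutoff t = -1 := by
  rw [integral_of_hasDerivAt_of_tendsto hasDerivAt_smoothCutoff integrable_deriv_smoothCutoff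
    (m := 1) (n := 0)]
  · norm_num
  · refine tendsto_const_nhds.congr' ?_
    filter_upwards [eventually_le_atBot (-1)] with t ht using (smoothCutoff_of_le ht).symm
  · refine tendsto_const_nhds.congr' ?_
    filter_upwards [eventually_ge_atTop 0] with t ht using (smoothCutoff_of_nonneg ht).symm

theorem tendsto_smoothCutoff_div {s : ℝ} (hs : s < 0) :
    ∀ᶠ δ : ℝ in 𝓝[>] 0, smoothCutoff (s / δ) = 1 := by
  have : ∀ᶠ δ : ℝ in 𝓝[>] 0, δ < -s := nhdsWithin_le_nhds (Iio_mem_nhds (by linarith))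
  filter_upwards [this, self_mem_nhdsWithin] with δ h1 h2
  apply smoothCutoff_of_le
  rw [div_le_iff₀ h2]
  linarith

end Cutoff

/-! ### Concentration of boundary layers on the facets of a polytope. -/

section Slicing

open MeasureTheory Set Filter

/-- Stretching the normal coordinate by `δ` turns a layer of width `δ` into one of fixed width, at
the cost of the factor `δ⁻¹`. -/
theorem integral_planeArea_prod_scaled {a : E3} (ha : ‖a‖ = 1) (c : ℝ) {δ : ℝ} (hδ : 0 < δ)
    {Q : E3 → ℝ} (hQ : Measurable Q) :
    ∫ p, Q (p.1 + (δ * p.2) • a) ∂((planeArea a c).prod volume) = δ⁻¹ * ∫ z, Q z := by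
  have h1 := measurePreserving_planeArea_prod ha c
  have hmul : Measurable fun t : ℝ => δ * t := by fun_prop
  have h2 : Measure.map (Prod.map id fun t : ℝ => δ * t) ((planeArea a c).prod volume)
      = ENNReal.ofReal δ⁻¹ • (planeArea a c).prod volume := by
    rw [← Measure.map_prod_map _ _ measurable_id hmul, Measure.map_id,
      Real.map_volume_mul_left hδ.ne', Measure.prod_smul_right, abs_of_pos (inv_pos.2 hδ)]
  have hQ1 : Measurable fun p : E3 × ℝ => Q (p.1 + p.2 • a) := hQ.comp h1.measurable
  calc ∫ p, Q (p.1 + (δ * p.2) • a) ∂((planeArea a c).prod volume)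
      = ∫ p, Q (p.1 + p.2 • a)
        ∂(Measure.map (Prod.map id fun t : ℝ => δ * t) ((planeArea a c).prod volume)) := by
        rw [integral_map (measurable_id.prodMap hmul).aemeasurable hQ1.aestronglyMeasurable]
        rfl
    _ = δ⁻¹ * ∫ p, Q (p.1 + p.2 • a) ∂((planeArea a c).prod volume) := by
        rw [h2, integral_smul_measure, ENNReal.toReal_ofReal (inv_pos.2 hδ).le, smul_eq_mul]
    _ = δ⁻¹ * ∫ z, Q z := by
        rw [← h1.map_eq, integral_map h1.measurable.aemeasurable hQ.aestronglyMeasurable]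

end Slicing

namespace RefPolytope

open MeasureTheory Set Filter

variable (K : RefPolytope)

/-- The product of the cutoff functions of the facets in `J`. -/
noncomputable def cutoffProd (J : Finset (Fin K.nFacets)) (δ : ℝ) (y : E3) : ℝ :=
  ∏ k ∈ J, smoothCutoff ((⟪K.normal k, y⟫_ℝ - K.offset k) / δ)

theorem cutoffProd_mem_Icc (J : Finset (Fin K.nFacets)) (δ : ℝ) (y : E3) :
    K.cutoffProd J δ y ∈ Icc (0 : ℝ) 1 :=
  ⟨Finset.prod_nonneg fun _ _ => smoothCutoff_nonneg _,
    Finset.prod_le_one (fun _ _ => smoothCutoff_nonneg _) fun _ _ => smoothCutoff_le_one _⟩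

theorem continuous_cutoffProd (J : Finset (Fin K.nFacets)) (δ : ℝ) :
    Continuous (K.cutoffProd J δ) :=
  continuous_finsetProd _ fun k _ => continuous_smoothCutoff.comp (by fun_prop)

theorem contDiff_cutoffProd (J : Finset (Fin K.nFacets)) (δ : ℝ) :
    ContDiff ℝ 1 (K.cutoffProd J δ) :=
  contDiff_prod fun k _ => (contDiff_smoothCutoff (by exact_mod_cast le_top)).comp
    (((contDiff_const.inner ℝ contDiff_id).sub contDiff_const).div_const _)

theorem cutoffProd_univ_eq_zero {δ : ℝ} (hδ : 0 < δ) {y : E3} (hy : y ∉ interior K.carrier) :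
    K.cutoffProd Finset.univ δ y = 0 := by
  rw [interior_carrier] at hy
  simp only [mem_ofPred_eq, not_forall, not_lt] at hy
  obtain ⟨k, hk⟩ := hy
  refine Finset.prod_eq_zero (Finset.mem_univ k) (smoothCutoff_of_nonneg ?_)
  exact div_nonneg (by linarith) hδ.le

/-- Integrating against the derivative of the cutoff function of a facet gives, in the limit, minus
the integral over the facet. -/
theorem tendsto_integral_deriv_cutoff (i : Fin K.nFacets) {g : E3 → ℝ}
    (hg : ContinuousOn g K.carrier)
    (hreg : ∀ᵐ y ∂((planeArea (K.normal i) (K.offset i)).restrict K.carrier),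
      ∀ k, k ≠ i → ⟪K.normal k, y⟫_ℝ < K.offset k) :
    Tendsto (fun δ : ℝ => δ⁻¹ * ∫ y in K.carrier, g y *
      (deriv smoothCutoff ((⟪K.normal i, y⟫_ℝ - K.offset i) / δ) *
        K.cutoffProd (Finset.univ.erase i) δ y))
      (𝓝[>] 0) (𝓝 (-∫ y in K.carrier, g y ∂(planeArea (K.normal i) (K.offset i)))) := by
  set a := K.normal i with ha_def
  set c := K.offset i with hc_def
  have ha : ‖a‖ = 1 := K.norm_normal i
  have hKm : MeasurableSet K.carrier := K.isClosed_carrier.measurableSet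
  let G : E3 → ℝ := K.carrier.indicator g
  have hG : Measurable G := hg.measurable_indicator_of hKm
  obtain ⟨C, hC⟩ := K.isCompact_carrier.exists_bound_of_continuousOn hg
  obtain ⟨C', hC'⟩ := isCompact_Icc.exists_bound_of_continuousOn
    (continuous_deriv_smoothCutoff.continuousOn (s := Icc (-1 : ℝ) 0))
  obtain ⟨R, hR⟩ := K.isCompact_carrier.isBounded.subset_closedBall (0 : E3)
  have hCG : ∀ y, |G y| ≤ |C| := fun y => by
    by_cases hy : y ∈ K.carrier
    · simp only [G, Set.indicator_of_mem hy]
      exact (hC y hy).trans (le_abs_self C)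
    · simp [G, Set.indicator_of_notMem hy]
  let Q : ℝ → E3 → ℝ := fun δ y => G y * (deriv smoothCutoff ((⟪a, y⟫_ℝ - c) / δ) *
        K.cutoffProd (Finset.univ.erase i) δ y)
  have hQ : ∀ δ, Measurable (Q δ) := fun δ => hG.mul
    ((continuous_deriv_smoothCutoff.comp (by fun_prop)).mul
      (K.continuous_cutoffProd _ δ)).measurable
  -- In the stretched coordinate the derivative of the cutoff no longer depends on `δ`, and it
  -- integrates to `-1`, which is the sign in the limit.
  let S : ℝ → E3 × ℝ → ℝ := fun δ p => G (p.1 + (δ * p.2) • a) * (deriv smoothCutoff p.2 *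
        K.cutoffProd (Finset.univ.erase i) δ (p.1 + (δ * p.2) • a))
  have haeplane : ∀ᵐ p ∂((planeArea a c).prod (volume : Measure ℝ)), ⟪a, p.1⟫_ℝ = c :=
    Measure.quasiMeasurePreserving_fst.ae (ae_planeArea_inner ha c)
  have hQS : ∀ᶠ δ : ℝ in 𝓝[>] 0, ∫ p, S δ p ∂((planeArea a c).prod volume)
      = δ⁻¹ * ∫ y in K.carrier, g y *
      (deriv smoothCutoff ((⟪a, y⟫_ℝ - c) / δ) * K.cutoffProd (Finset.univ.erase i) δ y) := by
    filter_upwards [self_mem_nhdsWithin] with δ hδ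
    have hδ : 0 < δ := hδ
    have h1 : ∫ p, S δ p ∂((planeArea a c).prod volume)
        = ∫ p, Q δ (p.1 + (δ * p.2) • a) ∂((planeArea a c).prod volume) := by
      refine integral_congr_ae ?_
      filter_upwards [haeplane] with p hp
      simp only [S, Q]
      rw [inner_add_smul_sub ha hp, mul_div_cancel_left₀ _ hδ.ne']
    rw [h1, integral_planeArea_prod_scaled ha c hδ (hQ δ), ← integral_indicator hKm]
    congr 2
    ext1 y
    by_cases hy : y ∈ K.carrier <;> simp [Q, G, hy]
  have hlim : ∫ p : E3 × ℝ, G p.1 * deriv smoothCutoff p.2 ∂((planeArea a c).prod volume)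
      = -∫ y in K.carrier, g y ∂(planeArea a c) := by
    rw [integral_prod_mul, integral_deriv_smoothCutoff, ← integral_indicator hKm]
    simp [G]
  rw [← hlim]
  refine Tendsto.congr' hQS ?_
  have hδ1 : ∀ᶠ δ : ℝ in 𝓝[>] 0, δ < 1 := nhdsWithin_le_nhds (Iio_mem_nhds one_pos)
  -- The derivative is supported in `[-1, 0]`, so for `δ < 1` the base point is within distance one
  -- of the polytope. This yields a dominating function with bounded support.
  refine tendsto_integral_filter_of_dominated_convergence
    (fun p => (Metric.closedBall (0 : E3) (R + 1)).indicator (fun _ => |C|) p.1 *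
      (Icc (-1 : ℝ) 0).indicator (fun _ => |C'|) p.2) ?_ ?_ ?_ ?_
  · refine Eventually.of_forall fun δ => Measurable.aestronglyMeasurable ?_
    have hc1 : Continuous fun p : E3 × ℝ => p.1 + (δ * p.2) • a := by fun_prop
    exact (hG.comp hc1.measurable).mul ((continuous_deriv_smoothCutoff.comp continuous_snd).mul
      ((K.continuous_cutoffProd _ δ).comp hc1)).measurable
  · filter_upwards [hδ1, self_mem_nhdsWithin] with δ hδ hδ0
    have hδ0 : 0 < δ := hδ0
    refine Eventually.of_forall fun p => ?_
    have hb := K.cutoffProd_mem_Icc (Finset.univ.erase i) δ (p.1 + (δ * p.2) • a)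
    by_cases ht : p.2 ∈ Icc (-1 : ℝ) 0
    · by_cases hy : p.1 + (δ * p.2) • a ∈ K.carrier
      · have hpb : p.1 ∈ Metric.closedBall (0 : E3) (R + 1) := by
          have h1 := hR hy
          rw [mem_closedBall_zero_iff] at h1 ⊢
          have h2 : ‖(δ * p.2) • a‖ ≤ 1 := by
            rw [norm_smul, ha, mul_one, Real.norm_eq_abs, abs_mul, abs_of_pos hδ0]
            have : |p.2| ≤ 1 := abs_le.2 ⟨ht.1, ht.2.trans zero_le_one⟩
            calc δ * |p.2| ≤ 1 * 1 := mul_le_mul hδ.le this (abs_nonneg _) zero_le_one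
              _ = 1 := one_mul 1
          have h3 : p.1 = (p.1 + (δ * p.2) • a) - (δ * p.2) • a := by abel
          rw [h3]
          exact (norm_sub_le _ _).trans (add_le_add h1 h2)
        rw [Set.indicator_of_mem hpb, Set.indicator_of_mem ht, norm_mul, norm_mul]
        refine mul_le_mul (hCG _) ?_ (by positivity) (abs_nonneg _)
        rw [Real.norm_of_nonneg hb.1]
        calc ‖deriv smoothCutoff p.2‖ * _ ≤ |C'| * 1 :=
              mul_le_mul ((hC' _ ht).trans (le_abs_self _)) hb.2 hb.1 (abs_nonneg _)
          _ = |C'| := mul_one _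
      · have h0 : S δ p = 0 := by simp [S, G, Set.indicator_of_notMem hy]
        rw [h0, norm_zero]
        exact mul_nonneg (Set.indicator_nonneg (fun _ _ => abs_nonneg _) _)
          (Set.indicator_nonneg (fun _ _ => abs_nonneg _) _)
    · have h0 : S δ p = 0 := by simp [S, deriv_smoothCutoff_eq_zero ht]
      rw [h0, norm_zero]
      exact mul_nonneg (Set.indicator_nonneg (fun _ _ => abs_nonneg _) _)
        (Set.indicator_nonneg (fun _ _ => abs_nonneg _) _)
  · refine Integrable.mul_prod (f := (Metric.closedBall (0 : E3) (R + 1)).indicator fun _ => |C|)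
      (g := (Icc (-1 : ℝ) 0).indicator fun _ => |C'|) ?_ ?_
    · refine (integrable_indicator_iff measurableSet_closedBall).2 ?_
      exact integrableOn_const
        ((planeArea_lt_top_of_isCompact a c (isCompact_closedBall _ _)).ne)
    · exact (integrable_indicator_iff measurableSet_Icc).2 (integrableOn_const (by simp))
  · have haereg : ∀ᵐ p ∂((planeArea a c).prod (volume : Measure ℝ)), p.1 ∈ K.carrier →
        ∀ k, k ≠ i → ⟪K.normal k, p.1⟫_ℝ < K.offset k :=
      Measure.quasiMeasurePreserving_fst.ae ((ae_restrict_iff' hKm).1 hreg)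
    filter_upwards [haeplane, haereg] with p hp hpreg
    by_cases ht : p.2 ∈ Icc (-1 : ℝ) 0
    swap
    · simp only [S, deriv_smoothCutoff_eq_zero ht, zero_mul, mul_zero]
      exact tendsto_const_nhds
    have hpath : Tendsto (fun δ : ℝ => p.1 + (δ * p.2) • a) (𝓝[>] 0) (𝓝 p.1) := by
      have : ContinuousAt (fun δ : ℝ => p.1 + (δ * p.2) • a) 0 := by fun_prop
      have h2 := this.tendsto
      simp only [zero_mul, zero_smul, add_zero] at h2
      exact h2.mono_left nhdsWithin_le_nhds
    by_cases hy : p.1 ∈ K.carrier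
    -- At a base point on no other facet, the remaining levels stay below half their negative value.
    -- The shifted point is then inside the polytope, and the other cutoffs equal `1` for small `δ`.
    · have hlev : ∀ k, k ≠ i → ∀ᶠ δ : ℝ in 𝓝[>] 0,
          ⟪K.normal k, p.1 + (δ * p.2) • a⟫_ℝ - K.offset k
            < (⟪K.normal k, p.1⟫_ℝ - K.offset k) / 2 := by
        intro k hk
        have hc1 : Tendsto (fun δ : ℝ => ⟪K.normal k, p.1 + (δ * p.2) • a⟫_ℝ - K.offset k)
            (𝓝[>] 0) (𝓝 (⟪K.normal k, p.1⟫_ℝ - K.offset k)) :=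
          (tendsto_const_nhds.inner hpath).sub tendsto_const_nhds
        exact hc1.eventually_lt_const (by linarith [hpreg hy k hk])
      have hin : ∀ᶠ δ : ℝ in 𝓝[>] 0, p.1 + (δ * p.2) • a ∈ K.carrier := by
        have : ∀ k, ∀ᶠ δ : ℝ in 𝓝[>] 0,
            ⟪K.normal k, p.1 + (δ * p.2) • a⟫_ℝ ≤ K.offset k := by
          intro k
          by_cases hk : k = i
          · subst hk
            filter_upwards [self_mem_nhdsWithin] with δ hδ
            have := inner_add_smul_sub ha hp (δ * p.2)
            have h2 : δ * p.2 ≤ 0 := mul_nonpos_of_nonneg_of_nonpos (le_of_lt hδ) ht.2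
            linarith
          · filter_upwards [hlev k hk] with δ h1
            linarith [hpreg hy k hk]
        filter_upwards [eventually_all.2 this] with δ h using h
      have hone : ∀ᶠ δ : ℝ in 𝓝[>] 0,
          K.cutoffProd (Finset.univ.erase i) δ (p.1 + (δ * p.2) • a) = 1 := by
        have : ∀ k, k ≠ i → ∀ᶠ δ : ℝ in 𝓝[>] 0, smoothCutoff
            ((⟪K.normal k, p.1 + (δ * p.2) • a⟫_ℝ - K.offset k) / δ) = 1 := by
          intro k hk
          have hneg : (⟪K.normal k, p.1⟫_ℝ - K.offset k) / 2 < 0 := by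
            linarith [hpreg hy k hk]
          have hsmall : ∀ᶠ δ : ℝ in 𝓝[>] 0, δ < -((⟪K.normal k, p.1⟫_ℝ - K.offset k) / 2) :=
            nhdsWithin_le_nhds (Iio_mem_nhds (by linarith))
          filter_upwards [hlev k hk, hsmall, self_mem_nhdsWithin] with δ h1 h2 h3
          apply smoothCutoff_of_le
          rw [div_le_iff₀ h3]
          linarith
        have hall : ∀ᶠ δ : ℝ in 𝓝[>] 0, ∀ k, k ≠ i → smoothCutoff
            ((⟪K.normal k, p.1 + (δ * p.2) • a⟫_ℝ - K.offset k) / δ) = 1 := by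
          refine eventually_all.2 fun k => ?_
          by_cases hk : k = i
          · exact Eventually.of_forall fun δ h => absurd hk h
          · filter_upwards [this k hk] with δ h _ using h
        filter_upwards [hall] with δ h
        exact Finset.prod_eq_one fun k hk => h k (Finset.ne_of_mem_erase hk)
      have hGt : Tendsto (fun δ : ℝ => G (p.1 + (δ * p.2) • a)) (𝓝[>] 0) (𝓝 (G p.1)) := by
        have h1 : Tendsto (fun δ : ℝ => g (p.1 + (δ * p.2) • a)) (𝓝[>] 0) (𝓝 (g p.1)) :=
          (hg p.1 hy).tendsto.comp (tendsto_nhdsWithin_iff.2 ⟨hpath, hin⟩)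
        simp only [G, Set.indicator_of_mem hy]
        refine h1.congr' ?_
        filter_upwards [hin] with δ h
        rw [Set.indicator_of_mem h]
      have := hGt.mul_const (deriv smoothCutoff p.2)
      refine this.congr' ?_
      filter_upwards [hone] with δ h
      simp only [S, h, mul_one]
    · have hout : ∀ᶠ δ : ℝ in 𝓝[>] 0, p.1 + (δ * p.2) • a ∈ K.carrierᶜ :=
        hpath.eventually (K.isClosed_carrier.isOpen_compl.mem_nhds hy)
      have h0 : G p.1 * deriv smoothCutoff p.2 = 0 := by
        simp [G, Set.indicator_of_notMem hy]
      rw [h0]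
      refine tendsto_const_nhds.congr' ?_
      filter_upwards [hout] with δ h
      simp [S, G, Set.indicator_of_notMem h]

end RefPolytope

/-! ### The divergence theorem on a curved element. -/

namespace DGMesh

open Set MeasureTheory Filter

variable {M : DGMesh} {e : Fin M.nElem}

theorem continuousOn_facetLevel (i : Fin (M.ref e).nFacets) :
    ContinuousOn (M.facetLevel e i) (M.map e).target := fun _ hx =>
  (hasFDerivAt_facetLevel hx i).continuousAt.continuousWithinAt

theorem continuousOn_cutoffProd_symm (J : Finset (Fin (M.ref e).nFacets)) (δ : ℝ) :
    ContinuousOn (fun x => (M.ref e).cutoffProd J δ ((M.map e).symm x)) (M.map e).target :=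
  ((M.ref e).continuous_cutoffProd J δ).comp_continuousOn (M.map e).symm.continuousOn

theorem cutoffProd_symm_eq_zero {δ : ℝ} (hδ : 0 < δ) {x : E3} (hx : x ∈ (M.map e).target)
    (hx' : x ∉ M.elem e) :
    (M.ref e).cutoffProd Finset.univ δ ((M.map e).symm x) = 0 :=
  (M.ref e).cutoffProd_univ_eq_zero hδ fun h => hx' ((mem_elem_iff_symm hx).2 h)

theorem hasFDerivAt_cutoffProd_symm (δ : ℝ) {x : E3} (hx : x ∈ (M.map e).target) :
    HasFDerivAt (fun x => (M.ref e).cutoffProd Finset.univ δ ((M.map e).symm x))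
      (∑ i, (M.ref e).cutoffProd (Finset.univ.erase i) δ ((M.map e).symm x) •
        ((deriv smoothCutoff (M.facetLevel e i x / δ) * δ⁻¹) • innerSL ℝ (M.facetGrad e i x))) x := by
  have h1 : ∀ i, HasFDerivAt (fun x => smoothCutoff (M.facetLevel e i x / δ))
      ((deriv smoothCutoff (M.facetLevel e i x / δ) * δ⁻¹) • innerSL ℝ (M.facetGrad e i x)) x := by
    intro i
    have h2 : HasFDerivAt (fun x => M.facetLevel e i x / δ)
        (δ⁻¹ • innerSL ℝ (M.facetGrad e i x)) x := by
      simp_rw [div_eq_mul_inv]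
      exact (hasFDerivAt_facetLevel hx i).mul_const δ⁻¹
    have := (hasDerivAt_smoothCutoff (M.facetLevel e i x / δ)).comp_hasFDerivAt x h2
    rwa [smul_smul] at this
  exact HasFDerivAt.finsetProd fun i _ => h1 i

theorem integral_fderiv_eq_zero_of_hasCompactSupport {F : E3 → ℝ} (hF : ContDiff ℝ 1 F)
    (hc : HasCompactSupport F) (v : E3) : ∫ x, fderiv ℝ F x v = 0 := by
  have hcont : Continuous fun x => fderiv ℝ F x v :=
    (hF.continuous_fderiv one_ne_zero).clm_apply continuous_const
  have hsupp : HasCompactSupport fun x => fderiv ℝ F x v :=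
    (hc.fderiv ℝ).comp_left (g := fun A : E3 →L[ℝ] ℝ => A v) (by simp)
  have := integral_mul_fderiv_eq_neg_fderiv_mul_of_integrable (μ := (volume : Measure E3))
    (f := fun _ => (1 : ℝ)) (g := F) (v := v) (by simp)
    (by simpa using hcont.integrable_of_hasCompactSupport hsupp)
    (by simpa using hF.continuous.integrable_of_hasCompactSupport hc)
    (fun x _ => differentiableAt_const _) (fun x _ => hF.differentiable one_ne_zero x)
  simpa using this

/-- The product of `w` with the cutoff, extended by zero, is `C¹` on all of space with compact
support, because the cutoff already vanishes in the target outside the open element. Its derivative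
integrates to zero, and the product rule gives the two terms. -/
theorem integral_cutoff_fderiv {w : E3 → ℝ} (hw : ContDiffOn ℝ 1 w (M.map e).target) (v : E3)
    {δ : ℝ} (hδ : 0 < δ) :
    (∫ x in M.closedElem e, (M.ref e).cutoffProd Finset.univ δ ((M.map e).symm x) *
      fderiv ℝ w x v) + ∑ i, δ⁻¹ * ∫ x in M.closedElem e, w x * ⟪M.facetGrad e i x, v⟫_ℝ *
        (deriv smoothCutoff (M.facetLevel e i x / δ) *
          (M.ref e).cutoffProd (Finset.univ.erase i) δ ((M.map e).symm x)) = 0 := by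
  have hopen := (M.map e).open_target
  let χ : E3 → ℝ := fun x => (M.ref e).cutoffProd Finset.univ δ ((M.map e).symm x)
  let F : E3 → ℝ := (M.closedElem e).indicator fun x => w x * χ x
  have hFt : ∀ x ∈ (M.map e).target, F =ᶠ[𝓝 x] fun x => w x * χ x := by
    intro x hx
    filter_upwards [hopen.mem_nhds hx] with z hz
    by_cases hzc : z ∈ M.closedElem e
    · simp only [F, Set.indicator_of_mem hzc]
    · simp only [F, Set.indicator_of_notMem hzc, χ]
      rw [cutoffProd_symm_eq_zero hδ hz fun h => hzc (elem_subset_closedElem h), mul_zero]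
  have hF0 : ∀ x ∉ M.closedElem e, F =ᶠ[𝓝 x] fun _ => 0 := by
    intro x hx
    filter_upwards [isClosed_closedElem.isOpen_compl.mem_nhds hx] with z hz
    exact Set.indicator_of_notMem hz _
  have hF : ContDiff ℝ 1 F := by
    rw [contDiff_iff_contDiffAt]
    intro x
    by_cases hx : x ∈ (M.map e).target
    · refine ContDiffAt.congr_of_eventuallyEq ?_ (hFt x hx)
      refine (hw.contDiffAt (hopen.mem_nhds hx)).mul ?_
      exact ((M.ref e).contDiff_cutoffProd Finset.univ δ).contDiffAt.comp x
        ((M.contDiffOn_symm e).contDiffAt (hopen.mem_nhds hx))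
    · exact contDiffAt_const.congr_of_eventuallyEq
        (hF0 x fun h => hx (closedElem_subset_target h))
  have hFc : HasCompactSupport F :=
    HasCompactSupport.intro isCompact_closedElem fun x hx => Set.indicator_of_notMem hx _
  have hderiv : ∀ x, fderiv ℝ F x v = (M.closedElem e).indicator (fun x => χ x * fderiv ℝ w x v
      + ∑ i, δ⁻¹ * (w x * ⟪M.facetGrad e i x, v⟫_ℝ *
        (deriv smoothCutoff (M.facetLevel e i x / δ) *
          (M.ref e).cutoffProd (Finset.univ.erase i) δ ((M.map e).symm x)))) x := by
    intro x
    by_cases hx : x ∈ M.closedElem e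
    · have hxt := closedElem_subset_target hx
      have hd := ((hw.contDiffAt (hopen.mem_nhds hxt)).differentiableAt one_ne_zero).hasFDerivAt
      have := (hd.mul (hasFDerivAt_cutoffProd_symm δ hxt)).congr_of_eventuallyEq (hFt x hxt)
      rw [this.fderiv, Set.indicator_of_mem hx]
      simp only [add_apply, smul_apply,
        sum_apply, smul_eq_mul, innerSL_apply_apply, Finset.mul_sum, χ]
      rw [add_comm]
      congr 1
      exact Finset.sum_congr rfl fun i _ => by ring
    · rw [(hF0 x hx).fderiv_eq, Set.indicator_of_notMem hx]
      simp
  have h0 := integral_fderiv_eq_zero_of_hasCompactSupport hF hFc v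
  simp_rw [hderiv] at h0
  rw [integral_indicator isClosed_closedElem.measurableSet, integral_add,
    integral_finsetSum] at h0
  · simp_rw [integral_const_mul] at h0
    exact h0
  all_goals
    have hwd : ContinuousOn (fun x => fderiv ℝ w x v) (M.map e).target :=
      (hw.continuousOn_fderiv_of_isOpen hopen le_rfl).clm_apply continuousOn_const
    have hterm : ∀ i, IntegrableOn (fun x => δ⁻¹ * (w x * ⟪M.facetGrad e i x, v⟫_ℝ *
        (deriv smoothCutoff (M.facetLevel e i x / δ) *
          (M.ref e).cutoffProd (Finset.univ.erase i) δ ((M.map e).symm x)))) (M.closedElem e) := by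
      intro i
      refine ContinuousOn.integrableOn_compact isCompact_closedElem
        (ContinuousOn.mono ?_ closedElem_subset_target)
      exact continuousOn_const.mul ((hw.continuousOn.mul
        ((continuousOn_facetGrad i).inner (𝕜 := ℝ) continuousOn_const)).mul
        ((continuous_deriv_smoothCutoff.comp_continuousOn
          ((continuousOn_facetLevel i).div_const δ)).mul (continuousOn_cutoffProd_symm _ δ)))
  · exact fun i _ => hterm i
  · exact (((continuousOn_cutoffProd_symm _ δ).mul hwd).mono
      closedElem_subset_target).integrableOn_compact isCompact_closedElem
  · exact integrable_finsetSum _ fun i _ => hterm i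

/-- The divergence theorem on a curved polytope. -/
theorem integral_elem_fderiv {w : E3 → ℝ} (hw : ContDiffOn ℝ 1 w (M.map e).target) (v : E3) :
    ∫ x in M.elem e, fderiv ℝ w x v
      = ∑ i, ∫ x, w x * ⟪M.facetNormal e i x, v⟫_ℝ ∂(M.facetMeasure e i) := by
  have hopen := (M.map e).open_target
  have hwd : ContinuousOn (fun x => fderiv ℝ w x v) (M.map e).target :=
    (hw.continuousOn_fderiv_of_isOpen hopen le_rfl).clm_apply continuousOn_const
  -- The cutoff tends to the indicator of the open element, being `0` at its boundary points. It is
  -- therefore not necessary to know that the boundary is a null set.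
  have hvol : Tendsto (fun δ : ℝ => ∫ x in M.closedElem e,
      (M.ref e).cutoffProd Finset.univ δ ((M.map e).symm x) * fderiv ℝ w x v) (𝓝[>] 0)
      (𝓝 (∫ x in M.elem e, fderiv ℝ w x v)) := by
    have h1 : ∫ x in M.elem e, fderiv ℝ w x v
        = ∫ x in M.closedElem e, (M.elem e).indicator (fun x => fderiv ℝ w x v) x := by
      rw [setIntegral_indicator isOpen_elem.measurableSet,
        inter_eq_right.2 elem_subset_closedElem]
    rw [h1]
    refine tendsto_integral_filter_of_dominated_convergence (fun x => ‖fderiv ℝ w x v‖) ?_ ?_ ?_ ?_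
    · refine Eventually.of_forall fun δ => ?_
      exact (((continuousOn_cutoffProd_symm _ δ).mul hwd).mono
        closedElem_subset_target).aestronglyMeasurable isClosed_closedElem.measurableSet
    · refine Eventually.of_forall fun δ => Eventually.of_forall fun x => ?_
      have hb := (M.ref e).cutoffProd_mem_Icc Finset.univ δ ((M.map e).symm x)
      rw [norm_mul, Real.norm_of_nonneg hb.1]
      exact mul_le_of_le_one_left (norm_nonneg _) hb.2
    · exact ((hwd.mono closedElem_subset_target).integrableOn_compact isCompact_closedElem).norm
    · filter_upwards [ae_restrict_mem isClosed_closedElem.measurableSet] with x hx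
      have hxt := closedElem_subset_target hx
      by_cases hxe : x ∈ M.elem e
      · rw [Set.indicator_of_mem hxe]
        have : ∀ᶠ δ : ℝ in 𝓝[>] 0, ∀ i, smoothCutoff (M.facetLevel e i x / δ) = 1 :=
          eventually_all.2 fun i => tendsto_smoothCutoff_div ((mem_elem_iff hxt).1 hxe i)
        refine tendsto_const_nhds.congr' ?_
        filter_upwards [this] with δ hδ
        have : (M.ref e).cutoffProd Finset.univ δ ((M.map e).symm x) = 1 :=
          Finset.prod_eq_one fun k _ => hδ k
        rw [this, one_mul]
      · rw [Set.indicator_of_notMem hxe]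
        refine tendsto_const_nhds.congr' ?_
        filter_upwards [self_mem_nhdsWithin] with δ hδ
        rw [cutoffProd_symm_eq_zero hδ hxt hxe, zero_mul]
  have hsurf : ∀ i, Tendsto (fun δ : ℝ => δ⁻¹ * ∫ x in M.closedElem e,
      w x * ⟪M.facetGrad e i x, v⟫_ℝ * (deriv smoothCutoff (M.facetLevel e i x / δ) *
          (M.ref e).cutoffProd (Finset.univ.erase i) δ ((M.map e).symm x))) (𝓝[>] 0)
      (𝓝 (-∫ x, w x * ⟪M.facetNormal e i x, v⟫_ℝ ∂(M.facetMeasure e i))) := by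
    intro i
    have hmapsto : MapsTo (M.map e) (M.ref e).carrier (M.map e).target := fun y hy =>
      (M.map e).map_source (M.subset_source e hy)
    have hΦ := (M.map e).continuousOn.mono (M.subset_source e)
    -- After the change of variables to the polytope, the Jacobian times the unnormalized gradient
    -- is the area density times the unit normal.
    let g : E3 → ℝ := fun y => |(fderiv ℝ (M.map e) y).det| *
      (w (M.map e y) * ⟪M.facetGrad e i (M.map e y), v⟫_ℝ)
    have hg : ContinuousOn g (M.ref e).carrier := by
      refine ContinuousOn.mul ?_ ((hw.continuousOn.comp hΦ hmapsto).mul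
        (((continuousOn_facetGrad i).comp hΦ hmapsto).inner (𝕜 := ℝ) continuousOn_const))
      exact ((ContinuousLinearMap.continuous_det.comp_continuousOn
        continuousOn_fderiv_map).abs).mono (M.subset_source e)
    have hreg : ∀ᵐ y ∂((planeArea ((M.ref e).normal i) ((M.ref e).offset i)).restrict
        (M.ref e).carrier), ∀ k, k ≠ i → ⟪(M.ref e).normal k, y⟫_ℝ < (M.ref e).offset k := by
      filter_upwards [ae_of_ae_facetMeasure i (ae_isRegularFacetPoint i),
        ae_restrict_mem measurableSet_carrier] with y hy hyK k hk
      refine lt_of_le_of_ne (hyK k) fun h => hk ?_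
      refine hy.facet_unique hy.1 ⟨hy.1.1, ?_⟩
      simp only [facetLevel]
      rw [(M.map e).left_inv (M.subset_source e hyK), h, sub_self]
    have hlim := (M.ref e).tendsto_integral_deriv_cutoff i hg hreg
    have hbd : ∫ x, w x * ⟪M.facetNormal e i x, v⟫_ℝ ∂(M.facetMeasure e i)
        = ∫ y in (M.ref e).carrier, g y
          ∂(planeArea ((M.ref e).normal i) ((M.ref e).offset i)) := by
      have hcont : ContinuousOn (fun x => w x * ⟪M.facetNormal e i x, v⟫_ℝ)
          (M.closedElem e ∩ univ) :=
        ((hw.continuousOn.mono closedElem_subset_target).mul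
          (continuousOn_inner_facetNormal i v)).mono inter_subset_left
      rw [← setIntegral_univ, ← facetIntegral_eq_of_continuousOn i isClosed_univ hcont]
      unfold facetIntegral
      have hset : {y | y ∈ (M.ref e).carrier ∧ M.map e y ∈ univ} = (M.ref e).carrier := by
        ext y; simp
      rw [hset]
      refine setIntegral_congr_fun measurableSet_carrier fun y hy => ?_
      have hne := norm_ne_zero_iff.2 (facetGrad_ne_zero (hmapsto hy) i)
      simp only [g, areaDensity, facetNormal, inner_smul_left, conj_trivial]
      field_simp
    rw [hbd]
    refine hlim.congr fun δ => ?_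
    congr 1
    have := integral_image_eq_integral_abs_det_fderiv_smul (volume : Measure E3)
      measurableSet_carrier
      (fun y hy => (hasFDerivAt_map (M.subset_source e hy)).hasFDerivWithinAt)
      ((M.map e).injOn.mono (M.subset_source e))
      (fun x => w x * ⟪M.facetGrad e i x, v⟫_ℝ *
        (deriv smoothCutoff (M.facetLevel e i x / δ) *
          (M.ref e).cutoffProd (Finset.univ.erase i) δ ((M.map e).symm x)))
    change _ = ∫ x in M.map e '' (M.ref e).carrier, _
    rw [this]
    refine setIntegral_congr_fun measurableSet_carrier fun y hy => ?_
    simp only [g, facetLevel, smul_eq_mul]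
    rw [(M.map e).left_inv (M.subset_source e hy)]
    ring
  have htot := hvol.add (tendsto_finsetSum Finset.univ fun i _ => hsurf i)
  have hzero : Tendsto (fun _ : ℝ => (0 : ℝ)) (𝓝[>] 0) (𝓝 0) := tendsto_const_nhds
  have heq := tendsto_nhds_unique (hzero.congr' (by
    filter_upwards [self_mem_nhdsWithin] with δ hδ
    exact (integral_cutoff_fderiv hw v hδ).symm)) htot
  rw [Finset.sum_neg_distrib] at heq
  linarith

end DGMesh

theorem MvPolynomial.contDiff_eval_euclidean {n : WithTop ℕ∞} (p : MvPolynomial (Fin 3) ℝ) :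
    ContDiff ℝ n fun y : E3 => MvPolynomial.eval (fun j => y j) p := by
  induction p using MvPolynomial.induction_on with
  | C a => simpa using contDiff_const
  | add p q hp hq => simpa using hp.add hq
  | mul_X p i hp =>
    simp only [map_mul, MvPolynomial.eval_X]
    exact hp.mul (by fun_prop)

/-! ### Weak derivatives of discrete functions without jumps. -/

namespace DGMesh

open Set MeasureTheory Filter

variable {M : DGMesh} {e : Fin M.nElem}

theorem contDiffOn_val (u : M.Space) (e : Fin M.nElem) :
    ContDiffOn ℝ 1 (M.val u e) (M.map e).target :=
  (MvPolynomial.contDiff_eval_euclidean _).comp_contDiffOn (M.contDiffOn_symm e)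

theorem continuousOn_val (u : M.Space) (e : Fin M.nElem) :
    ContinuousOn (M.val u e) (M.closedElem e) :=
  (contDiffOn_val u e).continuousOn.mono closedElem_subset_target

theorem hasFDerivAt_val (u : M.Space) {x : E3} (hx : x ∈ (M.map e).target) :
    HasFDerivAt (M.val u e) (fderiv ℝ (M.val u e) x) x :=
  (((contDiffOn_val u e).contDiffAt ((M.map e).open_target.mem_nhds hx)).differentiableAt
    one_ne_zero).hasFDerivAt

theorem continuousOn_fderiv_val (u : M.Space) (v : E3) :
    ContinuousOn (fun x => fderiv ℝ (M.val u e) x v) (M.map e).target :=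
  ((contDiffOn_val u e).continuousOn_fderiv_of_isOpen (M.map e).open_target
    le_rfl).clm_apply continuousOn_const

theorem integrableOn_elem_of_continuousOn {f : E3 → ℝ} (hf : ContinuousOn f (M.closedElem e)) :
    IntegrableOn f (M.elem e) :=
  (hf.integrableOn_compact isCompact_closedElem).mono_set elem_subset_closedElem

variable (M) in
/-- The function that is `f e` on the open element `e`, and zero outside all open elements. -/
noncomputable def glue (f : Fin M.nElem → E3 → ℝ) (x : E3) : ℝ :=
  ∑ e, (M.elem e).indicator (f e) x

theorem glue_eq_of_mem (f : Fin M.nElem → E3 → ℝ) {x : E3} (hx : x ∈ M.elem e) :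
    M.glue f x = f e x := by
  unfold glue
  rw [Finset.sum_eq_single e, Set.indicator_of_mem hx]
  · exact fun e' _ he' => Set.indicator_of_notMem
      (fun h => disjoint_left.1 (elem_disjoint he') h hx) _
  · simp

theorem glue_eq_zero (f : Fin M.nElem → E3 → ℝ) {x : E3} (hx : ∀ e, x ∉ M.elem e) :
    M.glue f x = 0 :=
  Finset.sum_eq_zero fun e _ => Set.indicator_of_notMem (hx e) _

theorem integrable_glue {f : Fin M.nElem → E3 → ℝ} (hf : ∀ e, ContinuousOn (f e) (M.closedElem e)) :
    Integrable (M.glue f) :=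
  integrable_finsetSum _ fun e _ => (integrable_indicator_iff isOpen_elem.measurableSet).2
    (integrableOn_elem_of_continuousOn (hf e))

theorem integral_glue_mul {f : Fin M.nElem → E3 → ℝ}
    (hf : ∀ e, ContinuousOn (f e) (M.closedElem e)) {φ : E3 → ℝ} (hφ : Continuous φ) :
    ∫ x, M.glue f x * φ x = ∑ e, ∫ x in M.elem e, f e x * φ x := by
  simp_rw [← integral_indicator isOpen_elem.measurableSet]
  rw [← integral_finsetSum]
  · congr 1
    ext1 x
    simp only [glue, Finset.sum_mul]
    exact Finset.sum_congr rfl fun e _ => by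
      by_cases hx : x ∈ M.elem e <;> simp [hx]
  · exact fun e _ => (integrable_indicator_iff isOpen_elem.measurableSet).2
      (integrableOn_elem_of_continuousOn ((hf e).mul hφ.continuousOn))

/-- A discrete function without jumps has a weak derivative, namely the piecewise derivative. -/
theorem integral_glue_val_mul_fderiv {u : M.Space}
    (hint : ∀ e e', e < e' → ∀ i, ∀ᵐ x ∂(M.facetMeasure e i), x ∈ M.closedElem e' →
      M.val u e x - M.val u e' x = 0)
    (hbdry : ∀ e i, ∀ᵐ x ∂(M.facetMeasure e i), x ∈ frontier M.domain → M.val u e x = 0)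
    {φ : E3 → ℝ} (hφ : ContDiff ℝ 1 φ) (v : E3) :
    ∫ x, M.glue (M.val u) x * fderiv ℝ φ x v
      = -∫ x, M.glue (fun e x => fderiv ℝ (M.val u e) x v) x * φ x := by
  have hdv : ∀ e, ContinuousOn (fun x => fderiv ℝ (M.val u e) x v) (M.closedElem e) := fun e =>
    (continuousOn_fderiv_val u v).mono closedElem_subset_target
  have hφ' : Continuous fun x => fderiv ℝ φ x v :=
    (hφ.continuous_fderiv one_ne_zero).clm_apply continuous_const
  -- The sum of the outward fluxes of `u φ` reduces to jumps over interior faces, all of which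
  -- vanish; the boundary fluxes vanish as well.
  have h1 : ∑ e, ∫ x in M.elem e, fderiv ℝ (fun x => M.val u e x * φ x) x v = 0 := by
    simp_rw [integral_elem_fderiv ((contDiffOn_val u _).mul hφ.contDiffOn) v]
    rw [sum_facetMeasure_eq_sum_jump (fun e x => M.val u e x * φ x)
      (fun e => (continuousOn_val u e).mul hφ.continuous.continuousOn)]
    · refine Finset.sum_eq_zero fun e _ => Finset.sum_eq_zero fun e' _ => ?_
      split_ifs with h
      · refine Finset.sum_eq_zero fun i _ => ?_
        rw [setIntegral_congr_ae (g := fun _ => 0) isClosed_closedElem.measurableSet]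
        · simp
        · filter_upwards [hint e e' h i] with x hx hxe
          rw [← sub_mul, hx hxe, zero_mul, zero_mul]
      · rfl
    · intro e i
      filter_upwards [hbdry e i] with x hx hxf
      rw [hx hxf, zero_mul]
  rw [integral_glue_mul (continuousOn_val u) hφ', integral_glue_mul hdv hφ.continuous,
    ← add_eq_zero_iff_eq_neg, ← h1, ← Finset.sum_add_distrib]
  refine Finset.sum_congr rfl fun e _ => ?_
  rw [← integral_add]
  · refine setIntegral_congr_fun isOpen_elem.measurableSet fun x hx => ?_
    have hd := (hasFDerivAt_val u (elem_subset_target hx)).mul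
      (hφ.differentiable one_ne_zero x).hasFDerivAt
    have hd' : fderiv ℝ (fun x => M.val u e x * φ x) x = _ := hd.fderiv
    rw [hd']
    simp [mul_comm]
  · exact integrableOn_elem_of_continuousOn ((continuousOn_val u e).mul hφ'.continuousOn)
  · exact integrableOn_elem_of_continuousOn ((hdv e).mul hφ.continuous.continuousOn)

theorem exists_bound_glue_fderiv (u : M.Space) : ∃ C : NNReal, ∀ x v,
    |M.glue (fun e x => fderiv ℝ (M.val u e) x v) x| ≤ C * ‖v‖ := by
  have hb : ∀ e, ∃ C : ℝ, ∀ x ∈ M.closedElem e, ‖fderiv ℝ (M.val u e) x‖ ≤ C := fun e =>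
    isCompact_closedElem.exists_bound_of_continuousOn
      (((contDiffOn_val u e).continuousOn_fderiv_of_isOpen (M.map e).open_target
        le_rfl).mono closedElem_subset_target)
  choose C hC using hb
  refine ⟨∑ e, ‖C e‖₊, fun x v => ?_⟩
  unfold glue
  refine (Finset.abs_sum_le_sum_abs _ _).trans ?_
  push_cast
  rw [Finset.sum_mul]
  refine Finset.sum_le_sum fun e _ => ?_
  by_cases hx : x ∈ M.elem e
  · rw [Set.indicator_of_mem hx]
    refine ((fderiv ℝ (M.val u e) x).le_opNorm v).trans ?_
    exact mul_le_mul_of_nonneg_right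
      ((hC e x (elem_subset_closedElem hx)).trans (le_abs_self _)) (norm_nonneg v)
  · rw [Set.indicator_of_notMem hx, abs_zero]
    positivity

end DGMesh

/-! ### Lipschitz bounds by mollification. -/

section WeakDerivative

open MeasureTheory Filter

/-- A function with a bounded weak derivative is Lipschitz on the set of its points of
continuity. -/
theorem norm_sub_le_of_weak_fderiv {U : E3 → ℝ} (hU : LocallyIntegrable U) {C : NNReal}
    {V : E3 → E3 → ℝ} (hV : ∀ v x, |V v x| ≤ C * ‖v‖)
    (hweak : ∀ φ : E3 → ℝ, ContDiff ℝ 1 φ → HasCompactSupport φ → ∀ v,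
      ∫ x, U x * fderiv ℝ φ x v = -∫ x, V v x * φ x)
    {x y : E3} (hx : ContinuousAt U x) (hy : ContinuousAt U y) :
    ‖U x - U y‖ ≤ C * ‖x - y‖ := by
  let b : ℕ → ContDiffBump (0 : E3) := fun n =>
    ⟨1 / (n + 1) / 2, 1 / (n + 1), by positivity, half_lt_self (by positivity)⟩
  let φ : ℕ → E3 → ℝ := fun n => (b n).normed volume
  have hφ : ∀ n, ContDiff ℝ 1 (φ n) := fun n => (b n).contDiff_normed
  have hφc : ∀ n, HasCompactSupport (φ n) := fun n => (b n).hasCompactSupport_normed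
  -- `W n` is the mollification of `U`. It converges to `U` at points of continuity, and its
  -- gradient is the mollified `V`, bounded by `C`.
  let W : ℕ → E3 → ℝ := fun n z => ∫ t, U t * φ n (z - t)
  have hlim : ∀ z, ContinuousAt U z → Tendsto (fun n => W n z) atTop (𝓝 (U z)) := by
    intro z hz
    have h1 := ContDiffBump.convolution_tendsto_right (μ := (volume : Measure E3)) (φ := b)
      (g := fun _ => U) (k := fun _ => z) (x₀ := z) (z₀ := U z) (l := atTop)
      tendsto_one_div_add_atTop_nhds_zero_nat
      (Eventually.of_forall fun _ => hU.aestronglyMeasurable)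
      (hz.tendsto.comp tendsto_snd) tendsto_const_nhds
    refine h1.congr fun n => ?_
    rw [convolution_eq_swap]
    simp only [ContinuousLinearMap.lsmul_apply, smul_eq_mul, W, φ, mul_comm]
  have hderiv : ∀ n z, HasFDerivAt (W n)
      (convolution U (fderiv ℝ (φ n))
        (ContinuousLinearMap.precompR E3 (ContinuousLinearMap.mul ℝ ℝ)) volume z) z := fun n z =>
    (hφc n).hasFDerivAt_convolution_right (ContinuousLinearMap.mul ℝ ℝ) hU (hφ n) z
  have hbound : ∀ n z, ‖convolution U (fderiv ℝ (φ n))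
        (ContinuousLinearMap.precompR E3 (ContinuousLinearMap.mul ℝ ℝ)) volume z‖ ≤ C := by
    intro n z
    refine ContinuousLinearMap.opNorm_le_bound _ C.2 fun v => ?_
    rw [convolution_precompR_apply _ hU ((hφc n).fderiv ℝ)
      ((hφ n).continuous_fderiv one_ne_zero)]
    have hψ : ContDiff ℝ 1 fun t => φ n (z - t) := (hφ n).comp (contDiff_const.sub contDiff_id)
    have hψc : HasCompactSupport fun t => φ n (z - t) :=
      (hφc n).comp_homeomorph (Homeomorph.subLeft z)
    have hd : ∀ t, fderiv ℝ (fun t => φ n (z - t)) t v = -fderiv ℝ (φ n) (z - t) v := by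
      intro t
      have h1 := ((hφ n).differentiable one_ne_zero (z - t)).hasFDerivAt.comp t
        ((hasFDerivAt_id t).const_sub z)
      have h2 : fderiv ℝ (fun t => φ n (z - t)) t = _ := h1.fderiv
      rw [h2]
      simp
    have h3 := hweak _ hψ hψc v
    simp only [hd, mul_neg] at h3
    rw [integral_neg, neg_inj] at h3
    have h4 : (convolution U (fun a => fderiv ℝ (φ n) a v) (ContinuousLinearMap.mul ℝ ℝ) volume z)
        = ∫ t, U t * fderiv ℝ (φ n) (z - t) v := rfl
    rw [h4, h3]
    have hint : ∫ t, φ n (z - t) = 1 := by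
      rw [integral_sub_left_eq_self (φ n) volume z]
      exact (b n).integral_normed
    have hint' : Integrable fun t => φ n (z - t) :=
      hψ.continuous.integrable_of_hasCompactSupport hψc
    calc ‖∫ t, V v t * φ n (z - t)‖ ≤ ∫ t, (C * ‖v‖) * φ n (z - t) := by
          refine norm_integral_le_of_norm_le (hint'.const_mul _) (Eventually.of_forall fun t => ?_)
          have h0 : 0 ≤ φ n (z - t) := (b n).nonneg_normed _
          rw [norm_mul, Real.norm_of_nonneg h0]
          exact mul_le_mul_of_nonneg_right (hV v t) h0
      _ = C * ‖v‖ := by rw [integral_const_mul, hint, mul_one]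
  -- The mean value inequality is used on all of space, so the constant does not depend on the shape
  -- of the domain.
  have hLip : ∀ n, ‖W n x - W n y‖ ≤ C * ‖x - y‖ := fun n =>
    convex_univ.norm_image_sub_le_of_norm_hasFDerivWithin_le
      (fun z _ => (hderiv n z).hasFDerivWithinAt) (fun z _ => hbound n z) (Set.mem_univ y)
      (Set.mem_univ x)
  exact le_of_tendsto (((hlim x hx).sub (hlim y hy)).norm) (Eventually.of_forall hLip)

end WeakDerivative

/-! ### Continuity of discrete functions without jumps. -/

namespace DGMesh

open Set MeasureTheory Filter

variable {M : DGMesh} {e : Fin M.nElem}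

/-- A discrete function without jumps across interior faces and with zero boundary values is
continuous. -/
theorem continuousZeroBoundary_of_ae {u : M.Space}
    (hint : ∀ e e', e < e' → ∀ i, ∀ᵐ x ∂(M.facetMeasure e i), x ∈ M.closedElem e' →
      M.val u e x - M.val u e' x = 0)
    (hbdry : ∀ e i, ∀ᵐ x ∂(M.facetMeasure e i), x ∈ frontier M.domain → M.val u e x = 0) :
    M.ContinuousZeroBoundary u := by
  obtain ⟨C, hC⟩ := exists_bound_glue_fderiv u
  have hUint : Integrable (M.glue (M.val u)) := integrable_glue (continuousOn_val u)
  let O : Set E3 := (⋃ e, M.closedElem e)ᶜ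
  have hO : IsOpen O := isClosed_iUnion_closedElem.isOpen_compl
  have hzero : ∀ x ∈ O, M.glue (M.val u) x = 0 := fun x hx =>
    glue_eq_zero _ fun e he => hx (mem_iUnion.2 ⟨e, elem_subset_closedElem he⟩)
  have hcont : ∀ x ∈ (⋃ e, M.elem e) ∪ O, ContinuousAt (M.glue (M.val u)) x := by
    rintro x (hx | hx)
    · obtain ⟨e, he⟩ := mem_iUnion.1 hx
      have h1 : ContinuousAt (M.val u e) x :=
        (hasFDerivAt_val u (elem_subset_target he)).continuousAt
      refine h1.congr ?_
      filter_upwards [isOpen_elem.mem_nhds he] with z hz using (glue_eq_of_mem _ hz).symm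
    · refine (continuousAt_const (y := (0 : ℝ))).congr ?_
      filter_upwards [hO.mem_nhds hx] with z hz using (hzero z hz).symm
  -- The exterior is included along with the open elements, so that the extension also carries the
  -- zero boundary values.
  have hLip : LipschitzOnWith C (M.glue (M.val u)) ((⋃ e, M.elem e) ∪ O) := by
    refine LipschitzOnWith.of_dist_le_mul fun x hx y hy => ?_
    rw [dist_eq_norm, dist_eq_norm]
    exact norm_sub_le_of_weak_fderiv hUint.locallyIntegrable (fun v x => hC x v)
      (fun φ hφ _ v => integral_glue_val_mul_fderiv hint hbdry hφ v) (hcont x hx) (hcont y hy)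
  obtain ⟨g, hg, hgU⟩ := hLip.extend_real
  refine ⟨g, hg.continuous.continuousOn, fun e => ?_, fun x hx => ?_⟩
  · have h1 : EqOn g (M.val u e) (M.elem e) := fun x hx => by
      rw [← hgU (Or.inl (mem_iUnion.2 ⟨e, hx⟩)), glue_eq_of_mem _ hx]
    exact h1.of_subset_closure hg.continuous.continuousOn (continuousOn_val u e)
      elem_subset_closedElem closedElem_subset_closure_elem
  -- The domain is the interior of the union of the closed elements, so each of its boundary points
  -- is a limit of exterior points, where `g` is zero.
  · have hxO : x ∈ closure O := by
      have : x ∉ M.domain := by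
        have := hx.2
        rwa [isOpen_domain.interior_eq] at this
      rwa [closure_compl]
    have hsub : closure O ⊆ {x | g x = 0} :=
      closure_minimal (fun z hz => by
        change g z = 0
        rw [← hgU (Or.inr hz), hzero z hz]) (isClosed_eq hg.continuous continuous_const)
    exact hsub hxO

end DGMesh

/-! ### Bilinearity, positivity and cancellation properties of the discrete forms. -/

namespace IsBilinearMap

variable {V : Type*} [AddCommGroup V] [Module ℝ V]

theorem of_sum {ι : Type*} (s : Finset ι) {a : ι → V → V → ℝ} (h : ∀ i, IsBilinearMap ℝ (a i)) :
    IsBilinearMap ℝ fun u v => ∑ i ∈ s, a i u v where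
  add_left u u' v := by simp [(h _).add_left, Finset.sum_add_distrib]
  smul_left c u v := by simp [(h _).smul_left, Finset.mul_sum]
  add_right u v v' := by simp [(h _).add_right, Finset.sum_add_distrib]
  smul_right c u v := by simp [(h _).smul_right, Finset.mul_sum]

theorem of_add {a b : V → V → ℝ} (ha : IsBilinearMap ℝ a) (hb : IsBilinearMap ℝ b) :
    IsBilinearMap ℝ fun u v => a u v + b u v where
  add_left u u' v := by simp only [ha.add_left, hb.add_left]; ring
  smul_left c u v := by simp only [ha.smul_left, hb.smul_left, smul_eq_mul]; ring
  add_right u v v' := by simp only [ha.add_right, hb.add_right]; ring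
  smul_right c u v := by simp only [ha.smul_right, hb.smul_right, smul_eq_mul]; ring

theorem of_zero : IsBilinearMap ℝ fun _ _ : V => (0 : ℝ) where
  add_left := by simp
  smul_left := by simp
  add_right := by simp
  smul_right := by simp

theorem of_ite (p : Prop) [Decidable p] {a : V → V → ℝ} (ha : IsBilinearMap ℝ a) :
    IsBilinearMap ℝ fun u v => if p then a u v else 0 := by
  split_ifs
  · exact ha
  · exact of_zero

end IsBilinearMap

/-- A continuous function of the normal and the jumps and averages of two functions, bilinear in
the two functions. -/
structure IsFaceForm (h : E3 → ℝ → ℝ → ℝ → ℝ → ℝ) : Prop where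
  cont : Continuous fun p : E3 × ℝ × ℝ × ℝ × ℝ => h p.1 p.2.1 p.2.2.1 p.2.2.2.1 p.2.2.2.2
  add_left : ∀ n a a' b b' c d, h n (a + a') (b + b') c d = h n a b c d + h n a' b' c d
  smul_left : ∀ n r a b c d, h n (r * a) (r * b) c d = r * h n a b c d
  add_right : ∀ n a b c c' d d', h n a b (c + c') (d + d') = h n a b c d + h n a b c' d'
  smul_right : ∀ n r a b c d, h n a b (r * c) (r * d) = r * h n a b c d

namespace DGMesh

open Set MeasureTheory Filter

variable {M : DGMesh} {e e' : Fin M.nElem}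

theorem val_add (u u' : M.Space) (e : Fin M.nElem) (x : E3) :
    M.val (u + u') e x = M.val u e x + M.val u' e x := by simp [val]

theorem val_smul (c : ℝ) (u : M.Space) (e : Fin M.nElem) (x : E3) :
    M.val (c • u) e x = c * M.val u e x := by simp [val]

theorem fderiv_val_add (u u' : M.Space) {x : E3} (hx : x ∈ (M.map e).target) (v : E3) :
    fderiv ℝ (M.val (u + u') e) x v = fderiv ℝ (M.val u e) x v + fderiv ℝ (M.val u' e) x v := by
  have h1 : M.val (u + u') e = fun x => M.val u e x + M.val u' e x := funext (val_add u u' e)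
  have h2 : fderiv ℝ (fun x => M.val u e x + M.val u' e x) x = _ :=
    ((hasFDerivAt_val u hx).add (hasFDerivAt_val u' hx)).fderiv
  rw [h1, h2]
  rfl

theorem fderiv_val_smul (c : ℝ) (u : M.Space) {x : E3} (hx : x ∈ (M.map e).target) (v : E3) :
    fderiv ℝ (M.val (c • u) e) x v = c * fderiv ℝ (M.val u e) x v := by
  have h1 : M.val (c • u) e = fun x => c * M.val u e x := funext (val_smul c u e)
  have h2 : fderiv ℝ (fun x => c * M.val u e x) x = _ := ((hasFDerivAt_val u hx).const_mul c).fderiv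
  rw [h1, h2]
  rfl

theorem integrableOn_mass {s : E3 → ℝ} (hs : IntegrableOn s M.domain) (u v : M.Space)
    (e : Fin M.nElem) :
    IntegrableOn (fun x => s x * M.val u e x * M.val v e x) (M.elem e) := by
  have h1 := (hs.mono_set (elem_subset_domain (e := e))).mul_continuousOn_of_subset
    ((continuousOn_val u e).mul (continuousOn_val v e)) isOpen_elem.measurableSet
    isCompact_closedElem elem_subset_closedElem
  refine h1.congr_fun (fun x _ => ?_) isOpen_elem.measurableSet
  simp only [Pi.mul_apply, mul_assoc]

theorem isBilinearMap_massForm {s : E3 → ℝ} (hs : IntegrableOn s M.domain) :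
    IsBilinearMap ℝ (M.massForm s) := by
  refine IsBilinearMap.of_sum _ fun e => ?_
  have hi := fun u v => integrableOn_mass hs u v e
  refine ⟨fun u u' v => ?_, fun c u v => ?_, fun u v v' => ?_, fun c u v => ?_⟩
  · rw [← integral_add (hi u v) (hi u' v)]
    simp only [val_add, mul_add, add_mul]
  · rw [smul_eq_mul, ← integral_const_mul]
    congr 1; ext1 x; rw [val_smul]; ring
  · rw [← integral_add (hi u v) (hi u v')]
    simp only [val_add, mul_add]
  · rw [smul_eq_mul, ← integral_const_mul]
    congr 1; ext1 x; rw [val_smul]; ring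

theorem massForm_symm (s : E3 → ℝ) (u v : M.Space) : M.massForm s u v = M.massForm s v u := by
  unfold massForm
  simp only [mul_assoc, mul_comm (M.val u _ _)]

/-- In reference coordinates the polynomial vanishes on a box with infinite sides, so it is the zero
polynomial. -/
theorem eq_zero_of_val_eq_zero {u : M.Space} (h : ∀ e, ∀ x ∈ M.elem e, M.val u e x = 0) :
    u = 0 := by
  funext e
  apply Subtype.ext
  change (u e : MvPolynomial (Fin 3) ℝ) = 0
  have hy : ∀ y ∈ interior (M.ref e).carrier,
      MvPolynomial.eval (fun j => y j) (u e : MvPolynomial (Fin 3) ℝ) = 0 := by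
    intro y hy
    have := h e (M.map e y) ⟨y, hy, rfl⟩
    unfold val at this
    rwa [(M.map e).left_inv (interior_subset_source hy)] at this
  have hnonempty : (interior (M.ref e).carrier).Nonempty := (M.ref e).solid
  obtain ⟨y, hyI⟩ := hnonempty
  let O : Set (Fin 3 → ℝ) := (WithLp.toLp 2) ⁻¹' interior (M.ref e).carrier
  have hO : IsOpen O := isOpen_interior.preimage (PiLp.continuous_toLp 2 _)
  obtain ⟨r, hr, hball⟩ := Metric.isOpen_iff.1 hO (WithLp.ofLp y) hyI
  refine MvPolynomial.funext_set (fun j => Metric.ball (y j) r) (fun j => ?_) fun z hz => ?_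
  · rw [Real.ball_eq_Ioo]
    exact Ioo_infinite (by linarith)
  · have hzO : z ∈ O := by
      apply hball
      rw [ball_pi _ hr]
      exact hz
    rw [map_zero]
    exact hy _ hzO

theorem massForm_self_nonneg {s : E3 → ℝ} (hs : ∀ x ∈ M.domain, 0 < s x) (u : M.Space) :
    0 ≤ M.massForm s u u := by
  refine Finset.sum_nonneg fun e _ => setIntegral_nonneg isOpen_elem.measurableSet fun x hx => ?_
  rw [mul_assoc]
  exact mul_nonneg (hs x (elem_subset_domain hx)).le (mul_self_nonneg _)

theorem massForm_self_pos {s : E3 → ℝ} (hs : ∀ x ∈ M.domain, 0 < s x)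
    (hsi : IntegrableOn s M.domain) {u : M.Space} (hu : u ≠ 0) : 0 < M.massForm s u u := by
  have hnn : ∀ e, ∀ x ∈ M.elem e, 0 ≤ s x * M.val u e x * M.val u e x := fun e x hx => by
    rw [mul_assoc]
    exact mul_nonneg (hs x (elem_subset_domain hx)).le (mul_self_nonneg _)
  refine lt_of_le_of_ne (massForm_self_nonneg hs u) fun h0 => hu ?_
  have h1 := (Finset.sum_eq_zero_iff_of_nonneg fun e _ =>
    setIntegral_nonneg isOpen_elem.measurableSet (hnn e)).1 h0.symm
  refine eq_zero_of_val_eq_zero fun e => ?_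
  -- The coefficient is only integrable, so the zero integral gives `u = 0` almost everywhere.
  -- Continuity of `u` on the open element upgrades this.
  have h2 : M.val u e =ᵐ[volume.restrict (M.elem e)] fun _ => 0 := by
    have h3 := (setIntegral_eq_zero_iff_of_nonneg_ae
      ((ae_restrict_iff' isOpen_elem.measurableSet).2 (Eventually.of_forall (hnn e)))
      (integrableOn_mass hsi u u e)).1 (h1 e (Finset.mem_univ e))
    filter_upwards [h3, ae_restrict_mem isOpen_elem.measurableSet] with x hx hxe
    have hx : s x * M.val u e x * M.val u e x = 0 := hx
    have hsx := (hs x (elem_subset_domain hxe)).ne'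
    rw [mul_assoc, mul_eq_zero, mul_self_eq_zero] at hx
    exact hx.resolve_left hsx
  exact Measure.eqOn_open_of_ae_eq h2 isOpen_elem
    ((continuousOn_val u e).mono elem_subset_closedElem) continuousOn_const

variable (M) in
/-- The form `∑_κ ∫_κ (ω·∇u) v dx`. -/
noncomputable def dirDerivForm (ω : E3) (u v : M.Space) : ℝ :=
  ∑ e, ∫ x in M.elem e, fderiv ℝ (M.val u e) x ω * M.val v e x

theorem integrableOn_dirDeriv (ω : E3) (u v : M.Space) (e : Fin M.nElem) :
    IntegrableOn (fun x => fderiv ℝ (M.val u e) x ω * M.val v e x) (M.elem e) :=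
  integrableOn_elem_of_continuousOn (((continuousOn_fderiv_val u ω).mono
    closedElem_subset_target).mul (continuousOn_val v e))

theorem isBilinearMap_dirDerivForm (ω : E3) : IsBilinearMap ℝ (M.dirDerivForm ω) := by
  refine IsBilinearMap.of_sum _ fun e => ?_
  have hi := fun u v => integrableOn_dirDeriv (M := M) ω u v e
  have hm := isOpen_elem (M := M) (e := e).measurableSet
  refine ⟨fun u u' v => ?_, fun c u v => ?_, fun u v v' => ?_, fun c u v => ?_⟩
  · rw [← integral_add (hi u v) (hi u' v)]
    refine setIntegral_congr_fun hm fun x hx => ?_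
    simp only [fderiv_val_add u u' (elem_subset_target hx), add_mul]
  · rw [smul_eq_mul, ← integral_const_mul]
    refine setIntegral_congr_fun hm fun x hx => ?_
    simp only [fderiv_val_smul c u (elem_subset_target hx), mul_assoc]
  · rw [← integral_add (hi u v) (hi u v')]
    simp only [val_add, mul_add]
  · rw [smul_eq_mul, ← integral_const_mul]
    congr 1; ext1 x; rw [val_smul]; ring

theorem isBilinearMap_derivForm (j : Fin 3) : IsBilinearMap ℝ (M.derivForm j) :=
  isBilinearMap_dirDerivForm (EuclideanSpace.single j 1)

theorem sum_mul_derivForm (ω : E3) (u v : M.Space) :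
    ∑ j, ω j * M.derivForm j u v = M.dirDerivForm ω u v := by
  unfold derivForm dirDerivForm
  simp_rw [Finset.mul_sum]
  rw [Finset.sum_comm]
  refine Finset.sum_congr rfl fun e _ => ?_
  simp_rw [← integral_const_mul]
  rw [← integral_finsetSum _ fun j _ => (integrableOn_dirDeriv _ u v e).const_mul _]
  congr 1
  ext1 x
  have hω : ω = ∑ j, ω j • EuclideanSpace.single j (1 : ℝ) := by
    ext k
    simp [Finset.sum_apply, Pi.single_apply]
  conv_rhs => rw [hω, map_sum, Finset.sum_mul]
  exact Finset.sum_congr rfl fun j _ => by rw [map_smul, smul_eq_mul, mul_assoc]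

theorem isClosed_frontier_domain : IsClosed (frontier M.domain) := isClosed_frontier

theorem continuousOn_faceForm {h : E3 → ℝ → ℝ → ℝ → ℝ → ℝ} (hh : IsFaceForm h)
    (i : Fin (M.ref e).nFacets) {s : Set E3} (hs : s ⊆ M.closedElem e) {a b c d : E3 → ℝ}
    (ha : ContinuousOn a s) (hb : ContinuousOn b s) (hc : ContinuousOn c s)
    (hd : ContinuousOn d s) :
    ContinuousOn (fun x => h (M.facetNormal e i x) (a x) (b x) (c x) (d x)) s :=
  hh.cont.comp_continuousOn (((continuousOn_facetNormal i).mono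
    (hs.trans closedElem_subset_target)).prodMk (ha.prodMk (hb.prodMk (hc.prodMk hd))))

theorem continuousOn_interiorFace {h : E3 → ℝ → ℝ → ℝ → ℝ → ℝ} (hh : IsFaceForm h)
    (i : Fin (M.ref e).nFacets) (e' : Fin M.nElem) (u v : M.Space) :
    ContinuousOn (fun x => h (M.facetNormal e i x)
      (M.val u e x - M.val u e' x) ((M.val u e x + M.val u e' x) / 2)
      (M.val v e x - M.val v e' x) ((M.val v e x + M.val v e' x) / 2))
      (M.closedElem e ∩ M.closedElem e') := by
  have h1 : ∀ u : M.Space, ContinuousOn (M.val u e) (M.closedElem e ∩ M.closedElem e') := fun u =>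
    (continuousOn_val u e).mono inter_subset_left
  have h2 : ∀ u : M.Space, ContinuousOn (M.val u e') (M.closedElem e ∩ M.closedElem e') := fun u =>
    (continuousOn_val u e').mono inter_subset_right
  exact continuousOn_faceForm hh i inter_subset_left ((h1 u).sub (h2 u))
    (((h1 u).add (h2 u)).div_const 2) ((h1 v).sub (h2 v)) (((h1 v).add (h2 v)).div_const 2)

theorem continuousOn_boundaryFace {h : E3 → ℝ → ℝ → ℝ → ℝ → ℝ} (hh : IsFaceForm h) (θ : ℝ)
    (i : Fin (M.ref e).nFacets) (u v : M.Space) :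
    ContinuousOn (fun x => h (M.facetNormal e i x)
      (M.val u e x) (θ * M.val u e x) (M.val v e x) (θ * M.val v e x))
      (M.closedElem e ∩ frontier M.domain) :=
  (continuousOn_faceForm hh i subset_rfl (continuousOn_val u e)
    (continuousOn_const.mul (continuousOn_val u e)) (continuousOn_val v e)
    (continuousOn_const.mul (continuousOn_val v e))).mono inter_subset_left

theorem faceSum_eq {h : E3 → ℝ → ℝ → ℝ → ℝ → ℝ} (hh : IsFaceForm h) (θ : ℝ) (u v : M.Space) :
    M.faceSum θ h u v = (∑ e, ∑ e', if e < e' then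
      ∑ i, ∫ x in M.closedElem e', h (M.facetNormal e i x)
        (M.val u e x - M.val u e' x) ((M.val u e x + M.val u e' x) / 2)
        (M.val v e x - M.val v e' x) ((M.val v e x + M.val v e' x) / 2) ∂(M.facetMeasure e i)
    else 0) +
    ∑ e, ∑ i, ∫ x in frontier M.domain, h (M.facetNormal e i x)
      (M.val u e x) (θ * M.val u e x) (M.val v e x) (θ * M.val v e x) ∂(M.facetMeasure e i) := by
  unfold faceSum
  simp only [facetIntegral_eq_of_continuousOn _ isClosed_closedElem
    (continuousOn_interiorFace hh _ _ u v), facetIntegral_eq_of_continuousOn _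
    isClosed_frontier_domain (continuousOn_boundaryFace hh θ _ u v)]

/-- Abstracting jump and average as linear maps `p` and `q` treats interior and boundary faces at
once. -/
theorem isBilinearMap_faceIntegral {h : E3 → ℝ → ℝ → ℝ → ℝ → ℝ} (hh : IsFaceForm h)
    (i : Fin (M.ref e).nFacets) (T : Set E3) (p q : M.Space →ₗ[ℝ] E3 → ℝ)
    (hi : ∀ u v, IntegrableOn (fun x => h (M.facetNormal e i x) (p u x) (q u x) (p v x) (q v x)) T
      (M.facetMeasure e i)) :
    IsBilinearMap ℝ fun u v => ∫ x in T, h (M.facetNormal e i x) (p u x) (q u x) (p v x) (q v x)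
      ∂(M.facetMeasure e i) where
  add_left u u' v := by
    rw [← integral_add (hi u v) (hi u' v)]
    simp only [map_add, Pi.add_apply, hh.add_left]
  smul_left c u v := by
    rw [smul_eq_mul, ← integral_const_mul]
    simp only [map_smul, Pi.smul_apply, smul_eq_mul, hh.smul_left]
  add_right u v v' := by
    rw [← integral_add (hi u v) (hi u v')]
    simp only [map_add, Pi.add_apply, hh.add_right]
  smul_right c u v := by
    rw [smul_eq_mul, ← integral_const_mul]
    simp only [map_smul, Pi.smul_apply, smul_eq_mul, hh.smul_right]

theorem isBilinearMap_faceSum {h : E3 → ℝ → ℝ → ℝ → ℝ → ℝ} (hh : IsFaceForm h) (θ : ℝ) :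
    IsBilinearMap ℝ (M.faceSum θ h) := by
  have heq : M.faceSum θ h = _ := funext fun u => funext fun v => faceSum_eq hh θ u v
  rw [heq]
  refine IsBilinearMap.of_add ?_ ?_
  · refine IsBilinearMap.of_sum _ fun e => IsBilinearMap.of_sum _ fun e' =>
      IsBilinearMap.of_ite _ (IsBilinearMap.of_sum _ fun i => ?_)
    exact isBilinearMap_faceIntegral hh i (M.closedElem e')
      { toFun := fun u x => M.val u e x - M.val u e' x
        map_add' := fun u u' => by
          ext x; simp only [val_add, Pi.add_apply]; ring
        map_smul' := fun c u => by
          ext x; simp only [val_smul, Pi.smul_apply, smul_eq_mul, RingHom.id_apply]; ring }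
      { toFun := fun u x => (M.val u e x + M.val u e' x) / 2
        map_add' := fun u u' => by
          ext x; simp only [val_add, Pi.add_apply]; ring
        map_smul' := fun c u => by
          ext x; simp only [val_smul, Pi.smul_apply, smul_eq_mul, RingHom.id_apply]; ring }
      fun u v => integrableOn_facetMeasure i isClosed_closedElem
        (continuousOn_interiorFace hh i e' u v)
  · refine IsBilinearMap.of_sum _ fun e => IsBilinearMap.of_sum _ fun i => ?_
    exact isBilinearMap_faceIntegral hh i (frontier M.domain)
      { toFun := fun u x => M.val u e x
        map_add' := fun u u' => by
          ext x; simp only [val_add, Pi.add_apply]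
        map_smul' := fun c u => by
          ext x; simp only [val_smul, Pi.smul_apply, smul_eq_mul, RingHom.id_apply] }
      { toFun := fun u x => θ * M.val u e x
        map_add' := fun u u' => by
          ext x; simp only [val_add, Pi.add_apply]; ring
        map_smul' := fun c u => by
          ext x; simp only [val_smul, Pi.smul_apply, smul_eq_mul, RingHom.id_apply]; ring }
      fun u v => integrableOn_facetMeasure i isClosed_frontier_domain
        (continuousOn_boundaryFace hh θ i u v)

theorem sum_mul_faceSum {ι : Type*} (s : Finset ι) (w : ι → ℝ)
    {h : ι → E3 → ℝ → ℝ → ℝ → ℝ → ℝ} (hh : ∀ d, IsFaceForm (h d))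
    {h₀ : E3 → ℝ → ℝ → ℝ → ℝ → ℝ} (hh₀ : IsFaceForm h₀)
    (hsum : ∀ n a b c k, ∑ d ∈ s, w d * h d n a b c k = h₀ n a b c k) (θ : ℝ) (u v : M.Space) :
    ∑ d ∈ s, w d * M.faceSum θ (h d) u v = M.faceSum θ h₀ u v := by
  simp_rw [faceSum_eq (hh _), faceSum_eq hh₀, mul_add, Finset.sum_add_distrib, Finset.mul_sum]
  congr 1
  · rw [Finset.sum_comm]
    refine Finset.sum_congr rfl fun e _ => ?_
    rw [Finset.sum_comm]
    refine Finset.sum_congr rfl fun e' _ => ?_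
    split_ifs
    · simp_rw [Finset.mul_sum]
      rw [Finset.sum_comm]
      refine Finset.sum_congr rfl fun i _ => ?_
      simp_rw [← integral_const_mul]
      rw [← integral_finsetSum]
      · simp_rw [hsum]
      · exact fun d _ => (integrableOn_facetMeasure i isClosed_closedElem
          (continuousOn_interiorFace (hh d) i e' u v)).const_mul _
    · simp
  · rw [Finset.sum_comm]
    refine Finset.sum_congr rfl fun e _ => ?_
    rw [Finset.sum_comm]
    refine Finset.sum_congr rfl fun i _ => ?_
    simp_rw [← integral_const_mul]
    rw [← integral_finsetSum]
    · simp_rw [hsum]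
    · exact fun d _ => (integrableOn_facetMeasure i isClosed_frontier_domain
        (continuousOn_boundaryFace (hh d) θ i u v)).const_mul _

theorem ContinuousZeroBoundary.val_eq {u : M.Space} (hu : M.ContinuousZeroBoundary u) {x : E3}
    (hx : x ∈ M.closedElem e) (hx' : x ∈ M.closedElem e') : M.val u e x = M.val u e' x := by
  obtain ⟨g, -, hg, -⟩ := hu
  rw [← hg e x hx, ← hg e' x hx']

theorem ContinuousZeroBoundary.val_eq_zero {u : M.Space} (hu : M.ContinuousZeroBoundary u)
    {x : E3} (hx : x ∈ M.closedElem e) (hx' : x ∈ frontier M.domain) : M.val u e x = 0 := by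
  obtain ⟨g, -, hg, hg0⟩ := hu
  rw [← hg e x hx, hg0 x hx']

theorem faceSum_eq_zero {h : E3 → ℝ → ℝ → ℝ → ℝ → ℝ} (hh : IsFaceForm h) (θ : ℝ) {u v : M.Space}
    (h0 : (M.ContinuousZeroBoundary u ∧ ∀ n b c d, h n 0 b c d = 0) ∨
      (M.ContinuousZeroBoundary v ∧ ∀ n a b d, h n a b 0 d = 0)) : M.faceSum θ h u v = 0 := by
  rw [faceSum_eq hh, Finset.sum_eq_zero, Finset.sum_eq_zero, add_zero]
  · refine fun e _ => Finset.sum_eq_zero fun i _ => ?_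
    rw [setIntegral_congr_ae (g := fun _ => 0) isClosed_frontier_domain.measurableSet,
      integral_zero]
    filter_upwards [ae_mem_facet i] with x hx hxf
    rcases h0 with ⟨hu, h0⟩ | ⟨hv, h0⟩
    · rw [hu.val_eq_zero hx.1 hxf, h0]
    · rw [hv.val_eq_zero hx.1 hxf, h0]
  · refine fun e _ => Finset.sum_eq_zero fun e' _ => ?_
    split_ifs
    · refine Finset.sum_eq_zero fun i _ => ?_
      rw [setIntegral_congr_ae (g := fun _ => 0) isClosed_closedElem.measurableSet, integral_zero]
      filter_upwards [ae_mem_facet i] with x hx hxe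
      rcases h0 with ⟨hu, h0⟩ | ⟨hv, h0⟩
      · rw [hu.val_eq hx.1 hxe, sub_self, h0]
      · rw [hv.val_eq hx.1 hxe, sub_self, h0]
    · rfl

theorem isFaceForm_upwind (ω : E3) : IsFaceForm fun n ju _ jv av =>
    -(⟪ω, n⟫_ℝ * ju * av) + 1 / 2 * |⟪ω, n⟫_ℝ| * ju * jv where
  cont := by fun_prop
  add_left := by intros; ring
  smul_left := by intros; ring
  add_right := by intros; ring
  smul_right := by intros; ring

theorem isFaceForm_upwindTilde (ω : E3) : IsFaceForm fun n ju au jv _ =>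
    ⟪ω, n⟫_ℝ * au * jv + 1 / 2 * |⟪ω, n⟫_ℝ| * ju * jv where
  cont := by fun_prop
  add_left := by intros; ring
  smul_left := by intros; ring
  add_right := by intros; ring
  smul_right := by intros; ring

/-- Each term of this form contains the jump of the trial function. In the tilde form each term
contains the jump of the test function instead, so one is annihilated by `P` from the right and the
other by `Pᵀ` from the left. -/
theorem upwindForm_eq_zero (θ : ℝ) (ω : E3) {u : M.Space} (hu : M.ContinuousZeroBoundary u)
    (v : M.Space) : M.upwindForm θ ω u v = 0 :=
  faceSum_eq_zero (isFaceForm_upwind ω) θ (Or.inl ⟨hu, fun n b c d => by ring⟩)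

theorem upwindFormTilde_eq_zero (θ : ℝ) (ω : E3) (u : M.Space) {v : M.Space}
    (hv : M.ContinuousZeroBoundary v) : M.upwindFormTilde θ ω u v = 0 :=
  faceSum_eq_zero (isFaceForm_upwindTilde ω) θ (Or.inr ⟨hv, fun n a b d => by ring⟩)

/-- Integration by parts against a continuous discrete function with zero boundary values. -/
theorem dirDerivForm_add_upwindForm (θ : ℝ) (ω : E3) (u : M.Space) {v : M.Space}
    (hv : M.ContinuousZeroBoundary v) :
    M.dirDerivForm ω u v + M.upwindForm θ ω u v = -M.dirDerivForm ω v u := by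
  have h1 : M.dirDerivForm ω u v + M.dirDerivForm ω v u
      = ∑ e, ∫ x in M.elem e, fderiv ℝ (fun x => M.val u e x * M.val v e x) x ω := by
    unfold dirDerivForm
    rw [← Finset.sum_add_distrib]
    refine Finset.sum_congr rfl fun e _ => ?_
    rw [← integral_add (integrableOn_dirDeriv ω u v e) (integrableOn_dirDeriv ω v u e)]
    refine setIntegral_congr_fun isOpen_elem.measurableSet fun x hx => ?_
    have hd : fderiv ℝ (fun x => M.val u e x * M.val v e x) x = _ :=
      ((hasFDerivAt_val u (elem_subset_target hx)).mul
        (hasFDerivAt_val v (elem_subset_target hx))).fderiv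
    simp only [hd, add_apply, smul_apply, smul_eq_mul]
    ring
  -- Since `v` has no jump, the penalty vanishes, the average of `v` is `v`, and the jump of `u v`
  -- is the jump of `u` times `v`. The remaining term is minus the total flux.
  have h2 : M.upwindForm θ ω u v
      = -∑ e, ∫ x in M.elem e, fderiv ℝ (fun x => M.val u e x * M.val v e x) x ω := by
    simp_rw [integral_elem_fderiv ((contDiffOn_val u _).mul (contDiffOn_val v _)) ω]
    rw [sum_facetMeasure_eq_sum_jump (fun e x => M.val u e x * M.val v e x)
      (fun e => (continuousOn_val u e).mul (continuousOn_val v e))]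
    · unfold upwindForm
      rw [faceSum_eq (isFaceForm_upwind ω), ← Finset.sum_neg_distrib]
      have hb : (∑ e, ∑ i, ∫ x in frontier M.domain, (-(⟪ω, M.facetNormal e i x⟫_ℝ *
          M.val u e x * (θ * M.val v e x)) + 1 / 2 * |⟪ω, M.facetNormal e i x⟫_ℝ| *
            M.val u e x * M.val v e x) ∂(M.facetMeasure e i)) = 0 := by
        refine Finset.sum_eq_zero fun e _ => Finset.sum_eq_zero fun i _ => ?_
        rw [setIntegral_congr_ae (g := fun _ => 0) isClosed_frontier_domain.measurableSet,
          integral_zero]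
        filter_upwards [ae_mem_facet i] with x hx hxf
        rw [hv.val_eq_zero hx.1 hxf]
        ring
      rw [hb, add_zero]
      refine Finset.sum_congr rfl fun e _ => ?_
      rw [← Finset.sum_neg_distrib]
      refine Finset.sum_congr rfl fun e' _ => ?_
      split_ifs
      · rw [← Finset.sum_neg_distrib]
        refine Finset.sum_congr rfl fun i _ => ?_
        rw [← integral_neg]
        refine setIntegral_congr_ae isClosed_closedElem.measurableSet ?_
        filter_upwards [ae_mem_facet i] with x hx hxe
        rw [hv.val_eq hx.1 hxe, real_inner_comm]
        ring
      · simp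
    · intro e i
      filter_upwards [ae_mem_facet i] with x hx hxf
      rw [hv.val_eq_zero hx.1 hxf, mul_zero]
  rw [h2, ← h1]
  ring

/-- The discrete functions whose jumps vanish in the quadratic mean are continuous with zero
boundary values. -/
theorem continuousZeroBoundary_of_faceSum_eq_zero {c : E3 → ℝ} (hc0 : ∀ n, 0 ≤ c n)
    (hcpos : ∀ n, ‖n‖ = 1 → 0 < c n)
    (hc : IsFaceForm fun n ju _ jv _ => c n * ju * jv) (θ : ℝ) {u : M.Space}
    (hu : M.faceSum θ (fun n ju _ jv _ => c n * ju * jv) u u = 0) :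
    M.ContinuousZeroBoundary u := by
  rw [faceSum_eq hc] at hu
  have h : ∀ n a, 0 ≤ c n * a * a := fun n a => by
    rw [mul_assoc]; exact mul_nonneg (hc0 n) (mul_self_nonneg a)
  have hint0 : ∀ e e', 0 ≤ if e < e' then ∑ i, ∫ x in M.closedElem e', c (M.facetNormal e i x) *
      (M.val u e x - M.val u e' x) * (M.val u e x - M.val u e' x) ∂(M.facetMeasure e i)
      else 0 := by
    intro e e'
    split_ifs
    · exact Finset.sum_nonneg fun i _ => integral_nonneg fun x => h _ _
    · rfl
  have hbd0 : ∀ e i, 0 ≤ ∫ x in frontier M.domain, c (M.facetNormal e i x) *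
      M.val u e x * M.val u e x ∂(M.facetMeasure e i) := fun e i => integral_nonneg fun x => h _ _
  have hz := (add_eq_zero_iff_of_nonneg
    (Finset.sum_nonneg fun e _ => Finset.sum_nonneg fun e' _ => hint0 e e')
    (Finset.sum_nonneg fun e _ => Finset.sum_nonneg fun i _ => hbd0 e i)).1 hu
  -- A zero integral of a nonnegative integrand vanishes almost everywhere, and the weight is
  -- strictly positive at the unit facet normal.
  have key : ∀ e (i : Fin (M.ref e).nFacets) (T : Set E3), MeasurableSet T → ∀ p : E3 → ℝ,
      IntegrableOn (fun x => c (M.facetNormal e i x) * p x * p x) T (M.facetMeasure e i) →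
      ∫ x in T, c (M.facetNormal e i x) * p x * p x ∂(M.facetMeasure e i) = 0 →
      ∀ᵐ x ∂(M.facetMeasure e i), x ∈ T → p x = 0 := by
    intro e i T hT p hpi hp0
    have h1 := (setIntegral_eq_zero_iff_of_nonneg_ae (Eventually.of_forall fun x => h _ _) hpi).1 hp0
    have h2 := (ae_restrict_iff' hT).1 h1
    filter_upwards [h2, ae_mem_facet i] with x hx hxi hxT
    have hx0 : c (M.facetNormal e i x) * p x * p x = 0 := hx hxT
    have hpos := hcpos _ (norm_facetNormal (closedElem_subset_target hxi.1) i)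
    rw [mul_assoc, mul_eq_zero, mul_self_eq_zero] at hx0
    exact hx0.resolve_left hpos.ne'
  refine continuousZeroBoundary_of_ae (fun e e' hlt i => ?_) fun e i => ?_
  · have h1 := (Finset.sum_eq_zero_iff_of_nonneg fun e _ =>
      Finset.sum_nonneg fun e' _ => hint0 e e').1 hz.1 e (Finset.mem_univ e)
    have h2 := (Finset.sum_eq_zero_iff_of_nonneg fun e' _ => hint0 e e').1 h1 e'
      (Finset.mem_univ e')
    rw [if_pos hlt] at h2
    have h3 := (Finset.sum_eq_zero_iff_of_nonneg fun i _ => integral_nonneg fun x => h _ _).1 h2 i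
      (Finset.mem_univ i)
    exact key e i _ isClosed_closedElem.measurableSet (fun x => M.val u e x - M.val u e' x)
      (integrableOn_facetMeasure i isClosed_closedElem (continuousOn_interiorFace hc i e' u u)) h3
  · have h1 := (Finset.sum_eq_zero_iff_of_nonneg fun e _ =>
      Finset.sum_nonneg fun i _ => hbd0 e i).1 hz.2 e (Finset.mem_univ e)
    have h2 := (Finset.sum_eq_zero_iff_of_nonneg fun i _ => hbd0 e i).1 h1 i (Finset.mem_univ i)
    exact key e i _ isClosed_frontier_domain.measurableSet (M.val u e)
      (integrableOn_facetMeasure i isClosed_frontier_domain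
        (continuousOn_boundaryFace hc θ i u u)) h2

end DGMesh

theorem Matrix.eq_of_forall_dotProduct_mulVec {N : ℕ} {B C : Matrix (Fin N) (Fin N) ℝ}
    (h : ∀ x y, x ⬝ᵥ B *ᵥ y = x ⬝ᵥ C *ᵥ y) : B = C := by
  ext i j
  simpa using h (Pi.single i 1) (Pi.single j 1)

/-! ### Moments of the angular quadrature. -/

namespace AngularQuadrature

variable (q : AngularQuadrature)

/-- Reversal of directions shows that the sum equals its own negative. -/
theorem sum_weight_mul_dir (j : Fin 3) : ∑ d, q.weight d * q.dir d j = 0 := by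
  have h := Equiv.sum_comp q.rev fun d => q.weight d * q.dir d j
  simp only [q.weight_rev, q.dir_rev, PiLp.neg_apply, mul_neg, Finset.sum_neg_distrib] at h
  linarith

theorem inner_dir (d : Fin q.nDir) (n : E3) : ⟪q.dir d, n⟫_ℝ = ∑ j, q.dir d j * n j := by
  rw [PiLp.inner_apply]
  exact Finset.sum_congr rfl fun j _ => by simp [mul_comm]

theorem sum_weight_mul_inner (n : E3) : ∑ d, q.weight d * ⟪q.dir d, n⟫_ℝ = 0 := by
  simp_rw [inner_dir, Finset.mul_sum]
  rw [Finset.sum_comm]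
  refine Finset.sum_eq_zero fun j _ => ?_
  simp_rw [← mul_assoc]
  rw [← Finset.sum_mul, q.sum_weight_mul_dir, zero_mul]

/-- The mean of the upwind jump penalty over all directions. -/
noncomputable def jumpWeight (n : E3) : ℝ := ∑ d, q.weight d * (1 / 2 * |⟪q.dir d, n⟫_ℝ|)

theorem jumpWeight_nonneg (n : E3) : 0 ≤ q.jumpWeight n :=
  Finset.sum_nonneg fun d _ => mul_nonneg (q.weight_pos d).le (by positivity)

/-- If the weight were zero, all directions would be orthogonal to `n`, and the second moment tensor
would send `n` to zero. It is a nonzero multiple of the identity. -/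
theorem jumpWeight_pos {n : E3} (hn : ‖n‖ = 1) : 0 < q.jumpWeight n := by
  refine lt_of_le_of_ne (q.jumpWeight_nonneg n) fun h0 => ?_
  have h1 := (Finset.sum_eq_zero_iff_of_nonneg fun d _ =>
    mul_nonneg (q.weight_pos d).le (by positivity)).1 h0.symm
  have h2 : ∀ d, ⟪q.dir d, n⟫_ℝ = 0 := fun d => by
    have := h1 d (Finset.mem_univ d)
    rw [mul_eq_zero] at this
    have := this.resolve_left (q.weight_pos d).ne'
    simpa using this
  have h3 : ∀ j, (4 * Real.pi / 3) * n j = 0 := by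
    intro j
    have h4 : ∑ d, q.weight d * q.dir d j * ⟪q.dir d, n⟫_ℝ = 0 := by simp [h2]
    simp_rw [inner_dir, Finset.mul_sum] at h4
    rw [Finset.sum_comm] at h4
    have h5 : ∀ k, ∑ d, q.weight d * q.dir d j * (q.dir d k * n k)
        = (if j = k then 4 * Real.pi / 3 else 0) * n k := by
      intro k
      rw [← q.sum_weight_mul j k, Finset.sum_mul]
      exact Finset.sum_congr rfl fun d _ => by ring
    simp_rw [h5] at h4
    simpa using h4
  have h6 : n = 0 := by
    ext j
    have hpi : (4 * Real.pi / 3) ≠ 0 := by positivity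
    simpa using (mul_eq_zero.1 (h3 j)).resolve_left hpi
  rw [h6, norm_zero] at hn
  exact zero_ne_one hn

theorem isFaceForm_jumpWeight : IsFaceForm fun n ju _ jv _ => q.jumpWeight n * ju * jv where
  cont := by unfold jumpWeight; fun_prop
  add_left := by intros; ring
  smul_left := by intros; ring
  add_right := by intros; ring
  smul_right := by intros; ring

end AngularQuadrature

/-! ### Matrix identities and the expansion of the preconditioned operator. -/

namespace TransportDG

variable (A : TransportDG)

/-- The discrete function with the given coefficients. -/
noncomputable def toSpace (c : Fin A.N → ℝ) : A.mesh.Space := A.basis.equivFun.symm c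

variable {A}

theorem dotProduct_matrixOf_mulVec {a : A.mesh.Space → A.mesh.Space → ℝ} (ha : IsBilinearMap ℝ a)
    (x y : Fin A.N → ℝ) : x ⬝ᵥ A.matrixOf a *ᵥ y = a (A.toSpace y) (A.toSpace x) := by
  have h : ∀ u v, ha.toLinearMap u v = a u v := fun _ _ => rfl
  unfold toSpace
  rw [← h, A.basis.equivFun_symm_apply, A.basis.equivFun_symm_apply]
  simp only [map_sum, map_smul, LinearMap.sum_apply, LinearMap.smul_apply, smul_eq_mul,
    dotProduct, Matrix.mulVec, matrixOf, Matrix.of_apply, h]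
  simp only [Finset.mul_sum]
  exact Finset.sum_congr rfl fun m _ => Finset.sum_congr rfl fun n _ => by ring

theorem dotProduct_ΩG_mulVec (d : Fin A.quad.nDir) (x y : Fin A.N → ℝ) :
    x ⬝ᵥ A.ΩG d *ᵥ y = A.mesh.dirDerivForm (A.quad.dir d) (A.toSpace y) (A.toSpace x) := by
  rw [← DGMesh.sum_mul_derivForm]
  simp only [ΩG, Matrix.sum_mulVec, dotProduct_sum, Matrix.smul_mulVec, dotProduct_smul, G,
    dotProduct_matrixOf_mulVec (DGMesh.isBilinearMap_derivForm _), smul_eq_mul]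

theorem dotProduct_F_mulVec (d : Fin A.quad.nDir) (x y : Fin A.N → ℝ) :
    x ⬝ᵥ A.F d *ᵥ y
      = A.mesh.upwindForm A.θ (A.quad.dir d) (A.toSpace y) (A.toSpace x) :=
  dotProduct_matrixOf_mulVec (DGMesh.isBilinearMap_faceSum (DGMesh.isFaceForm_upwind _) _) x y

theorem dotProduct_Ftilde_mulVec (d : Fin A.quad.nDir) (x y : Fin A.N → ℝ) :
    x ⬝ᵥ A.Ftilde d *ᵥ y
      = A.mesh.upwindFormTilde A.θ (A.quad.dir d) (A.toSpace y) (A.toSpace x) :=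
  dotProduct_matrixOf_mulVec (DGMesh.isBilinearMap_faceSum (DGMesh.isFaceForm_upwindTilde _) _) x y

/-- The consistency term is odd in the direction and averages to zero. Only the symmetric jump
penalty is left, independent of `θ`. -/
theorem dotProduct_F0_mulVec (x y : Fin A.N → ℝ) :
    x ⬝ᵥ A.F0 *ᵥ y = 1 / (4 * Real.pi) * A.mesh.faceSum A.θ
      (fun n ju _ jv _ => A.quad.jumpWeight n * ju * jv) (A.toSpace y) (A.toSpace x) := by
  rw [← DGMesh.sum_mul_faceSum Finset.univ A.quad.weight
    (fun d => DGMesh.isFaceForm_upwind (A.quad.dir d)) A.quad.isFaceForm_jumpWeight]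
  · simp only [F0, Matrix.sum_mulVec, dotProduct_sum, Matrix.smul_mulVec, dotProduct_smul,
      dotProduct_F_mulVec, smul_eq_mul]
    rfl
  · intro n ju _ jv av
    have h : ∀ d, A.quad.weight d * (-(⟪A.quad.dir d, n⟫_ℝ * ju * av)
        + 1 / 2 * |⟪A.quad.dir d, n⟫_ℝ| * ju * jv)
        = A.quad.weight d * ⟪A.quad.dir d, n⟫_ℝ * -(ju * av)
          + A.quad.weight d * (1 / 2 * |⟪A.quad.dir d, n⟫_ℝ|) * (ju * jv) := fun d => by ring
    simp only [h, Finset.sum_add_distrib, ← Finset.sum_mul, A.quad.sum_weight_mul_inner]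
    rw [AngularQuadrature.jumpWeight]
    ring

theorem posDef_mass {s : E3 → ℝ} (hs : ∀ x ∈ A.mesh.domain, 0 < s x)
    (hsi : MeasureTheory.IntegrableOn s A.mesh.domain) :
    (A.matrixOf (A.mesh.massForm s)).PosDef := by
  refine Matrix.PosDef.of_dotProduct_mulVec_pos ?_ fun {x} hx => ?_
  · ext m n
    simp [matrixOf, DGMesh.massForm_symm s (A.basis m)]
  · rw [star_trivial, dotProduct_matrixOf_mulVec (DGMesh.isBilinearMap_massForm hsi)]
    exact DGMesh.massForm_self_pos hs hsi fun h =>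
      hx (A.basis.equivFun.symm.map_eq_zero_iff.1 h)

theorem posDef_Mt : A.Mt.PosDef := posDef_mass A.σt_pos A.σt_int

theorem isUnit_det_Mt : IsUnit A.Mt.det := (Matrix.isUnit_iff_isUnit_det _).1 posDef_Mt.isUnit

section Projection

variable {P : A.Mat}

theorem IsProjContinuous.continuousZeroBoundary (hP : A.IsProjContinuous P) (x : Fin A.N → ℝ) :
    A.mesh.ContinuousZeroBoundary (A.toSpace (P *ᵥ x)) := (hP.2 _).1 ⟨x, rfl⟩

theorem IsProjContinuous.mulVec_eq (hP : A.IsProjContinuous P) {c : Fin A.N → ℝ}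
    (hc : A.mesh.ContinuousZeroBoundary (A.toSpace c)) : P *ᵥ c = c := by
  obtain ⟨y, rfl⟩ := (hP.2 c).2 hc
  simp [hP.1]

theorem IsProjContinuous.F_mul (hP : A.IsProjContinuous P) (d : Fin A.quad.nDir) :
    A.F d * P = 0 := by
  refine Matrix.eq_of_forall_dotProduct_mulVec fun x y => ?_
  rw [← Matrix.mulVec_mulVec, dotProduct_F_mulVec,
    DGMesh.upwindForm_eq_zero _ _ (hP.continuousZeroBoundary y)]
  simp

theorem dotProduct_transpose_mul_mulVec (P B : A.Mat) (x y : Fin A.N → ℝ) :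
    x ⬝ᵥ (Pᵀ * B) *ᵥ y = (P *ᵥ x) ⬝ᵥ B *ᵥ y := by
  rw [← Matrix.mulVec_mulVec, Matrix.dotProduct_mulVec, Matrix.vecMul_transpose]

theorem IsProjContinuous.transpose_mul_Ftilde (hP : A.IsProjContinuous P)
    (d : Fin A.quad.nDir) : Pᵀ * A.Ftilde d = 0 := by
  refine Matrix.eq_of_forall_dotProduct_mulVec fun x y => ?_
  rw [dotProduct_transpose_mul_mulVec, dotProduct_Ftilde_mulVec,
    DGMesh.upwindFormTilde_eq_zero _ _ _ (hP.continuousZeroBoundary x)]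
  simp

theorem IsProjContinuous.transpose_mul_F0 (hP : A.IsProjContinuous P) : Pᵀ * A.F0 = 0 := by
  refine Matrix.eq_of_forall_dotProduct_mulVec fun x y => ?_
  rw [dotProduct_transpose_mul_mulVec, dotProduct_F0_mulVec,
    DGMesh.faceSum_eq_zero A.quad.isFaceForm_jumpWeight _
      (Or.inr ⟨hP.continuousZeroBoundary x, fun n a b d => by ring⟩)]
  simp

theorem IsProjContinuous.F0_mul (hP : A.IsProjContinuous P) : A.F0 * P = 0 := by
  simp [F0, Finset.sum_mul, hP.F_mul]

theorem IsProjContinuous.F1_mul (hP : A.IsProjContinuous P) (j : Fin 3) : A.F1 j * P = 0 := by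
  simp [F1, Finset.sum_mul, hP.F_mul]

theorem IsProjContinuous.transpose_mul_F1tilde (hP : A.IsProjContinuous P) (j : Fin 3) :
    Pᵀ * A.F1tilde j = 0 := by
  simp [F1tilde, Finset.mul_sum, hP.transpose_mul_Ftilde]

/-- This is the integration by parts against continuous test functions in matrix form. -/
theorem IsProjContinuous.transpose_mul_ΩG_add_F (hP : A.IsProjContinuous P)
    (d : Fin A.quad.nDir) : Pᵀ * (A.ΩG d + A.F d) = -(Pᵀ * (A.ΩG d)ᵀ) := by
  refine Matrix.eq_of_forall_dotProduct_mulVec fun x y => ?_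
  rw [Matrix.neg_mulVec, dotProduct_neg, dotProduct_transpose_mul_mulVec,
    dotProduct_transpose_mul_mulVec, Matrix.add_mulVec, dotProduct_add, dotProduct_ΩG_mulVec,
    dotProduct_F_mulVec, DGMesh.dirDerivForm_add_upwindForm _ _ _ (hP.continuousZeroBoundary x),
    ← dotProduct_ΩG_mulVec, Matrix.mulVec_transpose, dotProduct_comm (P *ᵥ x),
    Matrix.dotProduct_mulVec]

theorem sum_weight_smul_ΩG : ∑ d, A.quad.weight d • A.ΩG d = 0 := by
  simp_rw [ΩG, Finset.smul_sum, smul_smul]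
  rw [Finset.sum_comm]
  refine Finset.sum_eq_zero fun j _ => ?_
  rw [← Finset.sum_smul, A.quad.sum_weight_mul_dir, zero_smul]

theorem mean_ΩG_add_F :
    (1 / (4 * Real.pi)) • ∑ d, A.quad.weight d • (A.ΩG d + A.F d) = A.F0 := by
  simp_rw [smul_add, Finset.sum_add_distrib, sum_weight_smul_ΩG, zero_add]
  rfl

/-- The isotropic second moment removes the mixed terms of the double sum and leaves the factor
`1/3`. -/
theorem mean_transpose_ΩG_mul (B : A.Mat) :
    (1 / (4 * Real.pi)) • ∑ d, A.quad.weight d • ((A.ΩG d)ᵀ * B * A.ΩG d)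
      = (1 / 3 : ℝ) • ∑ j, (A.G j)ᵀ * B * A.G j := by
  have h1 : ∀ d, A.quad.weight d • ((A.ΩG d)ᵀ * B * A.ΩG d)
      = ∑ j, ∑ k, (A.quad.weight d * (A.quad.dir d j * A.quad.dir d k)) •
        ((A.G j)ᵀ * B * A.G k) := by
    intro d
    simp only [ΩG, Matrix.transpose_sum, Matrix.transpose_smul, Finset.sum_mul, Finset.mul_sum,
      smul_mul_assoc, mul_smul_comm, Finset.smul_sum, smul_smul]
    rw [Finset.sum_comm]
    refine Finset.sum_congr rfl fun j _ => Finset.sum_congr rfl fun k _ => ?_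
    congr 1
    ring
  simp_rw [h1]
  rw [Finset.sum_comm]
  have h2 : ∀ j, ∑ d, ∑ k, (A.quad.weight d * (A.quad.dir d j * A.quad.dir d k)) •
        ((A.G j)ᵀ * B * A.G k) = (4 * Real.pi / 3) • ((A.G j)ᵀ * B * A.G j) := by
    intro j
    rw [Finset.sum_comm]
    simp_rw [← Finset.sum_smul, A.quad.sum_weight_mul, ite_smul, zero_smul]
    simp
  simp_rw [h2]
  rw [← Finset.smul_sum, smul_smul]
  congr 1
  field_simp

theorem mean_transpose_ΩG_mul_F (B : A.Mat) :
    (1 / (4 * Real.pi)) • ∑ d, A.quad.weight d • ((A.ΩG d)ᵀ * B * A.F d)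
      = ∑ j, (A.G j)ᵀ * B * A.F1 j := by
  simp only [ΩG, F1, Matrix.transpose_sum, Matrix.transpose_smul, Finset.sum_mul, Finset.mul_sum,
      smul_mul_assoc, mul_smul_comm, Finset.smul_sum, smul_smul]
  rw [Finset.sum_comm]

/-- Tested with continuous functions, the second-order term of the source iteration is the
diffusion operator. -/
theorem IsProjContinuous.transpose_mul_second_order (hP : A.IsProjContinuous P) :
    Pᵀ * (A.Ma - (1 / (4 * Real.pi)) • ∑ d, A.quad.weight d •
      ((A.ΩG d + A.F d) * A.Mt⁻¹ * (A.ΩG d + A.F d))) = Pᵀ * A.D0 := by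
  have h1 : ∀ d, Pᵀ * (A.quad.weight d • ((A.ΩG d + A.F d) * A.Mt⁻¹ * (A.ΩG d + A.F d)))
      = -(Pᵀ * (A.quad.weight d • ((A.ΩG d)ᵀ * A.Mt⁻¹ * A.ΩG d)
        + A.quad.weight d • ((A.ΩG d)ᵀ * A.Mt⁻¹ * A.F d))) := by
    intro d
    rw [← smul_add, ← mul_add, mul_smul_comm, mul_smul_comm, ← smul_neg]
    simp only [← mul_assoc]
    rw [hP.transpose_mul_ΩG_add_F]
    simp only [neg_mul]
  have h2 : Pᵀ * ((1 / (4 * Real.pi)) • ∑ d, A.quad.weight d •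
      ((A.ΩG d + A.F d) * A.Mt⁻¹ * (A.ΩG d + A.F d)))
      = -(Pᵀ * ((1 / 3 : ℝ) • (∑ j, (A.G j)ᵀ * A.Mt⁻¹ * A.G j)
        + ∑ j, (A.G j)ᵀ * A.Mt⁻¹ * A.F1 j)) := by
    rw [mul_smul_comm, Finset.mul_sum]
    simp_rw [h1]
    rw [Finset.sum_neg_distrib, ← Finset.mul_sum, Finset.sum_add_distrib, smul_neg,
      ← mul_smul_comm, smul_add, mean_transpose_ΩG_mul, mean_transpose_ΩG_mul_F]
  -- The `F̃` term of `D0` is not produced by the expansion; `Pᵀ` does not see it.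
  have h3 : Pᵀ * ∑ j, A.F1tilde j * A.Mt⁻¹ * A.G j = 0 := by
    rw [Finset.mul_sum]
    refine Finset.sum_eq_zero fun j _ => ?_
    rw [← mul_assoc, ← mul_assoc, hP.transpose_mul_F1tilde, zero_mul, zero_mul]
  rw [mul_sub, h2, D0]
  simp only [mul_add, mul_sub, h3]
  abel

/-- A vector in the range of `1 - P` with zero penalty energy has no jumps, so it is continuous with
zero boundary values and fixed by `P`. Both together make it zero. -/
theorem IsProjContinuous.bijective_compression_F0 (hP : A.IsProjContinuous P) :
    Function.Bijective (compression (1 - P) A.F0) := by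
  refine compression_bijective ?_ fun x hx h0 => ?_
  · rw [sub_mul, mul_sub, mul_sub, hP.1]
    simp
  · rw [dotProduct_F0_mulVec, mul_eq_zero] at h0
    have h1 := h0.resolve_left (by positivity)
    have h2 := hP.mulVec_eq (DGMesh.continuousZeroBoundary_of_faceSum_eq_zero
      A.quad.jumpWeight_nonneg (fun n => A.quad.jumpWeight_pos) A.quad.isFaceForm_jumpWeight _ h1)
    rw [Matrix.sub_mulVec, Matrix.one_mulVec, h2, sub_self] at hx
    exact hx.symm

/-- On the range of `P` both flux terms have zero quadratic form. What remains is the nonnegative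
diffusion term plus a positive definite mass term. -/
theorem IsProjContinuous.bijective_compression_D0 (hP : A.IsProjContinuous P)
    (hσ : ∀ x ∈ A.mesh.domain, 0 < A.σa x) : Function.Bijective (compression P A.D0) := by
  refine compression_bijective hP.1 fun x hx h0 => ?_
  by_contra hne
  have hMa : 0 < x ⬝ᵥ A.Ma *ᵥ x := by
    have h := (posDef_mass hσ A.σa_int).dotProduct_mulVec_pos hne
    rwa [star_trivial] at h
  have h1 : ∀ j, 0 ≤ x ⬝ᵥ ((A.G j)ᵀ * A.Mt⁻¹ * A.G j) *ᵥ x := by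
    intro j
    have := posDef_Mt.inv.posSemidef.dotProduct_mulVec_nonneg (A.G j *ᵥ x)
    rw [star_trivial] at this
    rwa [mul_assoc, dotProduct_transpose_mul_mulVec, ← Matrix.mulVec_mulVec]
  have h2 : ∀ j, x ⬝ᵥ (A.F1tilde j * A.Mt⁻¹ * A.G j) *ᵥ x = 0 := by
    intro j
    conv_lhs => rw [← hx]
    rw [← dotProduct_transpose_mul_mulVec, ← mul_assoc, ← mul_assoc, hP.transpose_mul_F1tilde]
    simp
  have h3 : ∀ j, x ⬝ᵥ ((A.G j)ᵀ * A.Mt⁻¹ * A.F1 j) *ᵥ x = 0 := by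
    intro j
    have h4 : A.F1 j *ᵥ x = 0 := by
      rw [← hx, Matrix.mulVec_mulVec, hP.F1_mul, Matrix.zero_mulVec]
    rw [← Matrix.mulVec_mulVec, h4]
    simp
  have h5 : x ⬝ᵥ A.D0 *ᵥ x = (1 / 3 : ℝ) * (∑ j, x ⬝ᵥ ((A.G j)ᵀ * A.Mt⁻¹ * A.G j) *ᵥ x)
      + x ⬝ᵥ A.Ma *ᵥ x := by
    simp only [D0, Matrix.add_mulVec, Matrix.sub_mulVec, Matrix.smul_mulVec, Matrix.sum_mulVec,
      dotProduct_add, dotProduct_sub, dotProduct_smul, dotProduct_sum, h2, h3, smul_eq_mul,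
      Finset.sum_const_zero, sub_zero, add_zero]
  have h6 : 0 ≤ ∑ j, x ⬝ᵥ ((A.G j)ᵀ * A.Mt⁻¹ * A.G j) *ᵥ x := Finset.sum_nonneg fun j _ => h1 j
  linarith

theorem IsProjContinuous.EP_mul_F0 (hP : A.IsProjContinuous P) : A.EP P * A.F0 = 0 := by
  rw [EP, ← projSolve_mul_transpose _ hP.1, mul_assoc, hP.transpose_mul_F0, mul_zero]

/-- The solve gives `E_Q F₀ Q = Q`, and the trailing `Q` may be omitted since `F₀ P = 0`. -/
theorem IsProjContinuous.EQ_mul_F0 (hP : A.IsProjContinuous P) : A.EQ P * A.F0 = 1 - P := by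
  have hQ : (1 - P) * (1 - P) = 1 - P := by
    rw [sub_mul, mul_sub, mul_sub, hP.1]
    simp
  have h := projSolve_mul_mul hQ hP.bijective_compression_F0
  rwa [mul_sub, mul_one, mul_assoc, hP.F0_mul, mul_zero, sub_zero] at h

theorem IsProjContinuous.isBigO (hP : A.IsProjContinuous P)
    (h : Function.Bijective (compression P A.D0)) (m n : Fin A.N) :
    (fun ε : ℝ => ((1 / ε) • (A.E P ε * A.Mt * (1 - A.S ε)) - 1) m n)
        =O[𝓝[>] 0] fun ε : ℝ => ε := by
  have hMt : A.Mt * A.Mt⁻¹ = 1 := Matrix.mul_nonsing_inv _ isUnit_det_Mt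
  have hfirst : A.Mt * ((1 / (4 * Real.pi)) • ∑ d, A.quad.weight d •
      (A.Mt⁻¹ * (A.ΩG d + A.F d))) = A.F0 := by
    rw [← mean_ΩG_add_F, mul_smul_comm, Finset.mul_sum]
    simp_rw [mul_smul_comm, ← mul_assoc, hMt, one_mul]
  have hsecond : A.Mt * (A.Mt⁻¹ * A.Ma - (1 / (4 * Real.pi)) • ∑ d, A.quad.weight d •
      ((A.Mt⁻¹ * (A.ΩG d + A.F d)) * (A.Mt⁻¹ * (A.ΩG d + A.F d))))
      = A.Ma - (1 / (4 * Real.pi)) • ∑ d, A.quad.weight d •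
        ((A.ΩG d + A.F d) * A.Mt⁻¹ * (A.ΩG d + A.F d)) := by
    rw [mul_sub, mul_smul_comm, Finset.mul_sum]
    simp_rw [mul_smul_comm, ← mul_assoc, hMt, one_mul]
  have hEPD : A.EP P * (A.Ma - (1 / (4 * Real.pi)) • ∑ d, A.quad.weight d •
        ((A.ΩG d + A.F d) * A.Mt⁻¹ * (A.ΩG d + A.F d))) = A.EP P * A.D0 := by
    rw [EP, ← projSolve_mul_transpose _ hP.1, mul_assoc, hP.transpose_mul_second_order, mul_assoc]
  refine preconditioned_isBigO A.quad.weight (1 / (4 * Real.pi))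
    (fun d => A.Mt⁻¹ * (A.ΩG d + A.F d)) (A.Mt⁻¹ * A.Ma) A.Mt (A.EP P)
    ((1 - A.EP P * A.D0) * A.EQ P * (1 - A.D0 * A.EP P)) ?_ ?_ ?_ m n
  · rw [A.quad.sum_weight]
    field_simp
  · rw [mul_assoc, hfirst, hP.EP_mul_F0]
  -- The right factor of `C` disappears because `E_P F₀ = 0`. The rest is `E_P D₀ + (1 - E_P D₀)(1 -
  -- P)`, which is `1` since `E_P D₀ P = P`.
  · rw [mul_assoc, hsecond, hEPD, mul_assoc _ A.Mt, hfirst, mul_assoc _ _ A.F0, sub_mul 1 _ A.F0,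
      mul_assoc A.D0, hP.EP_mul_F0, mul_zero, sub_zero, one_mul, mul_assoc, hP.EQ_mul_F0, sub_mul,
      mul_sub (A.EP P * A.D0), mul_one, one_mul, EP, projSolve_mul_mul hP.1 h]
    abel

end Projection

end TransportDG

theorem theorem2 (A : TransportDG) (P : A.Mat) (hP : A.IsProjContinuous P) :
    Function.Bijective (compression (1 - P) A.F0) ∧
    ((∀ x ∈ A.mesh.domain, 0 < A.σa x) → Function.Bijective (compression P A.D0)) ∧
    (Function.Bijective (compression P A.D0) →
      ∀ m n, (fun ε : ℝ => ((1 / ε) • (A.E P ε * A.Mt * (1 - A.S ε)) - 1) m n)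
        =O[𝓝[>] 0] fun ε : ℝ => ε) :=
  ⟨hP.bijective_compression_F0, hP.bijective_compression_D0, fun h m n => hP.isBigO h m n⟩
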